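/- Let $(\Omega,\mathcal F,(\mathcal F_n)_{n\in\mathbb N_0},\mathbb P)$ be a filtered probability space, $\mathcal F_\infty=\bigvee_n\mathcal F_n$, and $d\in\mathbb N$. Let $(\gamma_n)_{n\in\mathbb N}$ be a monotonically decreasing sequence of nonnegative reals converging to $0$, let $(b_n)_{n\in\mathbb N}$ and $(\delta_n)_{n\in\mathbb N}$ be sequences of strictly positive reals, and let $(n_0(n))_{n\in\mathbb N}$ be an increasing (not necessarily strictly) $\mathbb N_0$-valued sequence tending to infinity with $n_0(n)\le n$ for all $n$ and $n_0(n)<n$ for all sufficiently large $n$. Put $$\bar b_n=\sum_{i=n_0(n)+1}^n b_i,\qquad \sigma_n=\frac1{\bar b_n}\sqrt{\sum_{m=n_0(n)+1}^n (b_m\delta_m)^2}.$$ For each $n\in\mathbb N$ let $H_n$ be a random symmetric $d\times d$ matrix that is $\mathcal F_{n_0(n)}$-measurable, and set, for $i\le j$, $$\mathcal H_n[i,j]=\prod_{r=i+1}^j(I+\gamma_rH_n),\qquad \bar{\mathcal H}_n[i,j]=\sum_{r=i}^j\frac{\gamma_i b_r}{b_i}\,\mathcal H_n[i,r].$$ Let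 $(\mathcal D_k)_{k\in\mathbb N}$ be a sequence of square integrable $\mathbb R^d$-valued martingale differences with respect to $(\mathcal F_k)$, and define $$\Xi_n=\frac1{\bar b_n}\sum_{i=n_0(n)+1}^n b_i\,\bar{\mathcal H}_n[i,n]\,\mathcal D_i .$$ Let $A\in\mathcal F_\infty$ and assume the following. 1. $n\gamma_n\to\infty$, $\ \dfrac{b_{n+1}\gamma_n}{b_n\gamma_{n+1}}=1+o(\gamma_n)$, and for every sequence of integers $(L(n))_{n\in\mathbb N}$ with $n_0(n)\le L(n)\le n$ and $n-L(n)=o(n)$, $$\lim_{n\to\infty}\frac{\sum_{k=L(n)+1}^n(b_k\delta_k)^2}{\sum_{k=n_0(n)+1}^n(b_k\delta_k)^2}=0.$$ 2. There is a random matrix $H$ such that, almost surely on $A$, $H$ is symmetric with $\max\sigma(H)<0$ (where $\sigma(H)$ is the spectrum of $H$) and $H_n\to H$. 3. There is a random matrix $\Gamma$ such that (a) almost surely on $A$, $\ \lim_{m\to\infty}\|\operatorname{cov}(\delta_m^{-1}\mathcal D_m\mid\mathcal F_{m-1})-\Gamma\|=0$; (b) for every $\varepsilon>0$, $$\sigma_n^{-2}\sum_{m=n_0(n)+1}^n\frac{b_m^2}{\bar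 b_n^2}\,\mathbb E\Bigl[\mathbf 1_{\{|\mathcal D_m|>\varepsilon\bar b_n\sigma_n/b_m\}}|\mathcal D_m|^2\Bigm|\mathcal F_{m-1}\Bigr]\longrightarrow0\quad\text{in probability on }A,$$ where $X_n\to0$ in probability on $A$ means $\mathbb P(\{|X_n|>\eta\}\cap A)\to0$ for every $\eta>0$. Then $\sigma_n^{-1}\Xi_n$ converges stably on $A$ to $H^{-1}\,\mathcal N(0,\Gamma)$: for every $B\in\mathcal F$ and every bounded continuous $f:\mathbb R^d\to\mathbb R$, $$\lim_{n\to\infty}\mathbb E\bigl[\mathbf 1_{A\cap B}\,f(\sigma_n^{-1}\Xi_n)\bigr]=\mathbb E\Bigl[\mathbf 1_{A\cap B}\int f(y)\,K(\cdot,dy)\Bigr],$$ where $K(\omega,\cdot)$ is the image of the centred Gaussian law with covariance matrix $\Gamma(\omega)$ under the linear map $H(\omega)^{-1}$. -/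

import Mathlib

open MeasureTheory ProbabilityTheory Filter Asymptotics
open scoped Topology BoundedContinuousFunction

/-- `(Y n)` converges stably on the event `A` to the probability kernel `K`: for every event `B` and
every bounded continuous `f`,
`lim E[1_{A ∩ B} f(Y n)] = E[1_{A ∩ B} ∫ f(y) K(·, dy)]`.
Only the restriction of `K` to `A` enters. -/
def StablyConvergesOn {Ω E : Type*} [MeasurableSpace Ω] [TopologicalSpace E] [MeasurableSpace E]
    (P : Measure Ω) (A : Set Ω) (Y : ℕ → Ω → E) (K : Kernel Ω E) [IsMarkovKernel K] : Prop :=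
  ∀ B : Set Ω, MeasurableSet B → ∀ f : E →ᵇ ℝ,
    Tendsto (fun n => ∫ ω in A ∩ B, f (Y n ω) ∂P) atTop
      (𝓝 (∫ ω in A ∩ B, (∫ y, f y ∂(K ω)) ∂P))

/-- The conditional covariance matrix `cov(X | m)` of a random vector `X`, with entries
`E[(X_i - E[X_i | m]) (X_j - E[X_j | m]) | m]`. -/
noncomputable def condCovMatrix {Ω : Type*} [mΩ : MeasurableSpace Ω] {d : ℕ} (P : Measure Ω)
    (m : MeasurableSpace Ω) (X : Ω → EuclideanSpace ℝ (Fin d)) (ω : Ω) :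
    Matrix (Fin d) (Fin d) ℝ :=
  Matrix.of fun i j =>
    (condExp (E := ℝ) m P fun ω' => (X ω' i - condExp (E := ℝ) m P (fun ω'' => X ω'' i) ω') *
      (X ω' j - condExp (E := ℝ) m P (fun ω'' => X ω'' j) ω')) ω

/-- `𝓗[i,j] = ∏_{r=i+1}^j (1 + γ_r M)` (the factors commute). -/
noncomputable def matProd {d : ℕ} (γ : ℕ → ℝ) (M : Matrix (Fin d) (Fin d) ℝ) (i j : ℕ) :
    Matrix (Fin d) (Fin d) ℝ :=
  ((List.Ico (i + 1) (j + 1)).map fun r => 1 + γ r • M).prod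

/-- `𝓗̄[i,j] = ∑_{r=i}^j (γ_i b_r / b_i) 𝓗[i,r]`. -/
noncomputable def matProdBar {d : ℕ} (γ b : ℕ → ℝ) (M : Matrix (Fin d) (Fin d) ℝ) (i j : ℕ) :
    Matrix (Fin d) (Fin d) ℝ :=
  ∑ r ∈ Finset.Icc i j, (γ i * b r / b i) • matProd γ M i r

/-- `b̄_n = ∑_{i=n₀(n)+1}^n b_i`. -/
noncomputable def bBar (b : ℕ → ℝ) (n₀ : ℕ → ℕ) (n : ℕ) : ℝ :=
  ∑ i ∈ Finset.Ioc (n₀ n) n, b i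

/-- `σ_n = b̄_n⁻¹ √(∑_{m=n₀(n)+1}^n (b_m δ_m)²)`. -/
noncomputable def sigmaSeq (b δ : ℕ → ℝ) (n₀ : ℕ → ℕ) (n : ℕ) : ℝ :=
  1 / bBar b n₀ n * √(∑ m ∈ Finset.Ioc (n₀ n) n, (b m * δ m) ^ 2)

/-- `Ξ_n = b̄_n⁻¹ ∑_{i=n₀(n)+1}^n b_i 𝓗̄_n[i,n] 𝒟_i`. -/
noncomputable def xiSeq {Ω : Type*} {d : ℕ} (γ b : ℕ → ℝ) (n₀ : ℕ → ℕ)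
    (H : ℕ → Ω → Matrix (Fin d) (Fin d) ℝ) (D : ℕ → Ω → EuclideanSpace ℝ (Fin d))
    (n : ℕ) (ω : Ω) : EuclideanSpace ℝ (Fin d) :=
  (1 / bBar b n₀ n) • ∑ i ∈ Finset.Ioc (n₀ n) n,
    b i • Matrix.toEuclideanCLM (𝕜 := ℝ) (matProdBar γ b (H n ω) i n) (D i ω)

section GaussianKernel

open scoped MatrixOrder in
theorem measurable_sqrt_matrix {Ω : Type*} [MeasurableSpace Ω] {d : ℕ}
    (S : Ω → Matrix (Fin d) (Fin d) ℝ) (hS : ∀ i j, Measurable fun ω => S ω i j) (i j : Fin d) :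
    Measurable fun ω => CFC.sqrt (S ω) i j := by
  let : MeasurableSpace (Matrix (Fin d) (Fin d) ℝ) := borel _
  have : BorelSpace (Matrix (Fin d) (Fin d) ℝ) := ⟨rfl⟩
  have hpi : borel (Matrix (Fin d) (Fin d) ℝ)
      = (inferInstance : MeasurableSpace (Fin d → Fin d → ℝ)) :=
    (BorelSpace.measurable_eq (α := Fin d → Fin d → ℝ)).symm
  have hSm : Measurable S := by
    have h : @Measurable Ω (Fin d → Fin d → ℝ) _ _ S :=
      measurable_pi_iff.2 fun i => measurable_pi_iff.2 fun j => hS i j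
    change @Measurable Ω _ _ (borel _) S
    rw [hpi]
    exact h
  have hclosed : IsClosed {a : Matrix (Fin d) (Fin d) ℝ | 0 ≤ a} := by
    have he : {a : Matrix (Fin d) (Fin d) ℝ | 0 ≤ a}
        = {a | star a = a} ∩ ⋂ x : Fin d → ℝ, {a | 0 ≤ x ⬝ᵥ a.mulVec x} := by
      ext a
      simp only [Matrix.nonneg_iff_posSemidef, Matrix.posSemidef_iff_dotProduct_mulVec,
        Set.mem_ofPred_eq, Set.mem_inter_iff, Set.mem_iInter, star_trivial]
      rfl
    rw [he]
    refine (isClosed_eq continuous_star continuous_id).inter (isClosed_iInter fun x => ?_)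
    refine isClosed_le continuous_const ?_
    exact Continuous.dotProduct continuous_const (Continuous.matrix_mulVec continuous_id continuous_const)
  have hsqrt : Measurable (CFC.sqrt : Matrix (Fin d) (Fin d) ℝ → _) := by
    classical
    open scoped Matrix.Norms.L2Operator in
    have h := (CFC.continuousOn_sqrt (A := Matrix (Fin d) (Fin d) ℝ)).measurable_piecewise
      (g := fun _ => 0) continuousOn_const hclosed.measurableSet
    refine (congrArg Measurable ?_).mp h
    funext a
    by_cases ha : 0 ≤ a
    · exact Set.piecewise_eq_of_mem _ _ _ ha
    · have h0 := Set.piecewise_eq_of_notMem {a : Matrix (Fin d) (Fin d) ℝ | 0 ≤ a} CFC.sqrt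
        (fun _ => 0) (i := a) ha
      exact h0.trans (CFC.sqrt_of_not_nonneg ha).symm
  have hentry : Measurable fun a : Matrix (Fin d) (Fin d) ℝ => a i j :=
    Continuous.measurable (by fun_prop)
  exact hentry.comp (hsqrt.comp hSm)

theorem measurable_inv_matrix {Ω : Type*} [MeasurableSpace Ω] {d : ℕ}
    (S : Ω → Matrix (Fin d) (Fin d) ℝ) (hS : ∀ i j, Measurable fun ω => S ω i j) (i j : Fin d) :
    Measurable fun ω => (S ω)⁻¹ i j := by
  have hdet : ∀ T : Ω → Matrix (Fin d) (Fin d) ℝ, (∀ i j, Measurable fun ω => T ω i j) →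
      Measurable fun ω => (T ω).det := by
    intro T hT
    simp only [Matrix.det_apply]
    exact Finset.measurable_sum _ fun p _ =>
      (Finset.measurable_prod _ fun k _ => hT _ _).const_smul _
  simp only [Matrix.inv_def, Ring.inverse_eq_inv', Matrix.smul_apply, smul_eq_mul,
    Matrix.adjugate_apply]
  refine (hdet S hS).inv.mul (hdet _ fun k l => ?_)
  by_cases hk : k = j
  · subst hk
    simp
  · simpa [Matrix.updateRow_ne hk] using hS k l

theorem measurable_map_matrix {Ω : Type*} [MeasurableSpace Ω] {d : ℕ}
    (S : Ω → Matrix (Fin d) (Fin d) ℝ) (hS : ∀ i j, Measurable fun ω => S ω i j)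
    (ν : Measure (EuclideanSpace ℝ (Fin d))) [SFinite ν] :
    Measurable fun ω => ν.map (Matrix.toEuclideanCLM (𝕜 := ℝ) (S ω)) := by
  have hjoint : Measurable (Function.uncurry fun (ω : Ω) (x : EuclideanSpace ℝ (Fin d)) =>
      Matrix.toEuclideanCLM (𝕜 := ℝ) (S ω) x) := by
    have h2 : Measurable fun p : Ω × EuclideanSpace ℝ (Fin d) =>
        (S p.1).mulVec (WithLp.ofLp p.2) := by
      refine measurable_pi_iff.2 fun i => ?_
      simp only [Matrix.mulVec, dotProduct]
      refine Finset.measurable_sum _ fun j _ => ((hS i j).comp measurable_fst).mul ?_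
      have : Measurable fun x : EuclideanSpace ℝ (Fin d) => x j :=
        Continuous.measurable (by fun_prop)
      exact this.comp measurable_snd
    exact (WithLp.measurable_toLp 2 (Fin d → ℝ)).comp h2
  refine Measure.measurable_of_measurable_coe _ fun s hs => ?_
  have h3 := measurable_measure_prodMk_left (ν := ν) (measurableSet_preimage hjoint hs)
  have h4 : ∀ ω, (ν.map (Matrix.toEuclideanCLM (𝕜 := ℝ) (S ω))) s = ν (Prod.mk ω ⁻¹'
      ((Function.uncurry fun (ω : Ω) (x : EuclideanSpace ℝ (Fin d)) =>
        Matrix.toEuclideanCLM (𝕜 := ℝ) (S ω) x) ⁻¹' s)) := by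
    intro ω
    rw [Measure.map_apply (ContinuousLinearMap.measurable _) hs]
    rfl
  simpa only [h4] using h3

open scoped MatrixOrder in
theorem measurable_gaussianImage {Ω : Type*} [MeasurableSpace Ω] {d : ℕ}
    (T Γ : Ω → Matrix (Fin d) (Fin d) ℝ) (hT : ∀ i j, Measurable fun ω => T ω i j)
    (hΓ : ∀ i j, Measurable fun ω => Γ ω i j) :
    Measurable fun ω => (multivariateGaussian 0 (Γ ω)).map
      (Matrix.toEuclideanCLM (𝕜 := ℝ) (T ω)) := by
  have hprod : ∀ i j, Measurable fun ω => (T ω * CFC.sqrt (Γ ω)) i j := fun i j => by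
    simp only [Matrix.mul_apply]
    exact Finset.measurable_sum _ fun k _ => (hT i k).mul (measurable_sqrt_matrix Γ hΓ k j)
  have h := measurable_map_matrix (fun ω => T ω * CFC.sqrt (Γ ω)) hprod
    (stdGaussian (EuclideanSpace ℝ (Fin d)))
  have h4 : ∀ ω, (multivariateGaussian 0 (Γ ω)).map (Matrix.toEuclideanCLM (𝕜 := ℝ) (T ω))
      = (stdGaussian (EuclideanSpace ℝ (Fin d))).map
        (Matrix.toEuclideanCLM (𝕜 := ℝ) (T ω * CFC.sqrt (Γ ω))) := by
    intro ω
    rw [multivariateGaussian, Measure.map_map (ContinuousLinearMap.measurable _)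
      ((ContinuousLinearMap.measurable _).const_add 0), map_mul]
    congr 1
    funext x
    simp
  simpa only [h4] using h

/-- The random distribution `T 𝓝(0, Γ)` for random matrices `T` and `Γ`: the kernel whose value
at `ω` is the image under `T ω` of the centred Gaussian law with covariance matrix `Γ ω`. -/
noncomputable def gaussianImageKernel {Ω : Type*} [MeasurableSpace Ω] {d : ℕ}
    (T Γ : Ω → Matrix (Fin d) (Fin d) ℝ) (hT : ∀ i j, Measurable fun ω => T ω i j)
    (hΓ : ∀ i j, Measurable fun ω => Γ ω i j) : Kernel Ω (EuclideanSpace ℝ (Fin d)) where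
  toFun ω := (multivariateGaussian 0 (Γ ω)).map (Matrix.toEuclideanCLM (𝕜 := ℝ) (T ω))
  measurable' := measurable_gaussianImage T Γ hT hΓ

instance isMarkovKernel_gaussianImageKernel {Ω : Type*} [MeasurableSpace Ω] {d : ℕ}
    (T Γ : Ω → Matrix (Fin d) (Fin d) ℝ) (hT : ∀ i j, Measurable fun ω => T ω i j)
    (hΓ : ∀ i j, Measurable fun ω => Γ ω i j) : IsMarkovKernel (gaussianImageKernel T Γ hT hΓ) :=
  ⟨fun ω => Measure.isProbabilityMeasure_map (μ := multivariateGaussian 0 (Γ ω))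
    (ContinuousLinearMap.measurable _).aemeasurable⟩

end GaussianKernel

/-! Write `s_n = b̄_n σ_n`. Then `σ_n⁻¹ Ξ_n = ∑ (b_i / s_n) 𝓗̄_n[i,n] 𝒟_i`, and since `H_n` is known
at time `n₀(n) < i`, the coefficients are predictable: tested against a vector `u`, this is an array
of martingale differences. The heart of the matter is that `𝓗̄_n[i,n]` is close to `-H⁻¹` for most
`i`.

With `Q_r = (γ_i b_r / (b_i γ_r)) 𝓗[i,r]` one has `𝓗̄[i,n] = ∑ γ_r Q_r` and `Q_{r+1} - Q_r ≈ γ_{r+1}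
Q_r M`, so `𝓗̄[i,n] M` telescopes to `Q_n - 1` up to small errors
(`norm_matProdBar_mul_add_one_sub_le`). If `M` is negative definite, `Q_n` decays like `exp (-μ
∑_{i<k≤n} γ_k)`. As `n γ_n → ∞`, this sum is large for all `i ≤ L(n)` with some `n - L(n) = o(n)`
(`exists_cutoff`). The remaining indices carry a vanishing share of `∑ (b_k δ_k)²`, and there `𝓗̄`
is merely bounded. Hence the conditional variance converges to `V = ⟪u, H⁻¹ Γ H⁻ᵀ u⟫`
(`tendsto_weighted_sum`).

The central limit theorem `tendsto_setIntegral_exp_sum_mul_I` compares `exp (i S_n + V_n / 2)` with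
a martingale, stopped so as to stay bounded (`IsMartingaleDiffOn.exists_bounded_expMart`). The limit
variance is random and the event arbitrary, but both enter through one bounded test variable, which
`ℱ_{n₀(n)}` approximates well enough because `n₀(n) → ∞` (`norm_integral_smul_sub_le_of_approx`).

Uniform negative definiteness of `H_n` and boundedness of `V` hold only on events exhausting `A`
(`tendsto_setIntegral_of_exhaustion`). Convergence of characteristic functions on every event then
gives stable convergence (`stablyConvergesOn_of_charFun`). -/

/-! ### Products of contracting matrices and the approximation `𝓗̄ ≈ -M⁻¹`. -/

section MatrixProducts

open scoped Matrix.Norms.L2Operator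

/-- The matrices of norm at most `Λ` whose quadratic form is at most `-l ‖x‖²`. -/
def dissipativeMatrices (d : ℕ) (l Λ : ℝ) : Set (Matrix (Fin d) (Fin d) ℝ) :=
  {M | ‖M‖ ≤ Λ ∧ ∀ x : EuclideanSpace ℝ (Fin d),
    inner ℝ x (Matrix.toEuclideanCLM (𝕜 := ℝ) M x) ≤ -l * ‖x‖ ^ 2}

variable {d : ℕ} {l Λ : ℝ} {M : Matrix (Fin d) (Fin d) ℝ}

theorem norm_one_matrix_le : ‖(1 : Matrix (Fin d) (Fin d) ℝ)‖ ≤ 1 := by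
  rw [Matrix.cstar_norm_def, map_one]
  exact ContinuousLinearMap.norm_id_le

/-- Expanding the square, `‖x + t M x‖² ≤ (1 - 2 t l + t² Λ²) ‖x‖² ≤ (1 - t l) ‖x‖² ≤ (1 - t l / 2)²
‖x‖²`; the condition `t l ≤ 2` keeps the bound nonnegative. -/
theorem norm_one_add_smul_le (hM : M ∈ dissipativeMatrices d l Λ) {t : ℝ} (ht : 0 ≤ t)
    (h1 : t * Λ ^ 2 ≤ l) (h2 : t * l ≤ 2) : ‖1 + t • M‖ ≤ 1 - t * l / 2 := by
  rw [Matrix.cstar_norm_def]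
  refine ContinuousLinearMap.opNorm_le_bound _ (by linarith) fun x => ?_
  have hMx : ‖Matrix.toEuclideanCLM (𝕜 := ℝ) M x‖ ≤ Λ * ‖x‖ :=
    (ContinuousLinearMap.le_opNorm _ x).trans
      (mul_le_mul_of_nonneg_right (by rw [← Matrix.cstar_norm_def]; exact hM.1) (norm_nonneg x))
  have he : Matrix.toEuclideanCLM (𝕜 := ℝ) (1 + t • M) x
      = x + t • Matrix.toEuclideanCLM (𝕜 := ℝ) M x := by
    simp
  rw [he]
  refine le_of_sq_le_sq ?_ (mul_nonneg (by linarith) (norm_nonneg x))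
  rw [norm_add_sq_real, inner_smul_right, norm_smul, Real.norm_of_nonneg ht]
  have h3 := hM.2 x
  have h4 : ‖Matrix.toEuclideanCLM (𝕜 := ℝ) M x‖ ^ 2 ≤ Λ ^ 2 * ‖x‖ ^ 2 := by
    rw [← mul_pow]; exact pow_le_pow_left₀ (norm_nonneg _) hMx 2
  have h5 := mul_le_mul_of_nonneg_left h3 ht
  have h6 := mul_le_mul_of_nonneg_left h4 (sq_nonneg t)
  have h7 := mul_le_mul_of_nonneg_right h1 (mul_nonneg ht (sq_nonneg ‖x‖))
  nlinarith [mul_nonneg (sq_nonneg (t * l)) (sq_nonneg ‖x‖)]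

variable {γ b : ℕ → ℝ} {i : ℕ}

theorem matProd_self : matProd γ M i i = 1 := by simp [matProd]

theorem matProd_succ {r : ℕ} (hr : i ≤ r) :
    matProd γ M i (r + 1) = matProd γ M i r * (1 + γ (r + 1) • M) := by
  rw [matProd, List.Ico.succ_top (by omega), List.map_append, List.prod_append]
  simp [matProd]

/-- The summands of `matProdBar` divided by the step size. -/
noncomputable def scaledMatProd (γ b : ℕ → ℝ) (M : Matrix (Fin d) (Fin d) ℝ) (i r : ℕ) :
    Matrix (Fin d) (Fin d) ℝ :=
  (γ i * b r / (b i * γ r)) • matProd γ M i r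

theorem scaledMatProd_self (hγ : 0 < γ i) (hb : 0 < b i) : scaledMatProd γ b M i i = 1 := by
  rw [scaledMatProd, matProd_self, mul_comm (b i), div_self (by positivity), one_smul]

/-- Dividing by the step size makes the scalar factor exactly the quotient assumed to be `1 + o(γ)`.
-/
theorem scaledMatProd_succ (hγ : ∀ k, i ≤ k → 0 < γ k) (hb : ∀ k, i ≤ k → 0 < b k) {r : ℕ}
    (hr : i ≤ r) : scaledMatProd γ b M i (r + 1) =
      (b (r + 1) * γ r / (b r * γ (r + 1))) • (scaledMatProd γ b M i r * (1 + γ (r + 1) • M)) := by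
  rw [scaledMatProd, scaledMatProd, matProd_succ hr, smul_mul_assoc, smul_smul]
  congr 1
  have h1 := (hγ r hr).ne'
  have h2 := (hγ (r + 1) (by omega)).ne'
  have h3 := (hb r hr).ne'
  have h4 := (hb i le_rfl).ne'
  field_simp

theorem matProdBar_eq_sum (hγ : ∀ k, i ≤ k → 0 < γ k) (n : ℕ) :
    matProdBar γ b M i n = ∑ r ∈ Finset.Icc i n, γ r • scaledMatProd γ b M i r := by
  refine Finset.sum_congr rfl fun r hr => ?_
  rw [scaledMatProd, smul_smul]
  congr 1
  have h1 := (hγ r (Finset.mem_Icc.1 hr).1).ne'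
  field_simp

theorem sum_Ico_add_eq (f : ℕ → ℝ) {i r : ℕ} (h : i ≤ r) :
    ∑ k ∈ Finset.Ico i r, f k + f r = f i + ∑ k ∈ Finset.Ioc i r, f k := by
  rw [Finset.sum_Ico_add_eq_sum_Icc h, ← Finset.add_sum_Ioc_eq_sum_Icc h]

section Bounds

variable {η μ : ℝ} (hγ : ∀ k, i ≤ k → 0 < γ k) (hanti : ∀ k, i ≤ k → γ (k + 1) ≤ γ k)
  (hb : ∀ k, i ≤ k → 0 < b k)
  (he : ∀ k, i ≤ k → |b (k + 1) * γ k / (b k * γ (k + 1)) - 1| ≤ η * γ k)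
  (hM : ∀ k, i ≤ k → ‖1 + γ k • M‖ ≤ Real.exp (-(2 * μ) * γ k))
  (hη : 0 ≤ η) (hμ : 0 < μ) (hημ : η ≤ μ) (hηγ : η * γ i ≤ 1)

-- The step from `r` to `r + 1` multiplies the norm by at most `exp (η γ_r) exp (-2μ γ_{r+1})`.
-- Shifting the first exponents by one index costs at most `η γ_i ≤ 1`, whence the factor `e`, and
-- `η ≤ μ` leaves the decay rate `μ`.
include hγ hb he hM hη hημ hηγ in
theorem norm_scaledMatProd_le {r : ℕ} (hr : i ≤ r) :
    ‖scaledMatProd γ b M i r‖ ≤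
      Real.exp 1 * Real.exp (-μ * ∑ k ∈ Finset.Ioc i r, γ k) := by
  have key : ‖scaledMatProd γ b M i r‖ ≤ Real.exp (η * ∑ k ∈ Finset.Ico i r, γ k
      - 2 * μ * ∑ k ∈ Finset.Ioc i r, γ k) := by
    induction r, hr using Nat.le_induction with
    | base =>
      rw [scaledMatProd_self (hγ i le_rfl) (hb i le_rfl)]
      simpa using norm_one_matrix_le
    | succ r hr ih =>
      rw [scaledMatProd_succ hγ hb hr, norm_smul, Finset.sum_Ico_succ_top hr,
        Finset.sum_Ioc_succ_top hr]
      have h1 : ‖b (r + 1) * γ r / (b r * γ (r + 1))‖ ≤ Real.exp (η * γ r) := by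
        have h2 := he r hr
        have h3 : |b (r + 1) * γ r / (b r * γ (r + 1))| ≤ 1 + η * γ r := by
          have := abs_add_le (b (r + 1) * γ r / (b r * γ (r + 1)) - 1) 1
          rw [sub_add_cancel, abs_one] at this
          linarith
        rw [Real.norm_eq_abs]
        linarith [Real.add_one_le_exp (η * γ r)]
      calc _ ≤ Real.exp (η * γ r) * (Real.exp (η * ∑ k ∈ Finset.Ico i r, γ k
            - 2 * μ * ∑ k ∈ Finset.Ioc i r, γ k) * Real.exp (-(2 * μ) * γ (r + 1))) := by
            gcongr
            exact (norm_mul_le _ _).trans (mul_le_mul ih (hM _ (by omega)) (norm_nonneg _)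
              (Real.exp_nonneg _))
        _ = _ := by
            rw [← Real.exp_add, ← Real.exp_add]
            congr 1
            ring
  refine key.trans ?_
  rw [← Real.exp_add]
  refine Real.exp_le_exp.2 ?_
  have h1 := sum_Ico_add_eq γ hr
  have h2 : 0 ≤ ∑ k ∈ Finset.Ioc i r, γ k :=
    Finset.sum_nonneg fun k hk => (hγ k (Finset.mem_Ioc.1 hk).1.le).le
  have h3 := hγ r hr
  nlinarith [mul_nonneg hη h3.le, mul_nonneg (sub_nonneg.2 hημ) h2]

-- A Riemann sum for `∫ exp (-μ t) dt`: each term after the first is at most the increment of `-exp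
-- (-μ T) / μ` over its step, and these telescope. The first term is `γ_i`.
include hμ in
theorem sum_mul_exp_neg_le {n : ℕ} (hn : i ≤ n) :
    ∑ r ∈ Finset.Icc i n, γ r * Real.exp (-μ * ∑ k ∈ Finset.Ioc i r, γ k) ≤ γ i + 1 / μ := by
  have key : ∑ r ∈ Finset.Icc i n, γ r * Real.exp (-μ * ∑ k ∈ Finset.Ioc i r, γ k) ≤
      γ i + (1 - Real.exp (-μ * ∑ k ∈ Finset.Ioc i n, γ k)) / μ := by
    induction n, hn using Nat.le_induction with
    | base => simp
    | succ n hn ih =>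
      rw [Finset.sum_Icc_succ_top (by omega)]
      set T := ∑ k ∈ Finset.Ioc i n, γ k
      have hT : ∑ k ∈ Finset.Ioc i (n + 1), γ k = T + γ (n + 1) :=
        Finset.sum_Ioc_succ_top hn _
      rw [hT]
      set x := Real.exp (-μ * (T + γ (n + 1))) with hx
      have h1 : Real.exp (-μ * T) = x * Real.exp (μ * γ (n + 1)) := by
        rw [hx, ← Real.exp_add]; congr 1; ring
      have h2 : x * (1 + μ * γ (n + 1)) ≤ Real.exp (-μ * T) := by
        rw [h1]
        gcongr
        linarith [Real.add_one_le_exp (μ * γ (n + 1))]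
      have h3 : γ (n + 1) * x ≤ (Real.exp (-μ * T) - x) / μ := by
        rw [le_div_iff₀ hμ]; linarith
      have h4 : (1 - x) / μ = (1 - Real.exp (-μ * T)) / μ + (Real.exp (-μ * T) - x) / μ := by
        ring
      linarith
  refine key.trans ?_
  gcongr
  linarith [Real.exp_nonneg (-μ * ∑ k ∈ Finset.Ioc i n, γ k)]

include hγ hb he hM hη hμ hημ hηγ in
theorem sum_norm_scaledMatProd_le {n : ℕ} (hn : i ≤ n) :
    ∑ r ∈ Finset.Icc i n, γ r * ‖scaledMatProd γ b M i r‖ ≤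
      Real.exp 1 * (γ i + 1 / μ) := by
  refine le_trans ?_ (mul_le_mul_of_nonneg_left (sum_mul_exp_neg_le hμ hn) (Real.exp_nonneg 1))
  rw [Finset.mul_sum]
  refine Finset.sum_le_sum fun r hr => ?_
  have hr' := (Finset.mem_Icc.1 hr).1
  rw [mul_left_comm]
  exact mul_le_mul_of_nonneg_left (norm_scaledMatProd_le hγ hb he hM hη hημ hηγ hr') (hγ r hr').le

include hγ hb he hM hη hμ hημ hηγ in
theorem norm_matProdBar_le {n : ℕ} (hn : i ≤ n) :
    ‖matProdBar γ b M i n‖ ≤ Real.exp 1 * (γ i + 1 / μ) := by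
  rw [matProdBar_eq_sum hγ]
  refine (norm_sum_le _ _).trans (le_trans (Finset.sum_le_sum fun r hr => ?_)
    (sum_norm_scaledMatProd_le hγ hb he hM hη hμ hημ hηγ hn))
  rw [norm_smul, Real.norm_of_nonneg (hγ r (Finset.mem_Icc.1 hr).1).le]

-- The telescoping identity. Were all scalar factors 1, `Q_{r+1} - Q_r = γ_{r+1} Q_r M` would sum to
-- `Q_n - 1`. Two errors remain: replacing `γ_r` by `γ_{r+1}`, which telescopes to `γ_i - γ_n`
-- because `γ` decreases and `‖Q_r‖ ≤ e`, and the deviation of the scalar factors from 1, at most `η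
-- γ_r` each. The last summand `γ_n Q_n M` of `𝓗̄ M` has no partner and is subtracted.
include hγ hanti hb he hM hη hμ hημ hηγ in
theorem norm_matProdBar_mul_add_one_sub_le (hΛ : ‖M‖ ≤ Λ) {n : ℕ} (hn : i ≤ n) :
    ‖matProdBar γ b M i n * M + 1 - scaledMatProd γ b M i n
        - γ n • (scaledMatProd γ b M i n * M)‖ ≤
      Real.exp 1 * Λ * (γ i - γ n) +
        η * ∑ r ∈ Finset.Ico i n, γ r * ‖scaledMatProd γ b M i r‖ := by
  induction n, hn using Nat.le_induction with
  | base =>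
    have h0 : matProdBar γ b M i i * M + 1 - scaledMatProd γ b M i i
        - γ i • (scaledMatProd γ b M i i * M) = 0 := by
      rw [matProdBar_eq_sum hγ]
      simp [scaledMatProd_self (hγ i le_rfl) (hb i le_rfl)]
    rw [h0]
    simp
  | succ n hn ih =>
    set Q := scaledMatProd γ b M i with hQ
    have hbar : matProdBar γ b M i (n + 1) = matProdBar γ b M i n + γ (n + 1) • Q (n + 1) := by
      rw [matProdBar_eq_sum hγ, matProdBar_eq_sum hγ,
        Finset.sum_Icc_succ_top (by omega)]
    have hs : Q (n + 1) = (b (n + 1) * γ n / (b n * γ (n + 1))) • (Q n * (1 + γ (n + 1) • M)) :=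
      scaledMatProd_succ hγ hb hn
    set e := b (n + 1) * γ n / (b n * γ (n + 1)) - 1 with hedef
    have hs' : Q (n + 1) = Q n * (1 + γ (n + 1) • M) + e • (Q n * (1 + γ (n + 1) • M)) := by
      rw [hs, hedef, sub_smul, one_smul]; abel
    have hid : matProdBar γ b M i (n + 1) * M + 1 - Q (n + 1) - γ (n + 1) • (Q (n + 1) * M)
        = (matProdBar γ b M i n * M + 1 - Q n - γ n • (Q n * M))
          + ((γ n - γ (n + 1)) • (Q n * M) - e • (Q n * (1 + γ (n + 1) • M))) := by
      have h1 : matProdBar γ b M i (n + 1) * M + 1 - Q (n + 1) - γ (n + 1) • (Q (n + 1) * M)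
          = matProdBar γ b M i n * M + 1 - Q (n + 1) := by
        rw [hbar, add_mul, smul_mul_assoc]; abel
      rw [h1, hs', sub_smul, mul_add (Q n), mul_one, mul_smul_comm]
      clear_value e
      module
    have h1M : ‖1 + γ (n + 1) • M‖ ≤ 1 := (hM (n + 1) (by omega)).trans
      (Real.exp_le_one_iff.2 (by nlinarith [hγ (n + 1) (by omega)]))
    have hQn : ‖Q n‖ ≤ Real.exp 1 := by
      refine (norm_scaledMatProd_le hγ hb he hM hη hημ hηγ hn).trans
        (mul_le_of_le_one_right (Real.exp_nonneg 1) (Real.exp_le_one_iff.2 ?_))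
      have : 0 ≤ ∑ k ∈ Finset.Ioc i n, γ k :=
        Finset.sum_nonneg fun k hk => (hγ k (Finset.mem_Ioc.1 hk).1.le).le
      nlinarith
    have hb1 : ‖(γ n - γ (n + 1)) • (Q n * M)‖ ≤ (γ n - γ (n + 1)) * (Real.exp 1 * Λ) := by
      rw [norm_smul, Real.norm_of_nonneg (sub_nonneg.2 (hanti n hn))]
      exact mul_le_mul_of_nonneg_left ((norm_mul_le _ _).trans (mul_le_mul hQn hΛ (norm_nonneg _)
        (Real.exp_nonneg 1))) (sub_nonneg.2 (hanti n hn))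
    have hb2 : ‖e • (Q n * (1 + γ (n + 1) • M))‖ ≤ η * γ n * ‖Q n‖ := by
      rw [norm_smul]
      refine mul_le_mul (he n hn) ((norm_mul_le _ _).trans
        (mul_le_of_le_one_right (norm_nonneg _) h1M)) (norm_nonneg _)
        (mul_nonneg hη (hγ n hn).le)
    rw [hid, Finset.sum_Ico_succ_top hn]
    refine (norm_add_le _ _).trans ?_
    have h3 := norm_sub_le ((γ n - γ (n + 1)) • (Q n * M)) (e • (Q n * (1 + γ (n + 1) • M)))
    linarith

include hγ hanti hb he hM hη hμ hημ hηγ in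
theorem norm_matProdBar_mul_add_one_le (hΛ : ‖M‖ ≤ Λ) {n : ℕ} (hn : i ≤ n) :
    ‖matProdBar γ b M i n * M + 1‖ ≤
      Real.exp 1 * (Real.exp (-μ * ∑ k ∈ Finset.Ioc i n, γ k) + Λ * γ i + η * (γ i + 1 / μ)) := by
  have h1 := norm_matProdBar_mul_add_one_sub_le hγ hanti hb he hM hη hμ hημ hηγ hΛ hn
  have h2 := norm_scaledMatProd_le hγ hb he hM hη hημ hηγ hn
  have h3 := sum_norm_scaledMatProd_le hγ hb he hM hη hμ hημ hηγ hn
  set Q := scaledMatProd γ b M i with hQ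
  have h4 : ∑ r ∈ Finset.Ico i n, γ r * ‖Q r‖ ≤ ∑ r ∈ Finset.Icc i n, γ r * ‖Q r‖ :=
    Finset.sum_le_sum_of_subset_of_nonneg Finset.Ico_subset_Icc_self fun r hr _ =>
      mul_nonneg (hγ r (Finset.mem_Icc.1 hr).1).le (norm_nonneg _)
  have h5 : ‖Q n‖ ≤ Real.exp 1 := by
    refine h2.trans (mul_le_of_le_one_right (Real.exp_nonneg 1) (Real.exp_le_one_iff.2 ?_))
    have : 0 ≤ ∑ k ∈ Finset.Ioc i n, γ k :=
      Finset.sum_nonneg fun k hk => (hγ k (Finset.mem_Ioc.1 hk).1.le).le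
    nlinarith
  have h6 : ‖γ n • (Q n * M)‖ ≤ γ n * (Real.exp 1 * Λ) := by
    rw [norm_smul, Real.norm_of_nonneg (hγ n hn).le]
    exact mul_le_mul_of_nonneg_left ((norm_mul_le _ _).trans (mul_le_mul h5 hΛ (norm_nonneg _)
      (Real.exp_nonneg 1))) (hγ n hn).le
  have h7 : matProdBar γ b M i n * M + 1
      = (matProdBar γ b M i n * M + 1 - Q n - γ n • (Q n * M)) + Q n + γ n • (Q n * M) := by abel
  rw [h7]
  have h8 := norm_add₃_le (a := matProdBar γ b M i n * M + 1 - Q n - γ n • (Q n * M)) (b := Q n)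
    (c := γ n • (Q n * M))
  have h9 := mul_le_mul_of_nonneg_left (h4.trans h3) hη
  linarith

end Bounds

/-- Unboundedness of `n γ_n` yields positive steps arbitrarily late, and monotonicity carries
positivity back to every index. -/
theorem step_pos (hγ_anti : AntitoneOn γ (Set.Ici 1))
    (hnγ : Tendsto (fun n : ℕ => (n : ℝ) * γ n) atTop atTop) {n : ℕ} (hn : 1 ≤ n) : 0 < γ n := by
  obtain ⟨m, hm1, hm2⟩ := ((hnγ.eventually_gt_atTop 0).and (eventually_ge_atTop n)).exists
  have h1 : 0 < γ m := pos_of_mul_pos_right hm1 (Nat.cast_nonneg m)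
  exact h1.trans_le (hγ_anti hn (hn.trans hm2) hm2)

section Asymptotic

variable (hγ_anti : AntitoneOn γ (Set.Ici 1))
  (hγ_zero : Tendsto γ atTop (𝓝 0)) (hb : ∀ n, 1 ≤ n → 0 < b n)
  (hnγ : Tendsto (fun n : ℕ => (n : ℝ) * γ n) atTop atTop)
  (hbγ : (fun n => b (n + 1) * γ n / (b n * γ (n + 1)) - 1) =o[atTop] γ) (hl : 0 < l)

include hγ_anti hγ_zero hb hnγ hbγ hl

/-- The threshold for `i` does not depend on `n` or `M`; this matters because `M` will be `H_n(ω)`,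
which varies with both `n` and `ω`. -/
theorem eventually_matProdBar_bounds (Λ : ℝ) {η : ℝ} (hη : 0 < η) (hηl : η ≤ l / 4) :
    ∀ᶠ i in atTop, ∀ n, i ≤ n → ∀ M ∈ dissipativeMatrices d l Λ,
      ‖matProdBar γ b M i n‖ ≤ Real.exp 1 * (γ i + 1 / (l / 4)) ∧
      ‖matProdBar γ b M i n * M + 1‖ ≤
        Real.exp 1 * (Real.exp (-(l / 4) * ∑ k ∈ Finset.Ioc i n, γ k) + Λ * γ i
          + η * (γ i + 1 / (l / 4))) := by
  have hsmall : ∀ c u : ℝ, 0 < u → ∀ᶠ i in atTop, γ i * c ≤ u := fun c u hu => by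
    have h := hγ_zero.mul_const c
    rw [zero_mul] at h
    exact h.eventually_le_const hu
  filter_upwards [eventually_forall_ge_atTop.2 (hbγ.def hη),
    eventually_forall_ge_atTop.2 (hsmall (Λ ^ 2) l hl),
    eventually_forall_ge_atTop.2 (hsmall l 2 two_pos), hsmall η 1 one_pos, eventually_ge_atTop 1]
    with i h1 h2 h3 h4 h5 n hn M hM
  have hpos : ∀ k, i ≤ k → 0 < γ k := fun k hk =>
    step_pos hγ_anti hnγ (h5.trans hk)
  have hanti : ∀ k, i ≤ k → γ (k + 1) ≤ γ k := fun k hk =>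
    hγ_anti (h5.trans hk) (h5.trans (hk.trans k.le_succ)) k.le_succ
  have hb' : ∀ k, i ≤ k → 0 < b k := fun k hk => hb k (h5.trans hk)
  have he : ∀ k, i ≤ k → |b (k + 1) * γ k / (b k * γ (k + 1)) - 1| ≤ η * γ k := fun k hk => by
    have := h1 k hk
    rwa [Real.norm_eq_abs, Real.norm_of_nonneg (hpos k hk).le] at this
  -- The rate is `μ = l / 4`, since `1 - γ l / 2 ≤ exp (-2μ γ)`.
  have hM' : ∀ k, i ≤ k → ‖1 + γ k • M‖ ≤ Real.exp (-(2 * (l / 4)) * γ k) := fun k hk => by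
    refine (norm_one_add_smul_le hM (hpos k hk).le (h2 k hk) (h3 k hk)).trans ?_
    have := Real.add_one_le_exp (-(2 * (l / 4)) * γ k)
    linarith
  rw [mul_comm] at h4
  exact ⟨norm_matProdBar_le hpos hb' he hM' hη.le (by linarith) hηl h4 hn,
    norm_matProdBar_mul_add_one_le hpos hanti hb' he hM' hη.le (by linarith) hηl h4 hM.1 hn⟩

theorem exists_norm_matProdBar_le (Λ : ℝ) :
    ∃ R, ∀ᶠ i in atTop, ∀ n, i ≤ n → ∀ M ∈ dissipativeMatrices d l Λ,
      ‖matProdBar γ b M i n‖ ≤ R := by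
  refine ⟨Real.exp 1 * (1 + 1 / (l / 4)), ?_⟩
  filter_upwards [eventually_matProdBar_bounds hγ_anti hγ_zero hb hnγ hbγ hl Λ
    (η := l / 4) (by linarith) le_rfl, hγ_zero.eventually_le_const one_pos] with i h1 h2 n hn M hM
  refine (h1 n hn M hM).1.trans ?_
  gcongr

theorem exists_norm_matProdBar_mul_add_one_le (Λ : ℝ) {ε : ℝ} (hε : 0 < ε) :
    ∃ T, ∀ᶠ i in atTop, ∀ n, i ≤ n → T ≤ ∑ k ∈ Finset.Ioc i n, γ k →
      ∀ M ∈ dissipativeMatrices d l Λ, ‖matProdBar γ b M i n * M + 1‖ ≤ ε := by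
  have h0 : 0 < Real.exp 1 := Real.exp_pos 1
  have hl4 : 0 < l / 4 := by linarith
  -- Each of the three error terms is allotted `ρ`. The choice of `η` settles the third, and `T`
  -- below solves `exp (-(l / 4) T) = ρ`.
  set ρ := ε / Real.exp 1 / 3 with hρ
  have hρ0 : 0 < ρ := by positivity
  set η := min (l / 4) (ρ / (1 + 1 / (l / 4))) with hηdef
  have hη : 0 < η := lt_min hl4 (by positivity)
  refine ⟨-Real.log ρ / (l / 4), ?_⟩
  have hsmall : ∀ᶠ i in atTop, Λ * γ i ≤ ρ := by
    have h := hγ_zero.const_mul Λ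
    rw [mul_zero] at h
    exact h.eventually_le_const hρ0
  filter_upwards [eventually_matProdBar_bounds hγ_anti hγ_zero hb hnγ hbγ hl Λ
    hη (min_le_left _ _), hγ_zero.eventually_le_const one_pos, hsmall] with i h1 h2 h3 n hn hT M hM
  refine (h1 n hn M hM).2.trans ?_
  have h4 : Real.exp (-(l / 4) * ∑ k ∈ Finset.Ioc i n, γ k) ≤ ρ := by
    rw [div_le_iff₀ hl4] at hT
    rw [← Real.le_log_iff_exp_le hρ0]
    linarith
  have h5 : η * (γ i + 1 / (l / 4)) ≤ ρ := by
    have h6 : η * (1 + 1 / (l / 4)) ≤ ρ :=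
      (le_div_iff₀ (by positivity)).1 (min_le_right _ _)
    refine le_trans ?_ h6
    gcongr
  calc _ ≤ Real.exp 1 * (ρ + ρ + ρ) := by gcongr
    _ = ε := by rw [hρ]; field_simp; ring

end Asymptotic

end MatrixProducts

/-! ### Second order expansion of the complex exponential. -/

section Taylor

/-- The remainder of the second order Taylor expansion of `y ↦ exp (i y)`. -/
noncomputable def expIRemainder (y : ℝ) : ℂ :=
  Complex.exp (y * Complex.I) - (1 + y * Complex.I - (y : ℂ) ^ 2 / 2)

theorem norm_expIRemainder_le_cube {y : ℝ} (hy : |y| ≤ 1) : ‖expIRemainder y‖ ≤ |y| ^ 3 := by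
  have hn : ‖(y * Complex.I : ℂ)‖ = |y| := by simp
  have h := Complex.exp_bound (x := y * Complex.I) (by rwa [hn]) (n := 3) (by norm_num)
  rw [hn] at h
  have he : expIRemainder y = Complex.exp (y * Complex.I)
      - ∑ m ∈ Finset.range 3, (y * Complex.I : ℂ) ^ m / m.factorial := by
    rw [expIRemainder]
    simp [Finset.sum_range_succ, mul_pow, Nat.factorial]
    ring
  rw [he]
  refine h.trans (mul_le_of_le_one_right (by positivity) ?_)
  norm_num [Nat.factorial]

theorem norm_expIRemainder_le_sq (y : ℝ) : ‖expIRemainder y‖ ≤ 4 * y ^ 2 := by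
  rcases le_total |y| 1 with hy | hy
  · refine (norm_expIRemainder_le_cube hy).trans ?_
    rw [← sq_abs y]
    nlinarith [mul_le_mul_of_nonneg_right hy (sq_nonneg |y|), sq_nonneg |y|]
  · have h1 : ‖Complex.exp (y * Complex.I)‖ = 1 := Complex.norm_exp_ofReal_mul_I y
    have h2 : ‖(1 + y * Complex.I - (y : ℂ) ^ 2 / 2 : ℂ)‖ ≤ 1 + |y| + |y| ^ 2 / 2 := by
      refine (norm_sub_le _ _).trans (add_le_add ((norm_add_le _ _).trans ?_) ?_) <;> simp
    have h3 := norm_sub_le (Complex.exp (y * Complex.I)) (1 + y * Complex.I - (y : ℂ) ^ 2 / 2)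
    rw [expIRemainder, ← sq_abs y]
    nlinarith

/-- The cubic bound is used for `|y| ≤ ε` and the quadratic one beyond; the second part is what the
Lindeberg condition controls. -/
theorem norm_expIRemainder_le {ε : ℝ} (hε0 : 0 ≤ ε) (hε1 : ε ≤ 1) (y : ℝ) :
    ‖expIRemainder y‖ ≤ ε * y ^ 2 + 4 * Set.indicator {z : ℝ | ε < |z|} (fun z => z ^ 2) y := by
  by_cases h : ε < |y|
  · rw [Set.indicator_of_mem (by exact h)]
    exact (norm_expIRemainder_le_sq y).trans (by nlinarith [sq_nonneg y])
  · rw [Set.indicator_of_notMem (by exact h), mul_zero, add_zero]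
    rw [not_lt] at h
    refine (norm_expIRemainder_le_cube (h.trans hε1)).trans ?_
    rw [← sq_abs y]
    nlinarith [mul_le_mul_of_nonneg_right h (sq_nonneg |y|)]

theorem abs_one_sub_sub_exp_neg_le {x : ℝ} (hx : 0 ≤ x) : |1 - x - Real.exp (-x)| ≤ x ^ 2 := by
  have h1 := Real.add_one_le_exp (-x)
  have h2 := Real.add_one_le_exp x
  have h3 : Real.exp (-x) * Real.exp x = 1 := by rw [← Real.exp_add]; simp
  have h4 := Real.exp_pos (-x)
  have h5 : Real.exp (-x) * (1 + x) ≤ 1 := by nlinarith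
  rw [abs_le]
  constructor
  · nlinarith
  · nlinarith [sq_nonneg x]

end Taylor

/-! ### One step of the exponential martingale comparison. -/

section MartingaleStep

variable {Ω : Type*} {m m0 : MeasurableSpace Ω} {P : Measure Ω}

theorem integrable_smul_of_ae_bound {f : Ω → ℝ} {ζ : Ω → ℂ} {K : ℝ} (hf : Integrable f P)
    (hζ : AEStronglyMeasurable ζ P) (hK : ∀ᵐ ω ∂P, ‖ζ ω‖ ≤ K) :
    Integrable (fun ω => f ω • ζ ω) P := by
  refine (hf.norm.mul_const K).mono' (hf.aestronglyMeasurable.smul hζ) ?_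
  filter_upwards [hK] with ω h
  rw [norm_smul]
  gcongr

variable [IsProbabilityMeasure P]

theorem integral_condExp_smul (hm : m ≤ m0) {f : Ω → ℝ} {ζ : Ω → ℂ} {K : ℝ}
    (hf : Integrable f P) (hζ : StronglyMeasurable[m] ζ) (hK : ∀ᵐ ω ∂P, ‖ζ ω‖ ≤ K) :
    ∫ ω, (P[f | m]) ω • ζ ω ∂P = ∫ ω, f ω • ζ ω ∂P := by
  rw [← integral_condExp hm (f := fun ω => f ω • ζ ω)]
  refine integral_congr_ae ?_
  exact (condExp_smul_of_aestronglyMeasurable_right hf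
    (integrable_smul_of_ae_bound hf (hζ.mono hm).aestronglyMeasurable hK)
    hζ.aestronglyMeasurable).symm

/-- Expand `exp (i Y) = 1 + i Y - Y²/2 + R` and `exp (-v/2) = 1 - v/2 + O(v²)`. Against the
`m`-measurable `ζ`, the linear term integrates to zero and `Y²` has the same integral as its
conditional expectation `v`, so only the two remainders survive. The second is controlled by `v² ≤ v
(ε² + q) ≤ ε v + C q`, with `q` the conditional truncated second moment. -/
theorem norm_integral_exp_sub_exp_condVar_le (hm : m ≤ m0) {Y : Ω → ℝ} (hY : MemLp Y 2 P)
    (hmart : P[Y | m] =ᵐ[P] 0) {ε C K : ℝ} (hε0 : 0 ≤ ε) (hε1 : ε ≤ 1)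
    (hC : ∀ᵐ ω ∂P, (P[fun ω => Y ω ^ 2 | m]) ω ≤ C) {ζ : Ω → ℂ}
    (hζ : StronglyMeasurable[m] ζ) (hK : ∀ᵐ ω ∂P, ‖ζ ω‖ ≤ K) :
    ‖∫ ω, (Complex.exp (Y ω * Complex.I)
        - Real.exp (-((P[fun ω => Y ω ^ 2 | m]) ω / 2)) : ℂ) * ζ ω ∂P‖ ≤
      K * ∫ ω, (2 * ε * (P[fun ω => Y ω ^ 2 | m]) ω + (4 + C) *
        (P[fun ω => Set.indicator {z : ℝ | ε < |z|} (fun z => z ^ 2) (Y ω) | m]) ω) ∂P := by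
  set v := P[fun ω => Y ω ^ 2 | m] with hv
  set J : Ω → ℝ := fun ω => Set.indicator {z : ℝ | ε < |z|} (fun z => z ^ 2) (Y ω) with hJdef
  set q := P[J | m] with hq
  have hY1 : Integrable Y P := hY.integrable (by norm_num)
  have hY2 : Integrable (fun ω => Y ω ^ 2) P := hY.integrable_sq
  have hset : MeasurableSet {z : ℝ | ε < |z|} := measurableSet_lt measurable_const (by fun_prop)
  have hJle : ∀ ω, |J ω| ≤ Y ω ^ 2 := fun ω => by
    simp only [hJdef, Set.indicator]
    split_ifs
    · rw [abs_of_nonneg (sq_nonneg _)]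
    · simpa using sq_nonneg (Y ω)
  have hJ : Integrable J P := by
    refine hY2.mono' ?_ (ae_of_all _ hJle)
    exact (((measurable_id.pow_const 2).indicator hset).comp_aemeasurable
      hY1.aemeasurable).aestronglyMeasurable
  have hζm : AEStronglyMeasurable ζ P := (hζ.mono hm).aestronglyMeasurable
  have hv0 : ∀ᵐ ω ∂P, 0 ≤ v ω := condExp_nonneg (ae_of_all _ fun ω => sq_nonneg (Y ω))
  have hq0 : ∀ᵐ ω ∂P, 0 ≤ q ω := condExp_nonneg (ae_of_all _ fun ω =>
    Set.indicator_nonneg (fun z _ => sq_nonneg z) _)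
  have hvq : ∀ᵐ ω ∂P, v ω ≤ ε ^ 2 + q ω := by
    have h1 : (fun ω => Y ω ^ 2) ≤ᵐ[P] (fun _ => ε ^ 2) + J := ae_of_all _ fun ω => by
      simp only [hJdef, Pi.add_apply, Set.indicator]
      split_ifs with h
      · nlinarith [sq_nonneg ε]
      · have h' : |Y ω| ≤ ε := not_lt.1 h
        rw [add_zero]
        exact sq_le_sq' (abs_le.1 h').1 (abs_le.1 h').2
    filter_upwards [condExp_mono (m := m) hY2 ((integrable_const _).add hJ) h1,
      condExp_add (integrable_const (ε ^ 2)) hJ m] with ω h2 h3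
    rw [h3] at h2
    simpa [condExp_const hm] using h2
  have hvi : Integrable v P := integrable_condExp
  have hqi : Integrable q P := integrable_condExp
  have hR : Measurable expIRemainder := by unfold expIRemainder; fun_prop
  have hRi : Integrable (fun ω => expIRemainder (Y ω) * ζ ω) P := by
    refine ((hY2.const_mul 4).mul_const K).mono'
      ((hR.comp_aemeasurable hY1.aemeasurable).aestronglyMeasurable.mul hζm) ?_
    filter_upwards [hK] with ω h
    rw [norm_mul]
    exact mul_le_mul (norm_expIRemainder_le_sq _) h (norm_nonneg _) (by positivity)
  have hE : Measurable fun x : ℝ => ((1 - x / 2 - Real.exp (-(x / 2)) : ℝ) : ℂ) := by fun_prop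
  have hEb : ∀ᵐ ω ∂P, ‖((1 - v ω / 2 - Real.exp (-(v ω / 2)) : ℝ) : ℂ)‖
      ≤ ε * v ω + C * q ω := by
    filter_upwards [hv0, hq0, hvq, hC] with ω h1 h2 h3 h4
    rw [Complex.norm_real, Real.norm_eq_abs]
    refine (abs_one_sub_sub_exp_neg_le (by linarith)).trans ?_
    have h5 : v ω * v ω ≤ v ω * (ε ^ 2 + q ω) := mul_le_mul_of_nonneg_left h3 h1
    have h6 : v ω * q ω ≤ C * q ω := mul_le_mul_of_nonneg_right h4 h2
    have h7 : v ω * ε ^ 2 ≤ v ω * ε := mul_le_mul_of_nonneg_left (by nlinarith) h1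
    nlinarith
  have hEi : Integrable (fun ω => ((1 - v ω / 2 - Real.exp (-(v ω / 2)) : ℝ) : ℂ) * ζ ω) P := by
    refine (((hvi.const_mul ε).add (hqi.const_mul C)).mul_const K).mono'
      ((hE.comp_aemeasurable hvi.aemeasurable).aestronglyMeasurable.mul hζm) ?_
    filter_upwards [hK, hEb] with ω h h'
    rw [norm_mul]
    exact mul_le_mul h' h (norm_nonneg _) ((norm_nonneg _).trans h')
  have hYζ := integrable_smul_of_ae_bound hY1 hζm hK
  have hY2ζ := integrable_smul_of_ae_bound hY2 hζm hK
  have hvζ := integrable_smul_of_ae_bound hvi hζm hK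
  have hz1 : ∫ ω, Y ω • ζ ω ∂P = 0 := by
    rw [← integral_condExp_smul hm hY1 hζ hK]
    refine integral_eq_zero_of_ae ?_
    filter_upwards [hmart] with ω h
    simp [h]
  have hz2 : ∫ ω, v ω • ζ ω ∂P = ∫ ω, Y ω ^ 2 • ζ ω ∂P :=
    integral_condExp_smul hm hY2 hζ hK
  have hsplit : ∀ ω, (Complex.exp (Y ω * Complex.I) - Real.exp (-(v ω / 2)) : ℂ) * ζ ω
      = (expIRemainder (Y ω) * ζ ω + ((1 - v ω / 2 - Real.exp (-(v ω / 2)) : ℝ) : ℂ) * ζ ω)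
        + (Complex.I * (Y ω • ζ ω) + ((1 / 2 : ℂ) * (v ω • ζ ω) - (1 / 2 : ℂ) * (Y ω ^ 2 • ζ ω))) :=
    fun ω => by
      simp only [expIRemainder, Complex.real_smul]
      push_cast
      ring
  simp_rw [hsplit]
  have hmain : Integrable (fun ω => expIRemainder (Y ω) * ζ ω
      + ((1 - v ω / 2 - Real.exp (-(v ω / 2)) : ℝ) : ℂ) * ζ ω) P := hRi.add hEi
  have hdiff : Integrable (fun ω => (1 / 2 : ℂ) * (v ω • ζ ω) - (1 / 2 : ℂ) * (Y ω ^ 2 • ζ ω)) P :=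
    (hvζ.const_mul _).sub (hY2ζ.const_mul _)
  have hrest : Integrable (fun ω => Complex.I * (Y ω • ζ ω)
      + ((1 / 2 : ℂ) * (v ω • ζ ω) - (1 / 2 : ℂ) * (Y ω ^ 2 • ζ ω))) P :=
    (hYζ.const_mul _).add hdiff
  rw [integral_add hmain hrest, integral_add (hYζ.const_mul _) hdiff,
    integral_sub (hvζ.const_mul _) (hY2ζ.const_mul _), integral_const_mul, integral_const_mul,
    integral_const_mul, hz1, hz2, mul_zero, sub_self, add_zero, add_zero]
  have hb1 : Integrable (fun ω => ε * Y ω ^ 2 + 4 * J ω) P :=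
    (hY2.const_mul ε).add (hJ.const_mul 4)
  have hb2 : Integrable (fun ω => ε * v ω + C * q ω) P :=
    (hvi.const_mul ε).add (hqi.const_mul C)
  have hJint : ∫ ω, J ω ∂P = ∫ ω, q ω ∂P := (integral_condExp hm).symm
  have hY2int : ∫ ω, Y ω ^ 2 ∂P = ∫ ω, v ω ∂P := (integral_condExp hm).symm
  have hK0 : 0 ≤ K := by
    obtain ⟨ω, h⟩ := hK.exists
    exact (norm_nonneg _).trans h
  calc ‖∫ ω, (expIRemainder (Y ω) * ζ ω
          + ((1 - v ω / 2 - Real.exp (-(v ω / 2)) : ℝ) : ℂ) * ζ ω) ∂P‖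
      ≤ ∫ ω, ((ε * Y ω ^ 2 + 4 * J ω) + (ε * v ω + C * q ω)) * K ∂P := by
        refine norm_integral_le_of_norm_le ((hb1.add hb2).mul_const K) ?_
        filter_upwards [hK, hEb] with ω h h'
        have h3 := norm_expIRemainder_le hε0 hε1 (Y ω)
        refine (norm_add_le _ _).trans ?_
        rw [norm_mul, norm_mul, add_mul]
        exact add_le_add (mul_le_mul h3 h (norm_nonneg _) ((norm_nonneg _).trans h3))
          (mul_le_mul h' h (norm_nonneg _) ((norm_nonneg _).trans h'))
    _ = K * ((ε * ∫ ω, Y ω ^ 2 ∂P + 4 * ∫ ω, J ω ∂P) + (ε * ∫ ω, v ω ∂P + C * ∫ ω, q ω ∂P)) := by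
        rw [integral_mul_const, integral_add hb1 hb2, integral_add (hY2.const_mul ε) (hJ.const_mul 4),
          integral_add (hvi.const_mul ε) (hqi.const_mul C), integral_const_mul, integral_const_mul,
          integral_const_mul, integral_const_mul, mul_comm]
    _ = _ := by
        rw [integral_add (hvi.const_mul _) (hqi.const_mul _), integral_const_mul,
          integral_const_mul, hJint, hY2int]
        ring

end MartingaleStep

/-! ### Approximate martingale property of `exp (i S_k + V_k / 2)`. -/

section ExponentialMartingale

variable {Ω : Type*} {m0 : MeasurableSpace Ω}

/-- Square integrable martingale differences with index in `(a, n]`. -/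
structure IsMartingaleDiffOn (P : Measure Ω) (ℱ : Filtration ℕ m0) (Y : ℕ → Ω → ℝ) (a n : ℕ) :
    Prop where
  meas : ∀ i ∈ Finset.Ioc a n, StronglyMeasurable[ℱ i] (Y i)
  memLp : ∀ i ∈ Finset.Ioc a n, MemLp (Y i) 2 P
  mart : ∀ i ∈ Finset.Ioc a n, P[Y i | ℱ (i - 1)] =ᵐ[P] 0

/-- The square function truncated to `|z| > ε`. -/
noncomputable def tailSq (ε z : ℝ) : ℝ := Set.indicator {z : ℝ | ε < |z|} (fun z => z ^ 2) z

/-- `E[Y_i² | ℱ_{i-1}]`. -/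
noncomputable def condSq (P : Measure Ω) (ℱ : Filtration ℕ m0) (Y : ℕ → Ω → ℝ) (i : ℕ) : Ω → ℝ :=
  P[fun ω => Y i ω ^ 2 | ℱ (i - 1)]

/-- `E[Y_i² 1_{|Y_i| > ε} | ℱ_{i-1}]`. -/
noncomputable def condTailSq (P : Measure Ω) (ℱ : Filtration ℕ m0) (Y : ℕ → Ω → ℝ) (ε : ℝ)
    (i : ℕ) : Ω → ℝ :=
  P[fun ω => tailSq ε (Y i ω) | ℱ (i - 1)]

/-- `exp (i S_k + V_k / 2)` with `S_k` the partial sum and `V_k` the conditional variance. -/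
noncomputable def expMart (P : Measure Ω) (ℱ : Filtration ℕ m0) (Y : ℕ → Ω → ℝ) (a k : ℕ)
    (ω : Ω) : ℂ :=
  Complex.exp ((∑ i ∈ Finset.Ioc a k, Y i ω : ℝ) * Complex.I) *
    (Real.exp ((∑ i ∈ Finset.Ioc a k, condSq P ℱ Y i ω) / 2) : ℂ)

theorem norm_expMart {P : Measure Ω} {ℱ : Filtration ℕ m0} {Y : ℕ → Ω → ℝ} {a k : ℕ} (ω : Ω) :
    ‖expMart P ℱ Y a k ω‖ = Real.exp ((∑ i ∈ Finset.Ioc a k, condSq P ℱ Y i ω) / 2) := by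
  rw [expMart, norm_mul, Complex.norm_exp_ofReal_mul_I, one_mul, Complex.norm_real,
    Real.norm_of_nonneg (Real.exp_nonneg _)]

theorem tailSq_nonneg (ε z : ℝ) : 0 ≤ tailSq ε z := Set.indicator_nonneg (fun z _ => sq_nonneg z) _

theorem tailSq_le (ε z : ℝ) : tailSq ε z ≤ z ^ 2 := by
  simp only [tailSq, Set.indicator]
  split_ifs
  · rfl
  · exact sq_nonneg z

theorem measurable_tailSq (ε : ℝ) : Measurable (tailSq ε) :=
  (measurable_id.pow_const 2).indicator (measurableSet_lt measurable_const (by fun_prop))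

variable {P : Measure Ω} {ℱ : Filtration ℕ m0} {Y : ℕ → Ω → ℝ} {a n : ℕ}

theorem stronglyMeasurable_condSq {i k : ℕ} (h : i - 1 ≤ k) :
    StronglyMeasurable[ℱ k] (condSq P ℱ Y i) :=
  stronglyMeasurable_condExp.mono (ℱ.mono h)

theorem stronglyMeasurable_condTailSq {ε : ℝ} {i k : ℕ} (h : i - 1 ≤ k) :
    StronglyMeasurable[ℱ k] (condTailSq P ℱ Y ε i) :=
  stronglyMeasurable_condExp.mono (ℱ.mono h)

theorem condSq_nonneg (P : Measure Ω) (ℱ : Filtration ℕ m0) (Y : ℕ → Ω → ℝ) :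
    ∀ᵐ ω ∂P, ∀ i, 0 ≤ condSq P ℱ Y i ω :=
  ae_all_iff.2 fun i => condExp_nonneg (ae_of_all _ fun ω => sq_nonneg (Y i ω))

theorem condTailSq_nonneg (P : Measure Ω) (ℱ : Filtration ℕ m0) (Y : ℕ → Ω → ℝ) (ε : ℝ) :
    ∀ᵐ ω ∂P, ∀ i, 0 ≤ condTailSq P ℱ Y ε i ω :=
  ae_all_iff.2 fun i => condExp_nonneg (ae_of_all _ fun ω => tailSq_nonneg ε (Y i ω))

theorem IsMartingaleDiffOn.stronglyMeasurable_expMart (h : IsMartingaleDiffOn P ℱ Y a n) {k : ℕ}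
    (hk : k ≤ n) : StronglyMeasurable[ℱ k] (expMart P ℱ Y a k) := by
  have h1 : StronglyMeasurable[ℱ k] fun ω => ∑ i ∈ Finset.Ioc a k, Y i ω :=
    Finset.stronglyMeasurable_fun_sum _ fun i hi =>
      (h.meas i (Finset.Ioc_subset_Ioc_right hk hi)).mono (ℱ.mono (Finset.mem_Ioc.1 hi).2)
  have h2 : StronglyMeasurable[ℱ k] fun ω => ∑ i ∈ Finset.Ioc a k, condSq P ℱ Y i ω :=
    Finset.stronglyMeasurable_fun_sum _ fun i hi =>
      stronglyMeasurable_condSq (by have := (Finset.mem_Ioc.1 hi).2; omega)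
  have h3 : Continuous fun x : ℝ => Complex.exp (x * Complex.I) := by fun_prop
  have h4 : Continuous fun x : ℝ => (Real.exp (x / 2) : ℂ) := by fun_prop
  exact (h3.comp_stronglyMeasurable h1).mul (h4.comp_stronglyMeasurable h2)

variable [IsProbabilityMeasure P]

/-- Telescoping over `k`. The increment from `k` to `k + 1` is `(exp (i Y_{k+1}) - exp (-v_{k+1}/2))
ζ` with `ζ = Z · expMart_k · exp (v_{k+1}/2)`, which is `ℱ k`-measurable because `v_{k+1}` is
predictable, and bounded by `K exp (C/2)`. The one-step errors add up to `2 ε C + (4 + C) ε`. -/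
theorem IsMartingaleDiffOn.norm_integral_expMart_sub_le (h : IsMartingaleDiffOn P ℱ Y a n)
    (han : a ≤ n) {ε C K : ℝ} (hε0 : 0 ≤ ε) (hε1 : ε ≤ 1) (hC0 : 0 ≤ C)
    (hC : ∀ᵐ ω ∂P, ∑ i ∈ Finset.Ioc a n, condSq P ℱ Y i ω ≤ C)
    (hL : ∀ᵐ ω ∂P, ∑ i ∈ Finset.Ioc a n, condTailSq P ℱ Y ε i ω ≤ ε)
    {Z : Ω → ℝ} (hZ : StronglyMeasurable[ℱ a] Z) (hK : ∀ᵐ ω ∂P, |Z ω| ≤ K) :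
    ‖∫ ω, Z ω * expMart P ℱ Y a n ω ∂P - ∫ ω, (Z ω : ℂ) ∂P‖ ≤
      K * Real.exp (C / 2) * ((4 + 3 * C) * ε) := by
  have hK0 : 0 ≤ K := by
    obtain ⟨ω, h⟩ := hK.exists
    exact (abs_nonneg _).trans h
  have hsum_le : ∀ᵐ ω ∂P, ∀ k ≤ n, ∑ i ∈ Finset.Ioc a k, condSq P ℱ Y i ω ≤ C := by
    filter_upwards [hC, condSq_nonneg P ℱ Y] with ω h1 h2 k hk
    exact (Finset.sum_le_sum_of_subset_of_nonneg (Finset.Ioc_subset_Ioc_right hk)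
      fun i _ _ => h2 i).trans h1
  have hZc : StronglyMeasurable[ℱ a] fun ω => (Z ω : ℂ) :=
    Complex.continuous_ofReal.comp_stronglyMeasurable hZ
  have hint : ∀ k ≤ n, Integrable (fun ω => Z ω * expMart P ℱ Y a k ω) P := fun k hk => by
    refine (integrable_const (K * Real.exp (C / 2))).mono'
      ((hZc.mono (ℱ.le a)).mul ((h.stronglyMeasurable_expMart hk).mono (ℱ.le k))).aestronglyMeasurable
      ?_
    filter_upwards [hK, hsum_le] with ω h1 h2
    rw [norm_mul, norm_expMart, Complex.norm_real]
    have := h2 k hk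
    gcongr
    exact h1
  have hincr : ∀ k, Integrable (fun ω => 2 * ε * condSq P ℱ Y k ω
      + (4 + C) * condTailSq P ℱ Y ε k ω) P := fun k =>
    (integrable_condExp.const_mul _).add (integrable_condExp.const_mul _)
  have key : ∀ k, a ≤ k → k ≤ n →
      ‖∫ ω, Z ω * expMart P ℱ Y a k ω ∂P - ∫ ω, (Z ω : ℂ) ∂P‖ ≤
        K * Real.exp (C / 2) * ∑ i ∈ Finset.Ioc a k,
          ∫ ω, (2 * ε * condSq P ℱ Y i ω + (4 + C) * condTailSq P ℱ Y ε i ω) ∂P := by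
    intro k hak
    induction k, hak using Nat.le_induction with
    | base => simp [expMart]
    | succ k hak ih =>
      intro hkn
      have hmem : k + 1 ∈ Finset.Ioc a n := Finset.mem_Ioc.2 ⟨by omega, hkn⟩
      set ζ : Ω → ℂ := fun ω => Z ω * expMart P ℱ Y a k ω *
        (Real.exp (condSq P ℱ Y (k + 1) ω / 2) : ℂ) with hζ
      have hζm : StronglyMeasurable[ℱ k] ζ := by
        have h4 : Continuous fun x : ℝ => (Real.exp (x / 2) : ℂ) := by fun_prop
        exact ((hZc.mono (ℱ.mono hak)).mul (h.stronglyMeasurable_expMart (by omega))).mul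
          (h4.comp_stronglyMeasurable (stronglyMeasurable_condSq (by omega)))
      have hζK : ∀ᵐ ω ∂P, ‖ζ ω‖ ≤ K * Real.exp (C / 2) := by
        filter_upwards [hK, hsum_le] with ω h1 h2
        have h3 := h2 (k + 1) hkn
        rw [Finset.sum_Ioc_succ_top hak] at h3
        rw [hζ, norm_mul, norm_mul, norm_expMart, Complex.norm_real, Complex.norm_real,
          Real.norm_of_nonneg (Real.exp_nonneg _), mul_assoc, ← Real.exp_add, ← add_div]
        gcongr
        exact h1
      have hvC : ∀ᵐ ω ∂P, condSq P ℱ Y (k + 1) ω ≤ C := by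
        filter_upwards [hC, condSq_nonneg P ℱ Y] with ω h1 h2
        exact (Finset.single_le_sum (fun i _ => h2 i) hmem).trans h1
      have hstep := norm_integral_exp_sub_exp_condVar_le (ℱ.le k) (h.memLp _ hmem)
        (h.mart _ hmem) hε0 hε1 hvC hζm hζK
      have hdiff : ∀ ω, (Complex.exp (Y (k + 1) ω * Complex.I)
          - Real.exp (-(condSq P ℱ Y (k + 1) ω / 2)) : ℂ) * ζ ω
          = Z ω * expMart P ℱ Y a (k + 1) ω - Z ω * expMart P ℱ Y a k ω := fun ω => by
        have h1 : (Real.exp (-(condSq P ℱ Y (k + 1) ω / 2)) : ℂ)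
            * (Real.exp (condSq P ℱ Y (k + 1) ω / 2) : ℂ) = 1 := by
          rw [← Complex.ofReal_mul, ← Real.exp_add]; simp
        have h2 : expMart P ℱ Y a (k + 1) ω = expMart P ℱ Y a k ω
            * (Complex.exp (Y (k + 1) ω * Complex.I)
              * (Real.exp (condSq P ℱ Y (k + 1) ω / 2) : ℂ)) := by
          rw [expMart, expMart, Finset.sum_Ioc_succ_top hak, Finset.sum_Ioc_succ_top hak,
            Complex.ofReal_add, add_mul, Complex.exp_add, add_div, Real.exp_add, Complex.ofReal_mul]
          ring
        rw [h2, hζ]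
        linear_combination (-(Z ω * expMart P ℱ Y a k ω)) * h1
      have hstep' : ‖∫ ω, (Z ω * expMart P ℱ Y a (k + 1) ω - Z ω * expMart P ℱ Y a k ω) ∂P‖ ≤
          K * Real.exp (C / 2) * ∫ ω, (2 * ε * condSq P ℱ Y (k + 1) ω
            + (4 + C) * condTailSq P ℱ Y ε (k + 1) ω) ∂P := by
        simp_rw [← hdiff]
        exact hstep
      rw [integral_sub (hint _ hkn) (hint _ (by omega))] at hstep'
      rw [Finset.sum_Ioc_succ_top hak, mul_add]
      have ih' := ih (by omega)
      have := norm_add_le (∫ ω, Z ω * expMart P ℱ Y a k ω ∂P - ∫ ω, (Z ω : ℂ) ∂P)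
        (∫ ω, Z ω * expMart P ℱ Y a (k + 1) ω ∂P - ∫ ω, Z ω * expMart P ℱ Y a k ω ∂P)
      rw [add_comm, sub_add_sub_cancel] at this
      linarith
  refine (key n han le_rfl).trans (mul_le_mul_of_nonneg_left ?_ (by positivity))
  rw [← integral_finsetSum _ fun i _ => hincr i]
  calc ∫ ω, ∑ i ∈ Finset.Ioc a n,
        (2 * ε * condSq P ℱ Y i ω + (4 + C) * condTailSq P ℱ Y ε i ω) ∂P
      ≤ ∫ _, (4 + 3 * C) * ε ∂P := by
        refine integral_mono_ae (integrable_finsetSum _ fun i _ => hincr i) (integrable_const _) ?_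
        filter_upwards [hC, hL] with ω h1 h2
        rw [Finset.sum_add_distrib, ← Finset.mul_sum, ← Finset.mul_sum]
        have h3 := mul_le_mul_of_nonneg_left h1 (mul_nonneg two_pos.le hε0)
        have h4 := mul_le_mul_of_nonneg_left h2 (add_nonneg (by norm_num : (0 : ℝ) ≤ 4) hC0)
        linarith
    _ = (4 + 3 * C) * ε := by simp

end ExponentialMartingale

/-! ### Stopping the array before its conditional variance becomes large. -/

section Stopping

variable {Ω : Type*} {m0 : MeasurableSpace Ω}

/-- The event that up to time `i` the conditional variance is at most `C` and the conditional
Lindeberg sum at most `ε`. -/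
def underBudget (P : Measure Ω) (ℱ : Filtration ℕ m0) (Y : ℕ → Ω → ℝ) (a : ℕ) (C ε : ℝ) (i : ℕ) :
    Set Ω :=
  {ω | ∑ j ∈ Finset.Ioc a i, condSq P ℱ Y j ω ≤ C ∧
    ∑ j ∈ Finset.Ioc a i, condTailSq P ℱ Y ε j ω ≤ ε}

/-- Up to the last index where `p` holds, the kept terms are part of a sum bounded by `C`;
afterwards nothing is kept. No monotonicity of `p` is needed. -/
theorem sum_indicator_le_of_budget {f : ℕ → ℝ} (hf : ∀ i, 0 ≤ f i) {p : ℕ → Prop}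
    [DecidablePred p] {a : ℕ} {C : ℝ} (hC : 0 ≤ C)
    (hp : ∀ i, p i → ∑ j ∈ Finset.Ioc a i, f j ≤ C) (n : ℕ) :
    ∑ i ∈ Finset.Ioc a n, (if p i then f i else 0) ≤ C := by
  induction n with
  | zero => simpa using hC
  | succ n ih =>
    by_cases h : p (n + 1)
    · refine (Finset.sum_le_sum fun i _ => ?_).trans (hp _ h)
      split_ifs
      · rfl
      · exact hf i
    · rcases le_or_gt a n with han | han
      · rw [Finset.sum_Ioc_succ_top han, if_neg h, add_zero]
        exact ih
      · rw [Finset.Ioc_eq_empty (by omega), Finset.sum_empty]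
        exact hC

variable {P : Measure Ω} {ℱ : Filtration ℕ m0} {Y : ℕ → Ω → ℝ} {a n : ℕ} {C ε : ℝ}

/-- The sums run up to `i` inclusive and are still known at time `i - 1`, their terms being
conditional expectations. Hence stopping preserves martingale differences, and the budget is
respected without overshoot. -/
theorem measurableSet_underBudget (i : ℕ) :
    MeasurableSet[ℱ (i - 1)] (underBudget P ℱ Y a C ε i) := by
  have h1 : StronglyMeasurable[ℱ (i - 1)] fun ω => ∑ j ∈ Finset.Ioc a i, condSq P ℱ Y j ω :=
    Finset.stronglyMeasurable_fun_sum _ fun j hj =>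
      stronglyMeasurable_condSq (by have := (Finset.mem_Ioc.1 hj).2; omega)
  have h2 : StronglyMeasurable[ℱ (i - 1)] fun ω => ∑ j ∈ Finset.Ioc a i, condTailSq P ℱ Y ε j ω :=
    Finset.stronglyMeasurable_fun_sum _ fun j hj =>
      stronglyMeasurable_condTailSq (by have := (Finset.mem_Ioc.1 hj).2; omega)
  exact (h1.measurable measurableSet_Iic).inter (h2.measurable measurableSet_Iic)

variable (P ℱ Y a C ε) in
/-- The increments `Y` stopped before the budget is exceeded. -/
noncomputable def stoppedIncrement (i : ℕ) : Ω → ℝ :=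
  (underBudget P ℱ Y a C ε i).indicator (Y i)

theorem IsMartingaleDiffOn.stopped [IsProbabilityMeasure P] (h : IsMartingaleDiffOn P ℱ Y a n) :
    IsMartingaleDiffOn P ℱ (stoppedIncrement P ℱ Y a C ε) a n where
  meas i hi := (h.meas i hi).indicator (ℱ.mono (Nat.sub_le i 1) _ (measurableSet_underBudget i))
  memLp i hi := (h.memLp i hi).indicator (ℱ.le _ _ (measurableSet_underBudget i))
  mart i hi := by
    refine (condExp_indicator ((h.memLp i hi).integrable (by norm_num))
      (measurableSet_underBudget i)).trans ?_
    filter_upwards [h.mart i hi] with ω hω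
    simp [Set.indicator, hω]

theorem IsMartingaleDiffOn.integrable_tailSq (h : IsMartingaleDiffOn P ℱ Y a n) {i : ℕ}
    (hi : i ∈ Finset.Ioc a n) : Integrable (fun ω => tailSq ε (Y i ω)) P := by
  refine (h.memLp i hi).integrable_sq.mono' ((measurable_tailSq ε).comp_aemeasurable
    (h.memLp i hi).aemeasurable).aestronglyMeasurable (ae_of_all _ fun ω => ?_)
  rw [Real.norm_of_nonneg (tailSq_nonneg _ _)]
  exact tailSq_le _ _

theorem IsMartingaleDiffOn.condSq_stopped (h : IsMartingaleDiffOn P ℱ Y a n) {i : ℕ}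
    (hi : i ∈ Finset.Ioc a n) : condSq P ℱ (stoppedIncrement P ℱ Y a C ε) i =ᵐ[P]
      (underBudget P ℱ Y a C ε i).indicator (condSq P ℱ Y i) := by
  have he : (fun ω => stoppedIncrement P ℱ Y a C ε i ω ^ 2)
      = (underBudget P ℱ Y a C ε i).indicator fun ω => Y i ω ^ 2 := by
    funext ω
    by_cases hω : ω ∈ underBudget P ℱ Y a C ε i <;> simp [stoppedIncrement, hω]
  rw [condSq, he]
  exact condExp_indicator (h.memLp i hi).integrable_sq (measurableSet_underBudget i)

theorem tailSq_zero (ε : ℝ) : tailSq ε 0 = 0 := by simp [tailSq, Set.indicator]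

theorem IsMartingaleDiffOn.condTailSq_stopped (h : IsMartingaleDiffOn P ℱ Y a n) {i : ℕ}
    (hi : i ∈ Finset.Ioc a n) : condTailSq P ℱ (stoppedIncrement P ℱ Y a C ε) ε i =ᵐ[P]
      (underBudget P ℱ Y a C ε i).indicator (condTailSq P ℱ Y ε i) := by
  have he : (fun ω => tailSq ε (stoppedIncrement P ℱ Y a C ε i ω))
      = (underBudget P ℱ Y a C ε i).indicator fun ω => tailSq ε (Y i ω) := by
    funext ω
    by_cases hω : ω ∈ underBudget P ℱ Y a C ε i <;> simp [stoppedIncrement, hω, tailSq_zero]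
  rw [condTailSq, he]
  exact condExp_indicator (h.integrable_tailSq hi) (measurableSet_underBudget i)

/-- A bounded approximate martingale that agrees with the exponential `exp (i S_n + V_n / 2)` as
long as the budget is not exceeded. -/
theorem IsMartingaleDiffOn.exists_bounded_expMart [IsProbabilityMeasure P]
    (h : IsMartingaleDiffOn P ℱ Y a n) (han : a ≤ n) (hε0 : 0 ≤ ε) (hε1 : ε ≤ 1) (hC0 : 0 ≤ C) :
    ∃ M : Ω → ℂ, StronglyMeasurable[ℱ n] M ∧ (∀ᵐ ω ∂P, ‖M ω‖ ≤ Real.exp (C / 2)) ∧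
      (∀ (Z : Ω → ℝ) (K : ℝ), StronglyMeasurable[ℱ a] Z → (∀ᵐ ω ∂P, |Z ω| ≤ K) →
        ‖∫ ω, Z ω * M ω ∂P - ∫ ω, (Z ω : ℂ) ∂P‖ ≤ K * Real.exp (C / 2) * ((4 + 3 * C) * ε)) ∧
      ∀ᵐ ω ∂P, ∑ i ∈ Finset.Ioc a n, condSq P ℱ Y i ω ≤ C →
        ∑ i ∈ Finset.Ioc a n, condTailSq P ℱ Y ε i ω ≤ ε → M ω = expMart P ℱ Y a n ω := by
  classical
  set X := stoppedIncrement P ℱ Y a C ε with hX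
  have hXm : IsMartingaleDiffOn P ℱ X a n := h.stopped
  have hsq : ∀ᵐ ω ∂P, ∀ i ∈ Finset.Ioc a n, condSq P ℱ X i ω =
      if ω ∈ underBudget P ℱ Y a C ε i then condSq P ℱ Y i ω else 0 := by
    refine (ae_ball_iff (Finset.Ioc a n).countable_toSet).2 fun i hi => ?_
    filter_upwards [h.condSq_stopped (C := C) (ε := ε) hi] with ω hω
    rw [hω, Set.indicator_apply]
  have htail : ∀ᵐ ω ∂P, ∀ i ∈ Finset.Ioc a n, condTailSq P ℱ X ε i ω =
      if ω ∈ underBudget P ℱ Y a C ε i then condTailSq P ℱ Y ε i ω else 0 := by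
    refine (ae_ball_iff (Finset.Ioc a n).countable_toSet).2 fun i hi => ?_
    filter_upwards [h.condTailSq_stopped (C := C) (ε := ε) hi] with ω hω
    rw [hω, Set.indicator_apply]
  have hXC : ∀ᵐ ω ∂P, ∑ i ∈ Finset.Ioc a n, condSq P ℱ X i ω ≤ C := by
    filter_upwards [hsq, condSq_nonneg P ℱ Y] with ω h1 h2
    rw [Finset.sum_congr rfl h1]
    exact sum_indicator_le_of_budget h2 hC0 (fun i hi => hi.1) n
  have hXL : ∀ᵐ ω ∂P, ∑ i ∈ Finset.Ioc a n, condTailSq P ℱ X ε i ω ≤ ε := by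
    filter_upwards [htail, condTailSq_nonneg P ℱ Y ε] with ω h1 h2
    rw [Finset.sum_congr rfl h1]
    exact sum_indicator_le_of_budget h2 hε0 (fun i hi => hi.2) n
  -- The witness is the exponential of the stopped array, which satisfies both budgets almost surely
  -- on the whole space.
  refine ⟨expMart P ℱ X a n, hXm.stronglyMeasurable_expMart le_rfl, ?_, fun Z K hZ hK =>
    hXm.norm_integral_expMart_sub_le han hε0 hε1 hC0 hXC hXL hZ hK, ?_⟩
  · filter_upwards [hXC] with ω hω
    rw [norm_expMart]
    gcongr
  · filter_upwards [hsq, condSq_nonneg P ℱ Y, condTailSq_nonneg P ℱ Y ε] with ω h1 h2 h3 h4 h5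
    -- The terms are nonnegative, so respecting the budget at time `n` means respecting it at all
    -- earlier times: nothing was stopped.
    have hmem : ∀ i ∈ Finset.Ioc a n, ω ∈ underBudget P ℱ Y a C ε i := fun i hi =>
      ⟨(Finset.sum_le_sum_of_subset_of_nonneg
          (Finset.Ioc_subset_Ioc_right (Finset.mem_Ioc.1 hi).2) fun j _ _ => h2 j).trans h4,
        (Finset.sum_le_sum_of_subset_of_nonneg
          (Finset.Ioc_subset_Ioc_right (Finset.mem_Ioc.1 hi).2) fun j _ _ => h3 j).trans h5⟩
    have hs : ∑ i ∈ Finset.Ioc a n, X i ω = ∑ i ∈ Finset.Ioc a n, Y i ω :=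
      Finset.sum_congr rfl fun i hi => by
        rw [hX, stoppedIncrement, Set.indicator_of_mem (hmem i hi)]
    have hv : ∑ i ∈ Finset.Ioc a n, condSq P ℱ X i ω = ∑ i ∈ Finset.Ioc a n, condSq P ℱ Y i ω :=
      Finset.sum_congr rfl fun i hi => by rw [h1 i hi, if_pos (hmem i hi)]
    rw [expMart, expMart, hs, hv]

end Stopping

/-! ### The stable martingale central limit theorem for arrays. -/

section StableLimit

variable {Ω : Type*} {m0 : MeasurableSpace Ω} {P : Measure Ω} [IsProbabilityMeasure P]
  {ℱ : Filtration ℕ m0}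

/-- The conditional expectations of a bounded random variable form a Cauchy sequence in `L¹`. -/
theorem exists_integral_abs_condExp_sub_le {W : Ω → ℝ} {ρ : ℝ} (hρ : 0 < ρ) :
    ∃ N, ∀ n ≥ N, ∫ ω, |(P[W | ℱ n]) ω - (P[W | ℱ N]) ω| ∂P ≤ ρ := by
  have h0 := tendsto_eLpNorm_condExp (μ := P) (ℱ := ℱ) W
  set U := P[W | ⨆ n, ℱ n] with hU
  have h1 : Tendsto (fun n => ∫ ω, |(P[W | ℱ n]) ω - U ω| ∂P) atTop (𝓝 0) := by
    have h2 := (ENNReal.tendsto_toReal ENNReal.zero_ne_top).comp h0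
    refine h2.congr fun n => ?_
    have hi : Integrable (P[W | ℱ n] - U) P := integrable_condExp.sub integrable_condExp
    rw [Function.comp_apply, eLpNorm_one_eq_lintegral_enorm,
      ← integral_norm_eq_lintegral_enorm hi.aestronglyMeasurable]
    rfl
  obtain ⟨N, hN⟩ := eventually_atTop.1 (h1.eventually_le_const (half_pos hρ))
  refine ⟨N, fun n hn => ?_⟩
  have hi : ∀ k, Integrable (fun ω => |(P[W | ℱ k]) ω - U ω|) P := fun k =>
    (integrable_condExp.sub integrable_condExp).abs
  calc ∫ ω, |(P[W | ℱ n]) ω - (P[W | ℱ N]) ω| ∂P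
      ≤ ∫ ω, (|(P[W | ℱ n]) ω - U ω| + |(P[W | ℱ N]) ω - U ω|) ∂P := by
        refine integral_mono (integrable_condExp.sub integrable_condExp).abs
          ((hi n).add (hi N)) fun ω => ?_
        rw [abs_sub_comm ((P[W | ℱ N]) ω)]
        exact abs_sub_le _ _ _
    _ ≤ ρ := by
        rw [integral_add (hi n) (hi N)]
        linarith [hN n hn, hN N le_rfl]

/-- The source of stability. `W` need not be known at time `n₀`, but since `M` is `ℱ n`-measurable,
`W` may be replaced by `E[W | ℱ n]`, and then, at cost `c ρ`, by `E[W | ℱ N]`, to which the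
approximate martingale property from time `n₀ ≥ N` applies. -/
theorem norm_integral_smul_sub_le_of_approx {n₀ n N : ℕ} (hN : N ≤ n₀) {W : Ω → ℝ}
    (hW : Measurable W) (hW1 : ∀ᵐ ω ∂P, |W ω| ≤ 1) {M : Ω → ℂ} (hM : StronglyMeasurable[ℱ n] M)
    {c r ρ : ℝ} (hc : ∀ᵐ ω ∂P, ‖M ω‖ ≤ c)
    (hMZ : ∀ Z : Ω → ℝ, StronglyMeasurable[ℱ n₀] Z → (∀ᵐ ω ∂P, |Z ω| ≤ 1) →
      ‖∫ ω, Z ω * M ω ∂P - ∫ ω, (Z ω : ℂ) ∂P‖ ≤ r)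
    (hρ : ∫ ω, |(P[W | ℱ n]) ω - (P[W | ℱ N]) ω| ∂P ≤ ρ) :
    ‖∫ ω, W ω * M ω ∂P - ∫ ω, (W ω : ℂ) ∂P‖ ≤ c * ρ + r := by
  have hWi : Integrable W P := (integrable_const (1 : ℝ)).mono' hW.aestronglyMeasurable hW1
  have hc0 : 0 ≤ c := by
    obtain ⟨ω, h⟩ := hc.exists
    exact (norm_nonneg _).trans h
  have hMm : AEStronglyMeasurable M P := (hM.mono (ℱ.le n)).aestronglyMeasurable
  have hWN1 : ∀ᵐ ω ∂P, |(P[W | ℱ N]) ω| ≤ 1 :=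
    ae_bdd_abs_condExp_of_ae_bdd_abs hW1
  have h1 : ∫ ω, W ω * M ω ∂P = ∫ ω, (P[W | ℱ n]) ω • M ω ∂P := by
    rw [integral_condExp_smul (ℱ.le n) hWi hM hc]
    simp only [Complex.real_smul]
  have h2 : ∫ ω, (W ω : ℂ) ∂P = ∫ ω, ((P[W | ℱ N]) ω : ℂ) ∂P := by
    rw [integral_complex_ofReal, integral_complex_ofReal, integral_condExp (ℱ.le N)]
  have h3 := hMZ _ (stronglyMeasurable_condExp.mono (ℱ.mono hN)) hWN1
  have h4 : ‖∫ ω, (P[W | ℱ n]) ω • M ω ∂P - ∫ ω, (P[W | ℱ N]) ω • M ω ∂P‖ ≤ c * ρ := by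
    rw [← integral_sub (integrable_smul_of_ae_bound integrable_condExp hMm hc)
      (integrable_smul_of_ae_bound integrable_condExp hMm hc)]
    have hd : Integrable (fun ω => (P[W | ℱ n]) ω - (P[W | ℱ N]) ω) P :=
      integrable_condExp.sub integrable_condExp
    refine (norm_integral_le_of_norm_le (hd.abs.const_mul c) ?_).trans ?_
    · filter_upwards [hc] with ω h
      rw [← sub_smul, norm_smul, mul_comm]
      exact mul_le_mul_of_nonneg_right h (norm_nonneg _)
    · rw [integral_const_mul]
      exact mul_le_mul_of_nonneg_left hρ hc0
  simp only [Complex.real_smul] at h1 h4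
  rw [h1, h2]
  exact (norm_sub_le_norm_sub_add_norm_sub _ _ _).trans (add_le_add h4 h3)

/-- Central limit theorem for arrays of martingale differences, stable form. -/
theorem tendsto_setIntegral_exp_sum_mul_I {n₀ : ℕ → ℕ} (hn₀_top : Tendsto n₀ atTop atTop)
    (hn₀_le : ∀ᶠ n in atTop, n₀ n ≤ n) {Y : ℕ → ℕ → Ω → ℝ}
    (hY : ∀ᶠ n in atTop, IsMartingaleDiffOn P ℱ (Y n) (n₀ n) n) {A : Set Ω}
    (hA : MeasurableSet A) {V : Ω → ℝ} (hV : Measurable V) {C : ℝ} (hC : 0 ≤ C)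
    (hVC : ∀ᵐ ω ∂P, ω ∈ A → 0 ≤ V ω ∧ V ω ≤ C)
    (hvar : TendstoInMeasure (P.restrict A)
      (fun n ω => ∑ i ∈ Finset.Ioc (n₀ n) n, condSq P ℱ (Y n) i ω) atTop V)
    (hlind : ∀ ε : ℝ, 0 < ε → TendstoInMeasure (P.restrict A)
      (fun n ω => ∑ i ∈ Finset.Ioc (n₀ n) n, condTailSq P ℱ (Y n) ε i ω) atTop fun _ => 0) :
    Tendsto (fun n => ∫ ω in A,
      Complex.exp ((∑ i ∈ Finset.Ioc (n₀ n) n, Y n i ω : ℝ) * Complex.I) ∂P) atTop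
      (𝓝 (∫ ω in A, (Real.exp (-(V ω / 2)) : ℂ) ∂P)) := by
  set c := Real.exp ((C + 1) / 2) with hc
  have hc0 : 0 < c := Real.exp_pos _
  -- The test variable is chosen so that `W · exp (i S_n + V_n / 2)` is close to `1_A exp (i S_n)`
  -- when `V_n` is close to `V`, while `∫ W` is the desired limit.
  set W : Ω → ℝ := A.indicator fun ω => Real.exp (-(V ω / 2)) with hWdef
  have hWm : Measurable W := Measurable.indicator (by fun_prop) hA
  have hW1 : ∀ᵐ ω ∂P, |W ω| ≤ 1 := by
    filter_upwards [hVC] with ω h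
    by_cases hω : ω ∈ A
    · rw [hWdef, Set.indicator_of_mem hω, abs_of_pos (Real.exp_pos _)]
      exact Real.exp_le_one_iff.2 (by linarith [(h hω).1])
    · simp [hWdef, hω]
  have hWint : ∫ ω, (W ω : ℂ) ∂P = ∫ ω in A, (Real.exp (-(V ω / 2)) : ℂ) ∂P := by
    rw [integral_complex_ofReal, hWdef, integral_indicator hA, ← integral_complex_ofReal]
  have main : ∀ ε : ℝ, 0 < ε → ε ≤ 1 → ∀ᶠ n in atTop,
      ‖∫ ω in A, Complex.exp ((∑ i ∈ Finset.Ioc (n₀ n) n, Y n i ω : ℝ) * Complex.I) ∂P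
        - ∫ ω in A, (Real.exp (-(V ω / 2)) : ℂ) ∂P‖ ≤
      (1 + (1 + c) * 2 + (c + c * (4 + 3 * (C + 1)))) * ε := by
    intro ε hε hε1
    obtain ⟨N, hN⟩ := exists_integral_abs_condExp_sub_le (P := P) (ℱ := ℱ) (W := W) hε
    have hv1 := (tendstoInMeasure_iff_measureReal_norm.1 hvar ε hε).eventually_le_const hε
    have hl1 := (tendstoInMeasure_iff_measureReal_norm.1 (hlind ε hε) ε hε).eventually_le_const hε
    filter_upwards [hY, hn₀_le, hn₀_top.eventually_ge_atTop N, hv1, hl1]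
      with n hYn hn0 hnN hv2 hl2
    -- The budget `C + 1` leaves room for `V_n ≤ V + ε ≤ C + 1`.
    obtain ⟨M, hMm, hMc, hMZ, hMeq⟩ := hYn.exists_bounded_expMart hn0 hε.le hε1
      (C := C + 1) (by linarith)
    set S : Ω → ℝ := fun ω => ∑ i ∈ Finset.Ioc (n₀ n) n, Y n i ω with hS
    set Vn : Ω → ℝ := fun ω => ∑ i ∈ Finset.Ioc (n₀ n) n, condSq P ℱ (Y n) i ω with hVn
    set Ln : Ω → ℝ := fun ω => ∑ i ∈ Finset.Ioc (n₀ n) n, condTailSq P ℱ (Y n) ε i ω with hLn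
    have hSm : Measurable S := Finset.measurable_fun_sum _ fun i hi =>
      ((hYn.meas i hi).mono (ℱ.le i)).measurable
    have hVnm : Measurable Vn := Finset.measurable_fun_sum _ fun i hi =>
      (stronglyMeasurable_condExp.mono (ℱ.le _)).measurable
    have hLnm : Measurable Ln := Finset.measurable_fun_sum _ fun i hi =>
      (stronglyMeasurable_condExp.mono (ℱ.le _)).measurable
    have hT2 : ‖∫ ω, W ω * M ω ∂P - ∫ ω, (W ω : ℂ) ∂P‖ ≤ c * ε + c * ((4 + 3 * (C + 1)) * ε) :=
      norm_integral_smul_sub_le_of_approx hnN hWm hW1 hMm hMc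
        (fun Z hZ hZ1 => by simpa using hMZ Z 1 hZ hZ1) (hN n (hnN.trans hn0))
    have hMm0 : AEStronglyMeasurable M P := (hMm.mono (ℱ.le n)).aestronglyMeasurable
    have hWM : ∫ ω, W ω * M ω ∂P = ∫ ω in A, (Real.exp (-(V ω / 2)) : ℂ) * M ω ∂P := by
      rw [← integral_indicator hA]
      refine integral_congr_ae (ae_of_all _ fun ω => ?_)
      by_cases hω : ω ∈ A <;> simp [hWdef, hω]
    -- The exceptional set. Off `E` and on `A` nothing is stopped and the integrands differ by `|exp
    -- ((V_n - V)/2) - 1| ≤ ε`; on `E` they differ by at most `1 + c`.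
    set E : Set Ω := {ω | ε ≤ ‖Vn ω - V ω‖} ∪ {ω | ε ≤ ‖Ln ω - 0‖} with hE
    have hEm : MeasurableSet E := (measurableSet_le measurable_const (by fun_prop)).union
      (measurableSet_le measurable_const (by fun_prop))
    have hEP : (P.restrict A).real E ≤ 2 * ε := (measureReal_union_le _ _).trans (by linarith)
    have hSi : Integrable (fun ω => Complex.exp (S ω * Complex.I)) (P.restrict A) := by
      refine (integrable_const (1 : ℝ)).mono' (by fun_prop) (ae_of_all _ fun ω => ?_)
      rw [Complex.norm_exp_ofReal_mul_I]
    have hVMb : ∀ᵐ ω ∂P.restrict A, ‖(Real.exp (-(V ω / 2)) : ℂ) * M ω‖ ≤ c := by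
      rw [ae_restrict_iff' hA]
      filter_upwards [hVC, hMc] with ω h1 h2 hω
      rw [norm_mul, Complex.norm_real, Real.norm_of_nonneg (Real.exp_nonneg _)]
      exact (mul_le_of_le_one_left (norm_nonneg _)
        (Real.exp_le_one_iff.2 (by linarith [(h1 hω).1]))).trans h2
    have hVMi : Integrable (fun ω => (Real.exp (-(V ω / 2)) : ℂ) * M ω) (P.restrict A) := by
      refine (integrable_const c).mono' (AEStronglyMeasurable.mul ?_ hMm0.restrict) hVMb
      exact Measurable.aestronglyMeasurable (by fun_prop)
    have hT1 : ‖∫ ω in A, Complex.exp (S ω * Complex.I) ∂P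
        - ∫ ω in A, (Real.exp (-(V ω / 2)) : ℂ) * M ω ∂P‖ ≤ ε + (1 + c) * (2 * ε) := by
      rw [← integral_sub hSi hVMi]
      have hEi : Integrable (fun ω => (1 + c) * E.indicator 1 ω) (P.restrict A) :=
        ((integrable_const (1 : ℝ)).indicator hEm).const_mul _
      have hbi : Integrable (fun ω => ε + (1 + c) * E.indicator 1 ω) (P.restrict A) :=
        (integrable_const ε).add hEi
      refine (norm_integral_le_of_norm_le hbi ?_).trans ?_
      · have hAmem : ∀ᵐ ω ∂P.restrict A, ω ∈ A := ae_restrict_mem hA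
        filter_upwards [hVMb, ae_restrict_of_ae hVC, ae_restrict_of_ae hMeq, hAmem]
          with ω h1 h2 h3 h4
        by_cases hω : ω ∈ E
        · rw [Set.indicator_of_mem hω, Pi.one_apply, mul_one]
          refine (norm_sub_le _ _).trans ?_
          rw [Complex.norm_exp_ofReal_mul_I]
          linarith
        · rw [Set.indicator_of_notMem hω, mul_zero, add_zero]
          have h5 : |Vn ω - V ω| < ε := by
            by_contra h; exact hω (Or.inl (not_lt.1 h))
          have h6 : |Ln ω| < ε := by
            by_contra h; exact hω (Or.inr (by simpa using h))
          have h7 := abs_lt.1 h5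
          rw [h3 (by change Vn ω ≤ C + 1; linarith [(h2 h4).2]) (le_of_lt (abs_lt.1 h6).2), expMart]
          have h8 : (Real.exp (-(V ω / 2)) : ℂ) * (Complex.exp (S ω * Complex.I)
              * (Real.exp (Vn ω / 2) : ℂ))
              = Complex.exp (S ω * Complex.I) * (Real.exp ((Vn ω - V ω) / 2) : ℂ) := by
            rw [show (Vn ω - V ω) / 2 = -(V ω / 2) + Vn ω / 2 by ring, Real.exp_add]
            push_cast
            ring
          change ‖Complex.exp (S ω * Complex.I) - (Real.exp (-(V ω / 2)) : ℂ)
            * (Complex.exp (S ω * Complex.I) * (Real.exp (Vn ω / 2) : ℂ))‖ ≤ ε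
          rw [h8, ← mul_one_sub, norm_mul, Complex.norm_exp_ofReal_mul_I, one_mul,
            ← Complex.ofReal_one, ← Complex.ofReal_sub, Complex.norm_real, Real.norm_eq_abs,
            abs_sub_comm]
          have h9 : |(Vn ω - V ω) / 2| ≤ 1 := by
            rw [abs_div, abs_two]; linarith
          refine (Real.abs_exp_sub_one_le h9).trans ?_
          rw [abs_div, abs_two]
          linarith
      · rw [integral_add (integrable_const _) hEi, integral_const_mul, integral_const, integral_indicator_one hEm, smul_eq_mul]
        have h1 : (P.restrict A).real Set.univ ≤ 1 := by
          rw [measureReal_restrict_apply_univ]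
          exact measureReal_le_one
        have h2 := mul_le_mul_of_nonneg_right h1 hε.le
        have h3 := mul_le_mul_of_nonneg_left hEP (by linarith : 0 ≤ 1 + c)
        linarith
    rw [hWM, hWint] at hT2
    refine (norm_sub_le_norm_sub_add_norm_sub _ _ _).trans ((add_le_add hT1 hT2).trans
      (le_of_eq (by ring)))
  rw [Metric.tendsto_atTop']
  intro ρ hρ
  set D := 1 + (1 + c) * 2 + (c + c * (4 + 3 * (C + 1))) with hD
  have hD0 : 0 < D := by positivity
  obtain ⟨N, hN⟩ := eventually_atTop.1 (main (min 1 (ρ / (2 * D)))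
    (lt_min one_pos (by positivity)) (min_le_left _ _))
  refine ⟨N, fun n hn => ?_⟩
  rw [dist_eq_norm]
  refine (hN n hn.le).trans_lt ?_
  calc D * min 1 (ρ / (2 * D)) ≤ D * (ρ / (2 * D)) := by gcongr; exact min_le_right _ _
    _ = ρ / 2 := by field_simp
    _ < ρ := half_lt_self hρ

end StableLimit

/-! ### Negative definite matrices and their perturbations. -/

section DissipativeMatrices

open scoped Matrix.Norms.L2Operator

variable {d : ℕ}

theorem continuous_toEuclideanCLM_apply (x : EuclideanSpace ℝ (Fin d)) :
    Continuous fun M : Matrix (Fin d) (Fin d) ℝ => Matrix.toEuclideanCLM (𝕜 := ℝ) M x := by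
  have h : Continuous fun M : Matrix (Fin d) (Fin d) ℝ => M.mulVec (WithLp.ofLp x) := by fun_prop
  exact (PiLp.continuous_toLp 2 _).comp h

theorem isClosed_dissipativeMatrices (l Λ : ℝ) : IsClosed (dissipativeMatrices d l Λ) := by
  rw [dissipativeMatrices, Set.ofPred_and, Set.ofPred_forall]
  refine (isClosed_le continuous_norm continuous_const).inter (isClosed_iInter fun x => ?_)
  exact isClosed_le (continuous_const.inner (continuous_toEuclideanCLM_apply x)) continuous_const

theorem dissipativeMatrices_mono {l l' Λ Λ' : ℝ} (hl : l' ≤ l) (hΛ : Λ ≤ Λ') :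
    dissipativeMatrices d l Λ ⊆ dissipativeMatrices d l' Λ' := fun _ hM =>
  ⟨hM.1.trans hΛ, fun x => (hM.2 x).trans
    (mul_le_mul_of_nonneg_right (neg_le_neg hl) (sq_nonneg ‖x‖))⟩

theorem neg_one_mem_dissipativeMatrices {l Λ : ℝ} (hl : l ≤ 1) (hΛ : 1 ≤ Λ) :
    -1 ∈ dissipativeMatrices d l Λ := by
  refine ⟨by rw [norm_neg]; exact norm_one_matrix_le.trans hΛ, fun x => ?_⟩
  rw [map_neg, map_one]
  simp only [neg_apply, one_apply_eq_self, inner_neg_right,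
    real_inner_self_eq_norm_sq]
  nlinarith [sq_nonneg ‖x‖]

/-- The spectrum is finite, so it stays below some `-l < 0`, and for a symmetric matrix this gives
`M ≤ -l` in the Loewner order. -/
theorem exists_forall_inner_le_of_spectrum_neg {M : Matrix (Fin d) (Fin d) ℝ} (hM : M.IsSymm)
    (hs : ∀ μ ∈ spectrum ℝ M, μ < 0) : ∃ l > 0, ∀ x : EuclideanSpace ℝ (Fin d),
      inner ℝ x (Matrix.toEuclideanCLM (𝕜 := ℝ) M x) ≤ -l * ‖x‖ ^ 2 := by
  have hsa : IsSelfAdjoint M := by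
    rw [isSelfAdjoint_iff, Matrix.star_eq_conjTranspose, Matrix.conjTranspose_eq_transpose_of_trivial]
    exact hM
  obtain ⟨l, hl, hl'⟩ : ∃ l > 0, ∀ μ ∈ spectrum ℝ M, μ ≤ -l := by
    rcases (spectrum ℝ M).eq_empty_or_nonempty with h | h
    -- An empty spectrum occurs only for `d = 0`, where any `l` serves.
    · exact ⟨1, one_pos, by simp [h]⟩
    · obtain ⟨m, hm, hmax⟩ := M.finite_real_spectrum.exists_maximalFor id _ h
      refine ⟨-m, neg_pos.2 (hs m hm), fun μ hμ => ?_⟩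
      rw [neg_neg]
      rcases le_total μ m with h' | h'
      · exact h'
      · exact hmax hμ h'
  refine ⟨l, hl, fun x => ?_⟩
  open scoped MatrixOrder in
  have h1 : M ≤ algebraMap ℝ _ (-l) := le_algebraMap_of_spectrum_le hl' hsa
  have h2 := (Matrix.le_iff.1 h1).dotProduct_mulVec_nonneg (WithLp.ofLp x)
  rw [star_trivial, ← Matrix.inner_toEuclideanCLM, map_sub, Algebra.algebraMap_eq_smul_one, map_smul,
    map_one] at h2
  simp only [sub_apply, inner_sub_right, smul_apply,
    one_apply_eq_self, inner_smul_right, real_inner_self_eq_norm_sq] at h2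
  linarith

/-- Half the spectral gap survives a perturbation of size `l / 2`. One integer `k` governs the
starting time, the gap and the norm bound, so that the localising events of the main proof form a
single increasing sequence. -/
theorem exists_forall_ge_mem_dissipativeMatrices {M : Matrix (Fin d) (Fin d) ℝ} (hM : M.IsSymm)
    (hs : ∀ μ ∈ spectrum ℝ M, μ < 0) {Mn : ℕ → Matrix (Fin d) (Fin d) ℝ}
    (hlim : Tendsto Mn atTop (𝓝 M)) :
    ∃ k : ℕ, ∀ n ≥ k, Mn n ∈ dissipativeMatrices d (1 / (k + 1)) (k + 1) := by
  obtain ⟨l, hl, hlM⟩ := exists_forall_inner_le_of_spectrum_neg hM hs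
  have hd := (tendsto_iff_norm_sub_tendsto_zero.1 hlim).eventually_le_const (half_pos hl)
  obtain ⟨N, hN⟩ := eventually_atTop.1 hd
  obtain ⟨k1, hk1⟩ := exists_nat_ge (‖M‖ + l / 2)
  obtain ⟨k2, hk2⟩ := exists_nat_one_div_lt (half_pos hl)
  refine ⟨max N (max k1 k2), fun n hn => ?_⟩
  have hmem : Mn n ∈ dissipativeMatrices d (l / 2) (‖M‖ + l / 2) := by
    have h1 := hN n ((le_max_left _ _).trans hn)
    refine ⟨?_, fun x => ?_⟩
    · have := norm_add_le M (Mn n - M)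
      rw [add_sub_cancel] at this
      linarith
    · have h2 : Matrix.toEuclideanCLM (𝕜 := ℝ) (Mn n) x = Matrix.toEuclideanCLM (𝕜 := ℝ) M x
          + Matrix.toEuclideanCLM (𝕜 := ℝ) (Mn n - M) x := by
        rw [map_sub]; simp
      have h3 : inner ℝ x (Matrix.toEuclideanCLM (𝕜 := ℝ) (Mn n - M) x) ≤ l / 2 * ‖x‖ ^ 2 := by
        refine (real_inner_le_norm _ _).trans ?_
        have h4 := ContinuousLinearMap.le_opNorm (Matrix.toEuclideanCLM (𝕜 := ℝ) (Mn n - M)) x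
        rw [← Matrix.cstar_norm_def] at h4
        calc _ ≤ ‖x‖ * (l / 2 * ‖x‖) := by
              gcongr
              exact h4.trans (by gcongr)
          _ = _ := by ring
      rw [h2, inner_add_right]
      linarith [hlM x]
  refine dissipativeMatrices_mono ?_ ?_ hmem
  · refine le_trans ?_ hk2.le
    have : (k2 : ℝ) ≤ (max N (max k1 k2) : ℕ) := by
      exact_mod_cast (le_max_right _ _).trans (le_max_right _ _)
    gcongr
  · have : (k1 : ℝ) ≤ (max N (max k1 k2) : ℕ) := by
      exact_mod_cast (le_max_left _ _).trans (le_max_right _ _)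
    linarith

theorem isUnit_of_spectrum_neg {M : Matrix (Fin d) (Fin d) ℝ}
    (hs : ∀ μ ∈ spectrum ℝ M, μ < 0) : IsUnit M := by
  by_contra h
  exact lt_irrefl 0 (hs 0 ((spectrum.zero_mem_iff ℝ).2 h))

theorem continuous_matProdBar (γ b : ℕ → ℝ) (i n : ℕ) :
    Continuous fun M : Matrix (Fin d) (Fin d) ℝ => matProdBar γ b M i n := by
  have h : ∀ j, Continuous fun M : Matrix (Fin d) (Fin d) ℝ => matProd γ M i j := fun j =>
    continuous_list_prod _ fun r _ => continuous_const.add (continuous_id.const_smul (γ r))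
  exact continuous_finsetSum _ fun r _ => (h r).const_smul (γ i * b r / b i)

end DissipativeMatrices

/-! ### Measurability of matrix valued maps through their entries. -/

section MeasurableMatrices

variable {d : ℕ}

/-- A matrix valued map with measurable entries composed with a continuous function. -/
theorem measurable_comp_of_entries {Ω E : Type*} {m : MeasurableSpace Ω} [TopologicalSpace E]
    [MeasurableSpace E] [BorelSpace E] {S : Ω → Matrix (Fin d) (Fin d) ℝ}
    (hS : ∀ i j, Measurable fun ω => S ω i j) {φ : Matrix (Fin d) (Fin d) ℝ → E}
    (hφ : Continuous φ) : Measurable fun ω => φ (S ω) := by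
  have h : @Measurable Ω (Fin d → Fin d → ℝ) _ _ S :=
    measurable_pi_iff.2 fun i => measurable_pi_iff.2 fun j => hS i j
  have h2 : @Continuous (Fin d → Fin d → ℝ) E _ _ φ := hφ
  exact h2.measurable.comp h

theorem measurableSet_preimage_of_entries {Ω : Type*} {m : MeasurableSpace Ω}
    {S : Ω → Matrix (Fin d) (Fin d) ℝ}
    (hS : ∀ i j, Measurable fun ω => S ω i j) {G : Set (Matrix (Fin d) (Fin d) ℝ)}
    (hG : IsClosed G) : MeasurableSet (S ⁻¹' G) := by
  have h : @Measurable Ω (Fin d → Fin d → ℝ) _ _ S :=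
    measurable_pi_iff.2 fun i => measurable_pi_iff.2 fun j => hS i j
  have h2 : @IsClosed (Fin d → Fin d → ℝ) _ G := hG
  exact h h2.measurableSet

end MeasurableMatrices

/-! ### The cutoff `L(n)` and weighted averages. -/

section Deterministic

/-- With `s_n = √(n γ_n) → ∞`, cut off the last `⌈n / s_n⌉` indices. Their number is `o(n)`, yet the
steps over them sum to at least `(n / s_n) γ_n = s_n`, as `γ` decreases. -/
theorem exists_cutoff {γ : ℕ → ℝ} {n₀ : ℕ → ℕ} (hγ_anti : AntitoneOn γ (Set.Ici 1))
    (hn₀_le : ∀ n, 1 ≤ n → n₀ n ≤ n)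
    (hnγ : Tendsto (fun n : ℕ => (n : ℝ) * γ n) atTop atTop) :
    ∃ L : ℕ → ℕ, (∀ n, 1 ≤ n → n₀ n ≤ L n ∧ L n ≤ n) ∧
      ((fun n : ℕ => (n : ℝ) - (L n : ℝ)) =o[atTop] fun n : ℕ => (n : ℝ)) ∧
      ∀ T : ℝ, ∀ᶠ n in atTop, ∀ i ∈ Finset.Ioc (n₀ n) (L n),
        T ≤ ∑ k ∈ Finset.Ioc i n, γ k := by
  set s : ℕ → ℝ := fun n => √((n : ℝ) * γ n) with hs
  have hs_top : Tendsto s atTop atTop := Real.tendsto_sqrt_atTop.comp hnγ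
  set c : ℕ → ℕ := fun n => ⌈(n : ℝ) / s n⌉₊ with hc
  refine ⟨fun n => max (n₀ n) (n - c n), fun n hn => ⟨le_max_left _ _,
    max_le (hn₀_le n hn) (Nat.sub_le _ _)⟩, ?_, fun T => ?_⟩
  · have h1 : Tendsto (fun n : ℕ => 1 / s n + 1 / (n : ℝ)) atTop (𝓝 0) := by
      simpa using (tendsto_const_nhds (x := (1 : ℝ)).div_atTop hs_top).add
        (tendsto_const_nhds (x := (1 : ℝ)).div_atTop tendsto_natCast_atTop_atTop)
    refine (IsBigO.of_bound 1 ?_).trans_isLittleO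
      (g := fun n : ℕ => (1 / s n + 1 / (n : ℝ)) * (n : ℝ)) ?_
    · filter_upwards [eventually_ge_atTop 1, hs_top.eventually_gt_atTop 0] with n hn hsn
      have hn' : (0 : ℝ) < n := by exact_mod_cast hn
      have hle : max (n₀ n) (n - c n) ≤ n := max_le (hn₀_le n hn) (Nat.sub_le _ _)
      have h2 : n - max (n₀ n) (n - c n) ≤ c n := by omega
      have h3 : (n : ℝ) - (max (n₀ n) (n - c n) : ℕ) ≤ c n := by
        rw [← Nat.cast_sub hle]; exact_mod_cast h2
      have h4 : (c n : ℝ) < n / s n + 1 := Nat.ceil_lt_add_one (by positivity)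
      have h5 : (0 : ℝ) ≤ (n : ℝ) - (max (n₀ n) (n - c n) : ℕ) :=
        sub_nonneg.2 (by exact_mod_cast hle)
      rw [Real.norm_of_nonneg h5, one_mul]
      refine le_trans ?_ (Real.le_norm_self _)
      have h6 : (1 / s n + 1 / (n : ℝ)) * n = n / s n + 1 := by field_simp
      linarith
    · have := (isLittleO_one_iff ℝ).2 h1
      simpa using this.mul_isBigO (isBigO_refl (fun n : ℕ => (n : ℝ)) atTop)
  · filter_upwards [hs_top.eventually_ge_atTop T, hs_top.eventually_gt_atTop 0,
      eventually_ge_atTop 1] with n hT hsn hn i hi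
    rw [Finset.mem_Ioc] at hi
    have hn' : (0 : ℝ) < n := by exact_mod_cast hn
    have hnγ0 : 0 < (n : ℝ) * γ n := Real.sqrt_pos.1 hsn
    have hγn : 0 < γ n := pos_of_mul_pos_right hnγ0 hn'.le
    -- Because `i > n₀ n`, the maximum defining the cutoff must be `n - c n`, and the subtraction is
    -- not truncated.
    have hi2 : i + c n ≤ n := by
      have := hi.2
      omega
    have h1 : (n - i : ℕ) • γ n ≤ ∑ k ∈ Finset.Ioc i n, γ k := by
      rw [← Nat.card_Ioc]
      refine Finset.card_nsmul_le_sum _ _ _ fun k hk => ?_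
      rw [Finset.mem_Ioc] at hk
      exact hγ_anti (Set.mem_Ici.2 (by omega)) (Set.mem_Ici.2 hn) hk.2
    have h2 : (n : ℝ) / s n ≤ (n - i : ℕ) :=
      (Nat.le_ceil _).trans (by exact_mod_cast (by omega : c n ≤ n - i))
    have h3 : s n = (n : ℝ) / s n * γ n := by
      have : s n * s n = n * γ n := Real.mul_self_sqrt hnγ0.le
      field_simp
      linarith
    rw [nsmul_eq_mul] at h1
    calc T ≤ s n := hT
      _ = (n : ℝ) / s n * γ n := h3
      _ ≤ (n - i : ℕ) * γ n := by gcongr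
      _ ≤ _ := h1

/-- Up to `L n` the values are uniformly close to `v`; beyond it they are only bounded, but the
weights there sum to something negligible. -/
theorem tendsto_weighted_sum {n₀ L : ℕ → ℕ} {w q : ℕ → ℕ → ℝ} {v B : ℝ}
    (hL : ∀ᶠ n in atTop, n₀ n ≤ L n ∧ L n ≤ n) (hw : ∀ n i, 0 ≤ w n i)
    (hw1 : ∀ᶠ n in atTop, ∑ i ∈ Finset.Ioc (n₀ n) n, w n i = 1)
    (hwL : Tendsto (fun n => ∑ i ∈ Finset.Ioc (L n) n, w n i) atTop (𝓝 0))
    (hB : ∀ᶠ n in atTop, ∀ i ∈ Finset.Ioc (n₀ n) n, |q n i - v| ≤ B)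
    (hq : ∀ ε > 0, ∀ᶠ n in atTop, ∀ i ∈ Finset.Ioc (n₀ n) (L n), |q n i - v| ≤ ε) :
    Tendsto (fun n => ∑ i ∈ Finset.Ioc (n₀ n) n, w n i * q n i) atTop (𝓝 v) := by
  have key : ∀ ε > 0, ∀ᶠ n in atTop, |∑ i ∈ Finset.Ioc (n₀ n) n, w n i * q n i - v| ≤ ε := by
    intro ε hε
    have hwB : ∀ᶠ n in atTop, (∑ i ∈ Finset.Ioc (L n) n, w n i) * B ≤ ε / 2 := by
      have h := hwL.mul_const B
      rw [zero_mul] at h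
      exact h.eventually_le_const (half_pos hε)
    filter_upwards [hL, hw1, hwB, hB, hq (ε / 2) (half_pos hε)] with n h1 h2 h3 h4 h5
    have h6 : ∑ i ∈ Finset.Ioc (n₀ n) n, w n i * q n i - v
        = ∑ i ∈ Finset.Ioc (n₀ n) n, w n i * (q n i - v) := by
      simp_rw [mul_sub]
      rw [Finset.sum_sub_distrib, ← Finset.sum_mul, h2, one_mul]
    have hun : Finset.Ioc (n₀ n) (L n) ∪ Finset.Ioc (L n) n = Finset.Ioc (n₀ n) n :=
      Finset.Ioc_union_Ioc_eq_Ioc h1.1 h1.2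
    have hdis : Disjoint (Finset.Ioc (n₀ n) (L n)) (Finset.Ioc (L n) n) := by
      rw [Finset.disjoint_left]
      intro x hx hx'
      rw [Finset.mem_Ioc] at hx hx'
      omega
    have h7 : ∑ i ∈ Finset.Ioc (n₀ n) (L n), w n i ≤ 1 := by
      rw [← h2, ← hun, Finset.sum_union hdis]
      exact le_add_of_nonneg_right (Finset.sum_nonneg fun i _ => hw n i)
    rw [h6]
    refine (Finset.abs_sum_le_sum_abs _ _).trans ?_
    rw [← hun, Finset.sum_union hdis]
    have h8 : ∑ i ∈ Finset.Ioc (n₀ n) (L n), |w n i * (q n i - v)| ≤ ε / 2 := by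
      calc _ ≤ ∑ i ∈ Finset.Ioc (n₀ n) (L n), w n i * (ε / 2) := by
            refine Finset.sum_le_sum fun i hi => ?_
            rw [abs_mul, abs_of_nonneg (hw n i)]
            exact mul_le_mul_of_nonneg_left (h5 i hi) (hw n i)
        _ ≤ ε / 2 := by
            rw [← Finset.sum_mul]
            exact mul_le_of_le_one_left (half_pos hε).le h7
    have h9 : ∑ i ∈ Finset.Ioc (L n) n, |w n i * (q n i - v)| ≤ ε / 2 := by
      refine le_trans ?_ h3
      rw [Finset.sum_mul]
      refine Finset.sum_le_sum fun i hi => ?_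
      rw [abs_mul, abs_of_nonneg (hw n i)]
      exact mul_le_mul_of_nonneg_left
        (h4 i (Finset.Ioc_subset_Ioc_left h1.1 hi)) (hw n i)
    linarith
  rw [Metric.tendsto_atTop']
  intro ε hε
  obtain ⟨N, hN⟩ := eventually_atTop.1 (key (ε / 2) (half_pos hε))
  exact ⟨N, fun n hn => (hN n hn.le).trans_lt (half_lt_self hε)⟩

end Deterministic

/-! ### Conditional moments of `⟪g, D⟫` for predictable `g`. -/

section ConditionalMoments

variable {Ω : Type*} {m m0 : MeasurableSpace Ω} {P : Measure Ω} {d : ℕ}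
  {D g : Ω → EuclideanSpace ℝ (Fin d)} {ρ : ℝ}

theorem inner_eq_sum_coord (x y : EuclideanSpace ℝ (Fin d)) : inner ℝ x y = ∑ l, x l * y l := by
  simp [PiLp.inner_apply, mul_comm]

theorem abs_coord_le_norm (x : EuclideanSpace ℝ (Fin d)) (l : Fin d) : |x l| ≤ ‖x‖ :=
  PiLp.norm_apply_le x l

theorem memLp_coord (hD : MemLp D 2 P) (l : Fin d) : MemLp (fun ω => D ω l) 2 P :=
  hD.continuousLinearMap_comp (EuclideanSpace.proj l : EuclideanSpace ℝ (Fin d) →L[ℝ] ℝ)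

theorem stronglyMeasurable_coord (hg : StronglyMeasurable[m] g) (l : Fin d) :
    StronglyMeasurable[m] fun ω => g ω l :=
  (EuclideanSpace.proj l : EuclideanSpace ℝ (Fin d) →L[ℝ] ℝ).continuous.comp_stronglyMeasurable hg

theorem memLp_mul_inner (hm : m ≤ m0) (hD : MemLp D 2 P) (hg : StronglyMeasurable[m] g)
    (hρ : ∀ ω, ‖g ω‖ ≤ ρ) (c : ℝ) : MemLp (fun ω => c * inner ℝ (g ω) (D ω)) 2 P := by
  refine MemLp.of_le_mul (c := |c| * ρ) hD
    ((((hg.mono hm).aestronglyMeasurable).inner hD.aestronglyMeasurable).const_mul c)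
    (ae_of_all _ fun ω => ?_)
  rw [norm_mul, Real.norm_eq_abs, mul_assoc]
  gcongr
  exact (norm_inner_le_norm _ _).trans (by gcongr; exact hρ ω)

theorem condExp_bounded_mul (hm : m ≤ m0) {a X : Ω → ℝ} {c : ℝ} (ha : StronglyMeasurable[m] a)
    (hc : ∀ ω, |a ω| ≤ c) (hX : Integrable X P) :
    Integrable (fun ω => a ω * X ω) P ∧
      P[fun ω => a ω * X ω | m] =ᵐ[P] fun ω => a ω * (P[X | m]) ω := by
  have hi : Integrable (fun ω => a ω * X ω) P :=
    hX.bdd_mul (ha.mono hm).aestronglyMeasurable (ae_of_all _ hc)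
  exact ⟨hi, condExp_mul_of_stronglyMeasurable_left ha hi hX⟩

/-- By Cauchy–Schwarz `|c ⟪g, D⟫| ≤ |c| ρ ‖D‖`, so exceeding `ε` forces `‖D‖ > ε'`. -/
theorem condExp_tailSq_mul_inner_le (hm : m ≤ m0) (hD : MemLp D 2 P)
    (hg : StronglyMeasurable[m] g) (hρ : ∀ ω, ‖g ω‖ ≤ ρ) {c ε ε' : ℝ} (hε : |c| * ρ * ε' ≤ ε) :
    P[fun ω => tailSq ε (c * inner ℝ (g ω) (D ω)) | m] ≤ᵐ[P] fun ω => (c * ρ) ^ 2 *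
      (P[Set.indicator {ω' | ε' < ‖D ω'‖} (fun ω' => ‖D ω'‖ ^ 2) | m]) ω := by
  have hY := memLp_mul_inner hm hD hg hρ c
  have hi1 : Integrable (fun ω => tailSq ε (c * inner ℝ (g ω) (D ω))) P := by
    refine hY.integrable_sq.mono' ((measurable_tailSq ε).comp_aemeasurable
      hY.aemeasurable).aestronglyMeasurable (ae_of_all _ fun ω => ?_)
    rw [Real.norm_of_nonneg (tailSq_nonneg _ _)]
    exact tailSq_le _ _
  have hset : NullMeasurableSet {ω' | ε' < ‖D ω'‖} P :=
    nullMeasurableSet_lt aemeasurable_const hD.aestronglyMeasurable.norm.aemeasurable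
  have hi2 : Integrable (Set.indicator {ω' | ε' < ‖D ω'‖} fun ω' => ‖D ω'‖ ^ 2) P :=
    (hD.integrable_norm_pow (by norm_num)).indicator₀ hset
  have hle : (fun ω => tailSq ε (c * inner ℝ (g ω) (D ω))) ≤ᵐ[P]
      (c * ρ) ^ 2 • Set.indicator {ω' | ε' < ‖D ω'‖} fun ω' => ‖D ω'‖ ^ 2 := by
    refine ae_of_all _ fun ω => ?_
    have hρ0 : 0 ≤ ρ := (norm_nonneg _).trans (hρ ω)
    have h1 : |c * inner ℝ (g ω) (D ω)| ≤ |c| * ρ * ‖D ω‖ := by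
      rw [abs_mul, mul_assoc]
      gcongr
      exact (abs_real_inner_le_norm _ _).trans (by gcongr; exact hρ ω)
    simp only [tailSq, Pi.smul_apply, smul_eq_mul]
    by_cases h : ε < |c * inner ℝ (g ω) (D ω)|
    · have h2 : ε' < ‖D ω‖ := by
        by_contra h3
        have : |c| * ρ * ‖D ω‖ ≤ |c| * ρ * ε' := by
          gcongr
          exact not_lt.1 h3
        linarith
      rw [Set.indicator_of_mem (by exact h), Set.indicator_of_mem (by exact h2), ← sq_abs,
        ← sq_abs (c * ρ), ← mul_pow, abs_mul c ρ, abs_of_nonneg hρ0]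
      gcongr
    · rw [Set.indicator_of_notMem (by exact h)]
      exact mul_nonneg (sq_nonneg _) (Set.indicator_nonneg (fun _ _ => sq_nonneg _) _)
  refine (condExp_mono hi1 (hi2.smul _) hle).trans (condExp_smul _ _ m).le

variable [IsProbabilityMeasure P]

theorem condExp_coord_eq_zero (hD : MemLp D 2 P) (hmart : P[D | m] =ᵐ[P] 0) (l : Fin d) :
    P[fun ω => D ω l | m] =ᵐ[P] 0 := by
  have h := ContinuousLinearMap.comp_condExp_comm (m := m) (hD.integrable (by norm_num))
    (EuclideanSpace.proj l : EuclideanSpace ℝ (Fin d) →L[ℝ] ℝ)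
  filter_upwards [h, hmart] with ω h1 h2
  have h3 : (P[fun ω => D ω l | m]) ω = ((EuclideanSpace.proj l : EuclideanSpace ℝ (Fin d) →L[ℝ] ℝ)
      ∘ P[D | m]) ω := h1.symm
  rw [h3]
  simp [h2]

theorem condExp_mul_inner_eq_zero (hm : m ≤ m0) (hD : MemLp D 2 P) (hmart : P[D | m] =ᵐ[P] 0)
    (hg : StronglyMeasurable[m] g) (hρ : ∀ ω, ‖g ω‖ ≤ ρ) (c : ℝ) :
    P[fun ω => c * inner ℝ (g ω) (D ω) | m] =ᵐ[P] 0 := by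
  have he : (fun ω => c * inner ℝ (g ω) (D ω)) = ∑ l, fun ω => (c * g ω l) * D ω l := by
    funext ω
    rw [inner_eq_sum_coord, Finset.mul_sum, Finset.sum_apply]
    exact Finset.sum_congr rfl fun l _ => by ring
  have hl : ∀ l, Integrable (fun ω => (c * g ω l) * D ω l) P ∧
      P[fun ω => (c * g ω l) * D ω l | m] =ᵐ[P] fun ω => (c * g ω l) * (P[fun ω => D ω l | m]) ω :=
    fun l => condExp_bounded_mul hm (c := |c| * ρ) ((stronglyMeasurable_coord hg l).const_mul c)
      (fun ω => by
        rw [abs_mul]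
        gcongr
        exact (abs_coord_le_norm _ _).trans (hρ ω)) ((memLp_coord hD l).integrable (by norm_num))
  rw [he]
  refine (condExp_finsetSum (fun l _ => (hl l).1) m).trans ?_
  filter_upwards [ae_all_iff.2 fun l => (hl l).2,
    ae_all_iff.2 fun l => condExp_coord_eq_zero hD hmart l] with ω h1 h2
  rw [Finset.sum_apply]
  exact Finset.sum_eq_zero fun l _ => by rw [h1, h2]; simp

theorem condCovMatrix_inv_smul (hD : MemLp D 2 P) (hmart : P[D | m] =ᵐ[P] 0) (δ : ℝ) :
    ∀ᵐ ω ∂P, ∀ l l', condCovMatrix P m (fun ω' => δ⁻¹ • D ω') ω l l' =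
      δ⁻¹ ^ 2 * (P[fun ω => D ω l * D ω l' | m]) ω := by
  refine ae_all_iff.2 fun l => ae_all_iff.2 fun l' => ?_
  have h0 : ∀ l, P[fun ω => (δ⁻¹ • D ω) l | m] =ᵐ[P] 0 := fun l =>
    condExp_coord_eq_zero (hD.const_smul δ⁻¹) ((condExp_smul δ⁻¹ D m).trans (by
      filter_upwards [hmart] with ω h
      simp [h])) l
  have h1 : (fun ω' => ((δ⁻¹ • D ω') l - (P[fun ω'' => (δ⁻¹ • D ω'') l | m]) ω') *
      ((δ⁻¹ • D ω') l' - (P[fun ω'' => (δ⁻¹ • D ω'') l' | m]) ω'))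
      =ᵐ[P] δ⁻¹ ^ 2 • fun ω => D ω l * D ω l' := by
    filter_upwards [h0 l, h0 l'] with ω h2 h3
    rw [h2, h3]
    simp only [Pi.zero_apply, sub_zero, PiLp.smul_apply, smul_eq_mul, Pi.smul_apply]
    ring
  filter_upwards [condExp_congr_ae h1 (m := m),
    condExp_smul (δ⁻¹ ^ 2) (fun ω => D ω l * D ω l') m (μ := P)] with ω h2 h3
  rw [condCovMatrix, Matrix.of_apply]
  exact h2.trans h3

/-- Expand the square in coordinates and pull the products of entries of `g` out of the conditional
expectation. The conditional mean vanishes, so what remains are the entries of the conditional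
covariance. -/
theorem condExp_sq_mul_inner (hm : m ≤ m0) (hD : MemLp D 2 P) (hmart : P[D | m] =ᵐ[P] 0)
    (hg : StronglyMeasurable[m] g) (hρ : ∀ ω, ‖g ω‖ ≤ ρ) (c : ℝ) {δ : ℝ} (hδ : δ ≠ 0) :
    P[fun ω => (c * inner ℝ (g ω) (D ω)) ^ 2 | m] =ᵐ[P] fun ω => (c * δ) ^ 2 *
      inner ℝ (g ω) (Matrix.toEuclideanCLM (𝕜 := ℝ)
        (condCovMatrix P m (fun ω' => δ⁻¹ • D ω') ω) (g ω)) := by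
  have he : (fun ω => (c * inner ℝ (g ω) (D ω)) ^ 2)
      = ∑ p : Fin d × Fin d, fun ω => (c ^ 2 * (g ω p.1 * g ω p.2)) * (D ω p.1 * D ω p.2) := by
    funext ω
    rw [inner_eq_sum_coord, mul_pow, sq (∑ l, g ω l * D ω l), Finset.sum_mul_sum, Finset.mul_sum,
      Finset.sum_apply, ← Finset.univ_product_univ, Finset.sum_product]
    refine Finset.sum_congr rfl fun l _ => ?_
    rw [Finset.mul_sum]
    exact Finset.sum_congr rfl fun l' _ => by ring
  have hl : ∀ p : Fin d × Fin d,
      Integrable (fun ω => (c ^ 2 * (g ω p.1 * g ω p.2)) * (D ω p.1 * D ω p.2)) P ∧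
      P[fun ω => (c ^ 2 * (g ω p.1 * g ω p.2)) * (D ω p.1 * D ω p.2) | m] =ᵐ[P]
        fun ω => (c ^ 2 * (g ω p.1 * g ω p.2)) * (P[fun ω => D ω p.1 * D ω p.2 | m]) ω :=
    fun p => condExp_bounded_mul hm (c := c ^ 2 * (ρ * ρ))
      (((stronglyMeasurable_coord hg p.1).mul (stronglyMeasurable_coord hg p.2)).const_mul _)
      (fun ω => by
        rw [abs_mul, abs_mul, abs_of_nonneg (sq_nonneg c)]
        have h1 := (abs_coord_le_norm (g ω) p.1).trans (hρ ω)
        have h2 := (abs_coord_le_norm (g ω) p.2).trans (hρ ω)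
        gcongr
        exact (abs_nonneg _).trans h1)
      ((memLp_coord hD p.1).integrable_mul (memLp_coord hD p.2))
  rw [he]
  refine (condExp_finsetSum (fun p _ => (hl p).1) m).trans ?_
  filter_upwards [ae_all_iff.2 fun p => (hl p).2, condCovMatrix_inv_smul hD hmart δ] with ω h1 h2
  rw [Finset.sum_apply, Matrix.inner_toEuclideanCLM, dotProduct, Finset.mul_sum,
    ← Finset.univ_product_univ, Finset.sum_product]
  refine Finset.sum_congr rfl fun l _ => ?_
  rw [Matrix.mulVec, dotProduct, Finset.mul_sum, Finset.mul_sum]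
  refine Finset.sum_congr rfl fun l' _ => ?_
  rw [h1, h2]
  field_simp

end ConditionalMoments

/-! ### The central limit theorem for weighted sums with predictable coefficients. -/

section WeightedSums

open scoped Matrix.Norms.L2Operator

variable {Ω : Type*} {m0 : MeasurableSpace Ω} {P : Measure Ω} {d : ℕ}

theorem tendstoInMeasure_zero_of_le_mul {μ : Measure Ω} {f h : ℕ → Ω → ℝ} {c : ℝ} (hc : 0 < c)
    (hf : ∀ᶠ n in atTop, ∀ᵐ ω ∂μ, 0 ≤ f n ω ∧ f n ω ≤ c * h n ω)
    (hh : TendstoInMeasure μ h atTop fun _ => 0) : TendstoInMeasure μ f atTop fun _ => 0 := by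
  rw [tendstoInMeasure_iff_norm] at hh ⊢
  intro ε hε
  refine tendsto_of_tendsto_of_tendsto_of_le_of_le' tendsto_const_nhds (hh (ε / c) (by positivity))
    (Eventually.of_forall fun _ => zero_le) ?_
  filter_upwards [hf] with n hn
  refine measure_mono_ae ?_
  filter_upwards [hn] with ω h1 (h2 : ε ≤ ‖f n ω - 0‖)
  change ε / c ≤ ‖h n ω - 0‖
  rw [sub_zero] at h2 ⊢
  rw [Real.norm_of_nonneg h1.1] at h2
  rw [div_le_iff₀ hc]
  have := Real.le_norm_self (h n ω)
  nlinarith [h1.2]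

theorem abs_inner_toEuclideanCLM_le (M : Matrix (Fin d) (Fin d) ℝ) (x : EuclideanSpace ℝ (Fin d)) :
    |inner ℝ x (Matrix.toEuclideanCLM (𝕜 := ℝ) M x)| ≤ ‖M‖ * ‖x‖ ^ 2 := by
  refine (abs_real_inner_le_norm _ _).trans ?_
  have h := ContinuousLinearMap.le_opNorm (Matrix.toEuclideanCLM (𝕜 := ℝ) M) x
  rw [← Matrix.cstar_norm_def] at h
  calc _ ≤ ‖x‖ * (‖M‖ * ‖x‖) := by gcongr
    _ = _ := by ring

theorem continuous_inner_toEuclideanCLM :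
    Continuous fun p : EuclideanSpace ℝ (Fin d) × Matrix (Fin d) (Fin d) ℝ =>
      inner ℝ p.1 (Matrix.toEuclideanCLM (𝕜 := ℝ) p.2 p.1) := by
  simp_rw [Matrix.inner_toEuclideanCLM]
  have h : Continuous fun p : EuclideanSpace ℝ (Fin d) × Matrix (Fin d) (Fin d) ℝ =>
      WithLp.ofLp p.1 := (PiLp.continuous_ofLp 2 _).comp continuous_fst
  exact h.dotProduct (Continuous.matrix_mulVec continuous_snd h)

/-- Quadratic forms along convergent covariances and nearly constant vectors, averaged. -/
theorem tendsto_weighted_quadraticForms {n₀ L : ℕ → ℕ} (hn₀_top : Tendsto n₀ atTop atTop)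
    {w : ℕ → ℕ → ℝ} (hL : ∀ᶠ n in atTop, n₀ n ≤ L n ∧ L n ≤ n) (hw : ∀ n i, 0 ≤ w n i)
    (hw1 : ∀ᶠ n in atTop, ∑ i ∈ Finset.Ioc (n₀ n) n, w n i = 1)
    (hwL : Tendsto (fun n => ∑ i ∈ Finset.Ioc (L n) n, w n i) atTop (𝓝 0))
    {C : ℕ → Matrix (Fin d) (Fin d) ℝ} {G : Matrix (Fin d) (Fin d) ℝ}
    (hC : Tendsto C atTop (𝓝 G)) {g : ℕ → ℕ → EuclideanSpace ℝ (Fin d)}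
    {g' : EuclideanSpace ℝ (Fin d)} {ρ : ℝ}
    (hρ : ∀ᶠ n in atTop, ∀ i ∈ Finset.Ioc (n₀ n) n, ‖g n i‖ ≤ ρ)
    (hg : ∀ ε > 0, ∀ᶠ n in atTop, ∀ i ∈ Finset.Ioc (n₀ n) (L n), ‖g n i - g'‖ ≤ ε) :
    Tendsto (fun n => ∑ i ∈ Finset.Ioc (n₀ n) n,
        w n i * inner ℝ (g n i) (Matrix.toEuclideanCLM (𝕜 := ℝ) (C i) (g n i))) atTop
      (𝓝 (inner ℝ g' (Matrix.toEuclideanCLM (𝕜 := ℝ) G g'))) := by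
  have hCn := tendsto_iff_norm_sub_tendsto_zero.1 hC
  have hlift : ∀ {p : ℕ → Prop}, (∀ᶠ i in atTop, p i) →
      ∀ᶠ n in atTop, ∀ i, n₀ n < i → p i := fun {p} hp => by
    filter_upwards [hn₀_top.eventually (eventually_forall_ge_atTop.2 hp)] with n h i hi
    exact h i hi.le
  refine tendsto_weighted_sum (B := (‖G‖ + 1) * ρ ^ 2
    + |inner ℝ g' (Matrix.toEuclideanCLM (𝕜 := ℝ) G g')|) hL hw hw1 hwL ?_ fun ε hε => ?_
  · filter_upwards [hρ, hlift (hCn.eventually_le_const one_pos)] with n h1 h2 i hi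
    have h3 := h1 i hi
    have h4 := h2 i (Finset.mem_Ioc.1 hi).1
    have h5 : ‖C i‖ ≤ ‖G‖ + 1 := by
      have := norm_add_le G (C i - G)
      rw [add_sub_cancel] at this
      linarith
    refine (abs_sub _ _).trans (add_le_add ((abs_inner_toEuclideanCLM_le _ _).trans ?_) le_rfl)
    gcongr
  · have hcont := (continuous_inner_toEuclideanCLM (d := d)).continuousAt (x := (g', G))
    obtain ⟨r, hr, hball⟩ := Metric.continuousAt_iff.1 hcont ε hε
    filter_upwards [hg (r / 2) (half_pos hr), hlift (hCn.eventually_le_const (half_pos hr))]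
      with n h1 h2 i hi
    have h3 := h1 i hi
    have h4 := h2 i (Finset.mem_Ioc.1 hi).1
    have h5 : dist (g n i, C i) (g', G) < r := by
      rw [Prod.dist_eq, dist_eq_norm, dist_eq_norm]
      exact (max_le h3 h4).trans_lt (half_lt_self hr)
    have h6 := hball h5
    rw [Real.dist_eq] at h6
    exact h6.le

variable [IsProbabilityMeasure P] {ℱ : Filtration ℕ m0}

/-- Stable central limit theorem for `∑ (b_i / s_n) ⟪g_{n,i}, D_i⟫`. -/
theorem tendsto_setIntegral_exp_weighted {b δ : ℕ → ℝ} {n₀ L : ℕ → ℕ}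
    (hn₀_lt : ∀ᶠ n in atTop, n₀ n < n) (hn₀_top : Tendsto n₀ atTop atTop)
    (hb : ∀ n, 1 ≤ n → 0 < b n) (hδ : ∀ n, 1 ≤ n → 0 < δ n)
    (hL : ∀ᶠ n in atTop, n₀ n ≤ L n ∧ L n ≤ n)
    (hwL : Tendsto (fun n => (∑ k ∈ Finset.Ioc (L n) n, (b k * δ k) ^ 2) /
        ∑ k ∈ Finset.Ioc (n₀ n) n, (b k * δ k) ^ 2) atTop (𝓝 0))
    {D : ℕ → Ω → EuclideanSpace ℝ (Fin d)}
    (hD_adapted : ∀ k, 1 ≤ k → StronglyMeasurable[ℱ k] (D k))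
    (hD_sq : ∀ k, 1 ≤ k → MemLp (D k) 2 P)
    (hD_mart : ∀ k, 1 ≤ k → P[D k | ℱ (k - 1)] =ᵐ[P] 0)
    {Γ : Ω → Matrix (Fin d) (Fin d) ℝ} {A : Set Ω} (hA : MeasurableSet A)
    (hD_cov : ∀ᵐ ω ∂P, ω ∈ A →
      Tendsto (fun m => condCovMatrix P (ℱ (m - 1)) (fun ω' => (δ m)⁻¹ • D m ω') ω) atTop
        (𝓝 (Γ ω)))
    (hD_lindeberg : ∀ ε : ℝ, 0 < ε →
      TendstoInMeasure (P.restrict A)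
        (fun n ω => (sigmaSeq b δ n₀ n ^ 2)⁻¹ * ∑ m ∈ Finset.Ioc (n₀ n) n,
          b m ^ 2 / bBar b n₀ n ^ 2 *
            (P[Set.indicator {ω' | ε * bBar b n₀ n * sigmaSeq b δ n₀ n / b m < ‖D m ω'‖}
              (fun ω' => ‖D m ω'‖ ^ 2) | ℱ (m - 1)]) ω)
        atTop (fun _ => 0))
    {g : ℕ → ℕ → Ω → EuclideanSpace ℝ (Fin d)} {g' : Ω → EuclideanSpace ℝ (Fin d)} {ρ : ℝ}
    (hg_meas : ∀ n i, 1 ≤ n → StronglyMeasurable[ℱ (n₀ n)] (g n i))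
    (hρ : ∀ᶠ n in atTop, ∀ i ∈ Finset.Ioc (n₀ n) n, ∀ ω, ‖g n i ω‖ ≤ ρ)
    (hg : ∀ᵐ ω ∂P, ω ∈ A → ∀ ε > 0, ∀ᶠ n in atTop, ∀ i ∈ Finset.Ioc (n₀ n) (L n),
      ‖g n i ω - g' ω‖ ≤ ε)
    {V : Ω → ℝ} (hV : Measurable V) {C : ℝ} (hC : 0 ≤ C)
    (hVC : ∀ᵐ ω ∂P, ω ∈ A → 0 ≤ V ω ∧ V ω ≤ C)
    (hVg : ∀ᵐ ω ∂P, ω ∈ A →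
      V ω = inner ℝ (g' ω) (Matrix.toEuclideanCLM (𝕜 := ℝ) (Γ ω) (g' ω))) :
    Tendsto (fun n => ∫ ω in A, Complex.exp ((∑ i ∈ Finset.Ioc (n₀ n) n,
      b i / √(∑ m ∈ Finset.Ioc (n₀ n) n, (b m * δ m) ^ 2) * inner ℝ (g n i ω) (D i ω) : ℝ)
        * Complex.I) ∂P) atTop
      (𝓝 (∫ ω in A, (Real.exp (-(V ω / 2)) : ℂ) ∂P)) := by
  set s : ℕ → ℝ := fun n => √(∑ m ∈ Finset.Ioc (n₀ n) n, (b m * δ m) ^ 2) with hs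
  have hpos : ∀ n i, i ∈ Finset.Ioc (n₀ n) n → 1 ≤ i := fun n i hi => by
    have := (Finset.mem_Ioc.1 hi).1; omega
  have hsum_pos : ∀ n, n₀ n < n → 0 < ∑ m ∈ Finset.Ioc (n₀ n) n, (b m * δ m) ^ 2 := fun n hn =>
    Finset.sum_pos (fun m hm => pow_pos (mul_pos (hb m (hpos n m hm)) (hδ m (hpos n m hm))) 2)
      (Finset.nonempty_Ioc.2 hn)
  have hs_pos : ∀ n, n₀ n < n → 0 < s n := fun n hn => Real.sqrt_pos.2 (hsum_pos n hn)
  have hs_sq : ∀ n, s n ^ 2 = ∑ m ∈ Finset.Ioc (n₀ n) n, (b m * δ m) ^ 2 := fun n =>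
    Real.sq_sqrt (Finset.sum_nonneg fun m _ => sq_nonneg _)
  -- Indices in the sum satisfy `n₀ n ≤ i - 1`, which makes the coefficients predictable.
  have hgm : ∀ n i, i ∈ Finset.Ioc (n₀ n) n → StronglyMeasurable[ℱ (i - 1)] (g n i) :=
    fun n i hi => (hg_meas n i (by have := Finset.mem_Ioc.1 hi; omega)).mono
      (ℱ.mono (by have := Finset.mem_Ioc.1 hi; omega))
  refine tendsto_setIntegral_exp_sum_mul_I (ℱ := ℱ) hn₀_top (hn₀_lt.mono fun _ h => h.le)
    (Y := fun n i ω => b i / s n * inner ℝ (g n i ω) (D i ω)) ?_ hA hV hC hVC ?_ ?_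
  · filter_upwards [hρ] with n hn
    refine ⟨fun i hi => ?_, fun i hi => ?_, fun i hi => ?_⟩
    · exact (((hgm n i hi).mono (ℱ.mono (Nat.sub_le i 1))).inner
        (hD_adapted i (hpos n i hi))).const_mul _
    · exact memLp_mul_inner (ℱ.le (i - 1)) (hD_sq i (hpos n i hi)) (hgm n i hi) (hn i hi) _
    · exact condExp_mul_inner_eq_zero (ℱ.le (i - 1)) (hD_sq i (hpos n i hi))
        (hD_mart i (hpos n i hi)) (hgm n i hi) (hn i hi) _
  -- The conditional variance is an average of quadratic forms with weights `(b_i δ_i)² / s_n²`,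
  -- which sum to 1. Collecting the null sets over all `n ≥ N` allows a pathwise limit.
  · have hcond : ∀ᶠ n in atTop, ∀ᵐ ω ∂P, ∑ i ∈ Finset.Ioc (n₀ n) n,
        condSq P ℱ (fun i ω => b i / s n * inner ℝ (g n i ω) (D i ω)) i ω
        = ∑ i ∈ Finset.Ioc (n₀ n) n, (b i / s n * δ i) ^ 2 *
          inner ℝ (g n i ω) (Matrix.toEuclideanCLM (𝕜 := ℝ)
            (condCovMatrix P (ℱ (i - 1)) (fun ω' => (δ i)⁻¹ • D i ω') ω) (g n i ω)) := by
      filter_upwards [hρ] with n hn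
      have h1 : ∀ᵐ ω ∂P, ∀ i ∈ Finset.Ioc (n₀ n) n,
          condSq P ℱ (fun i ω => b i / s n * inner ℝ (g n i ω) (D i ω)) i ω
          = (b i / s n * δ i) ^ 2 *
          inner ℝ (g n i ω) (Matrix.toEuclideanCLM (𝕜 := ℝ)
            (condCovMatrix P (ℱ (i - 1)) (fun ω' => (δ i)⁻¹ • D i ω') ω) (g n i ω)) :=
        (ae_ball_iff (Finset.Ioc (n₀ n) n).countable_toSet).2 fun i hi =>
          condExp_sq_mul_inner (ℱ.le (i - 1)) (hD_sq i (hpos n i hi))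
            (hD_mart i (hpos n i hi)) (hgm n i hi) (hn i hi) _ (hδ i (hpos n i hi)).ne'
      filter_upwards [h1] with ω h2
      exact Finset.sum_congr rfl h2
    obtain ⟨N, hN⟩ := eventually_atTop.1 hcond
    have hN' : ∀ᵐ ω ∂P, ∀ n ≥ N, ∑ i ∈ Finset.Ioc (n₀ n) n,
        condSq P ℱ (fun i ω => b i / s n * inner ℝ (g n i ω) (D i ω)) i ω
        = ∑ i ∈ Finset.Ioc (n₀ n) n, (b i / s n * δ i) ^ 2 *
          inner ℝ (g n i ω) (Matrix.toEuclideanCLM (𝕜 := ℝ)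
            (condCovMatrix P (ℱ (i - 1)) (fun ω' => (δ i)⁻¹ • D i ω') ω) (g n i ω)) :=
      ae_all_iff.2 fun n => by
        by_cases h : n ≥ N
        · filter_upwards [hN n h] with ω hω _ using hω
        · exact ae_of_all _ fun ω h' => absurd h' h
    refine tendstoInMeasure_of_tendsto_ae (fun n => ?_) ?_
    · exact (Finset.stronglyMeasurable_fun_sum _ fun i _ =>
        stronglyMeasurable_condExp.mono (ℱ.le _)).aestronglyMeasurable
    · rw [ae_restrict_iff' hA]
      filter_upwards [hN', hD_cov, hg, hVg] with ω h1 h2 h3 h4 hω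
      rw [h4 hω]
      have hw : ∀ n i, (b i / s n * δ i) ^ 2 = (b i * δ i) ^ 2 / s n ^ 2 := fun n i => by
        rw [div_mul_eq_mul_div, div_pow]
      refine (tendsto_weighted_quadraticForms (w := fun n i => (b i / s n * δ i) ^ 2) hn₀_top hL
        (fun _ _ => sq_nonneg _) ?_ ?_ (h2 hω) (g := fun n i => g n i ω) (ρ := ρ)
        ?_ (h3 hω)).congr' ?_
      · filter_upwards [hn₀_lt] with n hn
        simp_rw [hw]
        rw [← Finset.sum_div, hs_sq, div_self (hsum_pos n hn).ne']
      · simp_rw [hw, ← Finset.sum_div, hs_sq]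
        exact hwL
      · filter_upwards [hρ] with n hn i hi using hn i hi ω
      · filter_upwards [eventually_ge_atTop N] with n hn
        exact (h1 n hn).symm
  · intro ε hε
    -- A positive bound, needed to divide by it: since `b̄_n σ_n = s_n`, the level `ε / r` for
    -- `‖D_i‖` corresponds exactly to `ε` for the increment.
    set r := max ρ 1 with hr
    have hr0 : 0 < r := one_pos.trans_le (le_max_right _ _)
    refine tendstoInMeasure_zero_of_le_mul (c := r ^ 2) (by positivity) ?_
      (hD_lindeberg (ε / r) (by positivity))
    filter_upwards [hρ, hn₀_lt] with n hn hlt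
    have hbar : 0 < bBar b n₀ n := Finset.sum_pos (fun m hm => hb m (hpos n m hm))
      (Finset.nonempty_Ioc.2 hlt)
    have hsig : bBar b n₀ n * sigmaSeq b δ n₀ n = s n := by
      rw [sigmaSeq, one_div, mul_inv_cancel_left₀ hbar.ne']
    have hle : ∀ᵐ ω ∂P, ∀ i ∈ Finset.Ioc (n₀ n) n,
        condTailSq P ℱ (fun i ω => b i / s n * inner ℝ (g n i ω) (D i ω)) ε i ω ≤
          (b i / s n * r) ^ 2 *
          (P[Set.indicator {ω' | ε / r * bBar b n₀ n * sigmaSeq b δ n₀ n / b i < ‖D i ω'‖}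
              (fun ω' => ‖D i ω'‖ ^ 2) | ℱ (i - 1)]) ω := by
      refine (ae_ball_iff (Finset.Ioc (n₀ n) n).countable_toSet).2 fun i hi => ?_
      refine condExp_tailSq_mul_inner_le (ρ := r) (ℱ.le (i - 1)) (hD_sq i (hpos n i hi)) (hgm n i hi)
        (fun ω => (hn i hi ω).trans (le_max_left _ _)) ?_
      have hbi := hb i (hpos n i hi)
      have hsn := hs_pos n hlt
      rw [abs_of_pos (div_pos hbi hsn), mul_assoc (ε / r), hsig]
      refine le_of_eq ?_
      field_simp
    refine ae_restrict_of_ae ?_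
    filter_upwards [hle, condTailSq_nonneg P ℱ
      (fun i ω => b i / s n * inner ℝ (g n i ω) (D i ω)) ε] with ω h1 h2
    refine ⟨Finset.sum_nonneg fun i _ => h2 i, (Finset.sum_le_sum h1).trans (le_of_eq ?_)⟩
    rw [Finset.mul_sum, Finset.mul_sum]
    refine Finset.sum_congr rfl fun i _ => ?_
    have h3 : (b i / s n * r) ^ 2
        = r ^ 2 * ((sigmaSeq b δ n₀ n ^ 2)⁻¹ * (b i ^ 2 / bBar b n₀ n ^ 2)) := by
      have hsn := hs_pos n hlt
      rw [← hsig] at hsn ⊢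
      have hσ : sigmaSeq b δ n₀ n ≠ 0 := (pos_of_mul_pos_right hsn hbar.le).ne'
      field_simp
    rw [h3]
    ring

end WeightedSums

/-! ### From characteristic functions to stable convergence. -/

section StableConvergence

variable {Ω : Type*} [mΩ : MeasurableSpace Ω] {P : Measure Ω} [IsProbabilityMeasure P] {d : ℕ}

theorem integral_kernel_comp_measure {E F : Type*} [MeasurableSpace E] [NormedAddCommGroup F]
    [NormedSpace ℝ F] {ν : Measure Ω} [SFinite ν] {K : Kernel Ω E} [IsSFiniteKernel K] {f : E → F}
    (hf : Integrable f (K ∘ₘ ν)) : ∫ y, f y ∂(K ∘ₘ ν) = ∫ ω, ∫ y, f y ∂(K ω) ∂ν := by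
  rw [Measure.comp_eq_comp_const_apply] at hf ⊢
  rw [Kernel.integral_comp hf, Kernel.const_apply]

/-- Stable convergence follows from convergence of the characteristic functions on every event. -/
theorem stablyConvergesOn_of_charFun {A : Set Ω} {Y : ℕ → Ω → EuclideanSpace ℝ (Fin d)}
    (hY : ∀ n, AEMeasurable (Y n) P) {K : Kernel Ω (EuclideanSpace ℝ (Fin d))} [IsMarkovKernel K]
    (h : ∀ B : Set Ω, MeasurableSet B → ∀ u : EuclideanSpace ℝ (Fin d),
      Tendsto (fun n => ∫ ω in A ∩ B, Complex.exp ((inner ℝ (Y n ω) u : ℝ) * Complex.I) ∂P) atTop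
        (𝓝 (∫ ω in A ∩ B, charFun (K ω) u ∂P))) :
    StablyConvergesOn P A Y K := by
  intro B hB f
  by_cases h0 : P (A ∩ B) = 0
  · simp [Measure.restrict_eq_zero.2 h0]
  -- Conditioning on `A ∩ B` turns the claim into weak convergence of probability laws to the
  -- mixture `K ∘ₘ ν`, to which Lévy's continuity theorem applies.
  set ν : Measure Ω := P[|A ∩ B] with hν
  have hνp : IsProbabilityMeasure ν := cond_isProbabilityMeasure h0
  have hνP : ν ≪ P := cond_absolutelyContinuous
  have hc : P.real (A ∩ B) ≠ 0 := (measureReal_ne_zero_iff).2 h0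
  have hint : ∀ {F : Type} [NormedAddCommGroup F] [NormedSpace ℝ F] (φ : Ω → F),
      ∫ ω, φ ω ∂ν = (P.real (A ∩ B))⁻¹ • ∫ ω in A ∩ B, φ ω ∂P := fun φ => by
    rw [hν, ProbabilityTheory.cond, integral_smul_measure, ENNReal.toReal_inv]
    rfl
  have hYν : ∀ n, AEMeasurable (Y n) ν := fun n => (hY n).mono_ac hνP
  let μ : ℕ → ProbabilityMeasure (EuclideanSpace ℝ (Fin d)) := fun n =>
    ⟨ν.map (Y n), Measure.isProbabilityMeasure_map (hYν n)⟩
  let μ₀ : ProbabilityMeasure (EuclideanSpace ℝ (Fin d)) := ⟨K ∘ₘ ν, inferInstance⟩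
  have hlim : Tendsto μ atTop (𝓝 μ₀) := by
    refine ProbabilityMeasure.tendsto_iff_tendsto_charFun.2 fun u => ?_
    have h1 : ∀ n, charFun (μ n : Measure (EuclideanSpace ℝ (Fin d))) u = (P.real (A ∩ B))⁻¹ •
        ∫ ω in A ∩ B, Complex.exp ((inner ℝ (Y n ω) u : ℝ) * Complex.I) ∂P := fun n => by
      rw [← hint, charFun_apply]
      exact integral_map (hYν n) (by fun_prop)
    have h2 : charFun (μ₀ : Measure (EuclideanSpace ℝ (Fin d))) u = (P.real (A ∩ B))⁻¹ •
        ∫ ω in A ∩ B, charFun (K ω) u ∂P := by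
      rw [← hint, charFun_apply]
      refine integral_kernel_comp_measure ?_
      refine (integrable_const (1 : ℝ)).mono' (by fun_prop) (ae_of_all _ fun y => ?_)
      rw [Complex.norm_exp_ofReal_mul_I]
    simp_rw [h1, h2]
    exact (h B hB u).const_smul _
  have hf := (ProbabilityMeasure.tendsto_iff_forall_integral_tendsto.1 hlim) f
  have h1 : ∀ n, ∫ ω in A ∩ B, f (Y n ω) ∂P = P.real (A ∩ B) • ∫ y, f y ∂(μ n : Measure _) :=
    fun n => by
      have h2 : ∫ y, f y ∂(μ n : Measure (EuclideanSpace ℝ (Fin d))) = ∫ ω, f (Y n ω) ∂ν :=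
        integral_map (hYν n) f.continuous.aestronglyMeasurable
      rw [h2, hint, smul_inv_smul₀ hc]
  have h2 : ∫ ω in A ∩ B, ∫ y, f y ∂(K ω) ∂P = P.real (A ∩ B) • ∫ y, f y ∂(μ₀ : Measure _) := by
    have h3 : ∫ y, f y ∂(μ₀ : Measure (EuclideanSpace ℝ (Fin d))) = ∫ ω, ∫ y, f y ∂(K ω) ∂ν :=
      integral_kernel_comp_measure (f.integrable _)
    rw [h3, hint, smul_inv_smul₀ hc]
  simp_rw [h1, h2]
  exact hf.const_smul _

/-- The integrands are bounded by 1, so passing from `T` to `S k` costs at most `P (T \ S k)`,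
uniformly in `n`. -/
theorem tendsto_setIntegral_of_exhaustion {f : ℕ → Ω → ℂ} {g : Ω → ℂ}
    (hf : ∀ n, AEStronglyMeasurable (f n) P) (hf1 : ∀ n ω, ‖f n ω‖ ≤ 1)
    (hg : AEStronglyMeasurable g P) (hg1 : ∀ ω, ‖g ω‖ ≤ 1) {S : ℕ → Set Ω} {T : Set Ω}
    (hS : ∀ k, MeasurableSet (S k)) (hT : MeasurableSet T) (hST : ∀ k, S k ⊆ T) (hmono : Monotone S)
    (hcov : ∀ᵐ ω ∂P, ω ∈ T → ∃ k, ω ∈ S k)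
    (h : ∀ k, Tendsto (fun n => ∫ ω in S k, f n ω ∂P) atTop (𝓝 (∫ ω in S k, g ω ∂P))) :
    Tendsto (fun n => ∫ ω in T, f n ω ∂P) atTop (𝓝 (∫ ω in T, g ω ∂P)) := by
  have hsmall : Tendsto (fun k => P.real (T \ S k)) atTop (𝓝 0) := by
    have h1 : Tendsto (fun k => P (T \ S k)) atTop (𝓝 (P (⋂ k, T \ S k))) :=
      tendsto_measure_iInter_atTop (fun k => (hT.diff (hS k)).nullMeasurableSet)
        (fun k l hkl => Set.sdiff_subset_sdiff_right (hmono hkl)) ⟨0, measure_ne_top _ _⟩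
    have h2 : P (⋂ k, T \ S k) = 0 := by
      rw [measure_eq_zero_iff_ae_notMem]
      filter_upwards [hcov] with ω h3 h4
      rw [Set.mem_iInter] at h4
      obtain ⟨k, hk⟩ := h3 (h4 0).1
      exact (h4 k).2 hk
    rw [h2] at h1
    exact (ENNReal.tendsto_toReal ENNReal.zero_ne_top).comp h1
  have hdiff : ∀ φ : Ω → ℂ, AEStronglyMeasurable φ P → (∀ ω, ‖φ ω‖ ≤ 1) → ∀ k,
      ‖∫ ω in T, φ ω ∂P - ∫ ω in S k, φ ω ∂P‖ ≤ P.real (T \ S k) := fun φ hφ hφ1 k => by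
    have hi : Integrable φ P := (integrable_const (1 : ℝ)).mono' hφ (ae_of_all _ hφ1)
    rw [← setIntegral_sdiff (hS k) hi.integrableOn (hST k)]
    simpa using norm_setIntegral_le_of_norm_le_const (measure_lt_top P (T \ S k))
      fun ω _ => hφ1 ω
  rw [Metric.tendsto_atTop']
  intro ε hε
  obtain ⟨k, hk⟩ := (hsmall.eventually_lt_const (by positivity : 0 < ε / 3)).exists
  obtain ⟨N, hN⟩ := Metric.tendsto_atTop'.1 (h k) (ε / 3) (by positivity)
  refine ⟨N, fun n hn => ?_⟩
  have h1 := hdiff (f n) (hf n) (hf1 n) k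
  have h2 := hdiff g hg hg1 k
  have h3 := hN n hn
  rw [← dist_eq_norm] at h1 h2
  rw [dist_comm] at h2
  have := dist_triangle4 (∫ ω in T, f n ω ∂P) (∫ ω in S k, f n ω ∂P) (∫ ω in S k, g ω ∂P)
    (∫ ω in T, g ω ∂P)
  linarith

theorem inner_toEuclideanCLM_left (M : Matrix (Fin d) (Fin d) ℝ) (x y : EuclideanSpace ℝ (Fin d)) :
    inner ℝ (Matrix.toEuclideanCLM (𝕜 := ℝ) M x) y
      = inner ℝ x (Matrix.toEuclideanCLM (𝕜 := ℝ) M.transpose y) := by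
  rw [real_inner_comm, Matrix.inner_toEuclideanCLM, Matrix.inner_toEuclideanCLM,
    Matrix.dotProduct_mulVec, Matrix.mulVec_transpose, dotProduct_comm]

theorem inner_conj_toEuclideanCLM (M G : Matrix (Fin d) (Fin d) ℝ)
    (u : EuclideanSpace ℝ (Fin d)) :
    inner ℝ u (Matrix.toEuclideanCLM (𝕜 := ℝ) (M * G * M.transpose) u)
      = inner ℝ (Matrix.toEuclideanCLM (𝕜 := ℝ) M.transpose u)
        (Matrix.toEuclideanCLM (𝕜 := ℝ) G (Matrix.toEuclideanCLM (𝕜 := ℝ) M.transpose u)) := by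
  rw [inner_toEuclideanCLM_left, Matrix.transpose_transpose, map_mul, map_mul]
  rfl

theorem charFun_map_multivariateGaussian {M G : Matrix (Fin d) (Fin d) ℝ} (hG : G.PosSemidef)
    (u : EuclideanSpace ℝ (Fin d)) :
    charFun ((multivariateGaussian 0 G).map (Matrix.toEuclideanCLM (𝕜 := ℝ) M)) u =
      (Real.exp (-(inner ℝ u (Matrix.toEuclideanCLM (𝕜 := ℝ) (M * G * M.transpose) u) / 2)) : ℂ) := by
  have h1 : charFun ((multivariateGaussian 0 G).map (Matrix.toEuclideanCLM (𝕜 := ℝ) M)) u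
      = charFun (multivariateGaussian 0 G) (Matrix.toEuclideanCLM (𝕜 := ℝ) M.transpose u) := by
    rw [charFun_apply, charFun_apply, integral_map (by fun_prop) (by fun_prop)]
    simp_rw [inner_toEuclideanCLM_left]
  rw [h1, charFun_multivariateGaussian hG, inner_conj_toEuclideanCLM, inner_zero_right,
    Matrix.inner_toEuclideanCLM]
  push_cast
  congr 1
  ring

/-- Needed so that the Gaussian with parameter `Γ` really has covariance `Γ`. Conditional
covariances have nonnegative quadratic forms almost surely for each fixed vector; a countable dense
set of vectors gives a common null set, and the inequality passes to the limit and then, by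
continuity, to all vectors. -/
theorem posSemidef_of_tendsto_condCovMatrix {ℱ : Filtration ℕ mΩ} {δ : ℕ → ℝ}
    (hδ : ∀ n, 1 ≤ n → 0 < δ n) {D : ℕ → Ω → EuclideanSpace ℝ (Fin d)}
    (hD_sq : ∀ k, 1 ≤ k → MemLp (D k) 2 P)
    (hD_mart : ∀ k, 1 ≤ k → P[D k | ℱ (k - 1)] =ᵐ[P] 0)
    {Γ : Ω → Matrix (Fin d) (Fin d) ℝ} {A : Set Ω}
    (hD_cov : ∀ᵐ ω ∂P, ω ∈ A →
      Tendsto (fun m => condCovMatrix P (ℱ (m - 1)) (fun ω' => (δ m)⁻¹ • D m ω') ω) atTop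
        (𝓝 (Γ ω))) : ∀ᵐ ω ∂P, ω ∈ A → (Γ ω).PosSemidef := by
  set C : ℕ → Ω → Matrix (Fin d) (Fin d) ℝ := fun m ω =>
    condCovMatrix P (ℱ (m - 1)) (fun ω' => (δ m)⁻¹ • D m ω') ω with hC
  have hsymm : ∀ᵐ ω ∂P, ∀ m, 1 ≤ m → ∀ l l', C m ω l l' = C m ω l' l := by
    refine ae_all_iff.2 fun m => ?_
    by_cases hm : 1 ≤ m
    · filter_upwards [condCovMatrix_inv_smul (hD_sq m hm) (hD_mart m hm) (δ m)] with ω h _ l l'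
      rw [hC]
      simp only [h, mul_comm (D m _ l)]
    · exact ae_of_all _ fun ω h => absurd h hm
  have hquad : ∀ᵐ ω ∂P, ∀ m, 1 ≤ m → ∀ k, 0 ≤ inner ℝ (TopologicalSpace.denseSeq _ k)
      (Matrix.toEuclideanCLM (𝕜 := ℝ) (C m ω)
        (TopologicalSpace.denseSeq (EuclideanSpace ℝ (Fin d)) k)) := by
    refine ae_all_iff.2 fun m => ?_
    by_cases hm : 1 ≤ m
    · have h1 : ∀ᵐ ω ∂P, ∀ k, 0 ≤ inner ℝ (TopologicalSpace.denseSeq _ k)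
          (Matrix.toEuclideanCLM (𝕜 := ℝ) (C m ω)
            (TopologicalSpace.denseSeq (EuclideanSpace ℝ (Fin d)) k)) := by
        refine ae_all_iff.2 fun k => ?_
        set x := TopologicalSpace.denseSeq (EuclideanSpace ℝ (Fin d)) k
        have h2 := condExp_sq_mul_inner (ℱ.le (m - 1)) (hD_sq m hm) (hD_mart m hm)
          (g := fun _ => x) stronglyMeasurable_const (fun _ => le_rfl) 1 (hδ m hm).ne'
        have h3 : 0 ≤ᵐ[P] P[fun ω => (1 * inner ℝ x (D m ω)) ^ 2 | ℱ (m - 1)] :=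
          condExp_nonneg (ae_of_all _ fun ω => sq_nonneg _)
        filter_upwards [h2, h3] with ω h4 h5
        rw [h4] at h5
        exact nonneg_of_mul_nonneg_right h5 (pow_pos (mul_pos one_pos (hδ m hm)) 2)
      filter_upwards [h1] with ω h _ using h
    · exact ae_of_all _ fun ω h => absurd h hm
  filter_upwards [hsymm, hquad, hD_cov] with ω h1 h2 h3 hω
  have hlim := h3 hω
  refine Matrix.PosSemidef.of_dotProduct_mulVec_nonneg ?_ fun x => ?_
  · ext l l'
    rw [Matrix.conjTranspose_apply, star_trivial]
    have hl : ∀ l l', Tendsto (fun m => C m ω l l') atTop (𝓝 (Γ ω l l')) := fun l l' =>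
      tendsto_pi_nhds.1 (tendsto_pi_nhds.1 hlim l) l'
    refine tendsto_nhds_unique (hl l' l) ((hl l l').congr' ?_)
    filter_upwards [eventually_ge_atTop 1] with m hm using h1 m hm l l'
  · rw [star_trivial]
    have hcl : ∀ y : EuclideanSpace ℝ (Fin d),
        0 ≤ inner ℝ y (Matrix.toEuclideanCLM (𝕜 := ℝ) (Γ ω) y) := by
      have hclosed : IsClosed {y : EuclideanSpace ℝ (Fin d) |
          0 ≤ inner ℝ y (Matrix.toEuclideanCLM (𝕜 := ℝ) (Γ ω) y)} :=
        isClosed_le continuous_const (by fun_prop)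
      intro y
      refine hclosed.closure_subset_iff.2 ?_
        ((TopologicalSpace.denseRange_denseSeq (EuclideanSpace ℝ (Fin d))).closure_eq ▸ Set.mem_univ y)
      rintro _ ⟨k, rfl⟩
      have hk := ((continuous_inner_toEuclideanCLM (d := d)).comp
        (Continuous.prodMk_right (TopologicalSpace.denseSeq (EuclideanSpace ℝ (Fin d)) k))).tendsto
        (Γ ω)
      refine ge_of_tendsto (hk.comp hlim) ?_
      filter_upwards [eventually_ge_atTop 1] with m hm using h2 m hm k
    have := hcl (WithLp.toLp 2 x)
    rwa [Matrix.inner_toEuclideanCLM] at this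

end StableConvergence

/-! ### Convergence of the coefficients to `-H⁻¹`, and truncation of `H_n`. -/

section Coefficients

open scoped Matrix.Norms.L2Operator

variable {d : ℕ}

/-- The telescoping bound involves `N = H_n`, whereas the limit involves the inverse of `M = H`; the
identity `S + M⁻¹ = (S N + 1 - S (N - M)) M⁻¹` bridges the two without inverting `N`. -/
theorem norm_add_inv_le {S N M : Matrix (Fin d) (Fin d) ℝ} (hM : IsUnit M) {R ε : ℝ}
    (hS : ‖S‖ ≤ R) (h : ‖S * N + 1‖ ≤ ε) :
    ‖S + M⁻¹‖ ≤ (ε + R * ‖N - M‖) * ‖M⁻¹‖ := by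
  have hdet : IsUnit M.det := (Matrix.isUnit_iff_isUnit_det M).1 hM
  have h1 : S + M⁻¹ = (S * N + 1 - S * (N - M)) * M⁻¹ := by
    have h2 : S * N + 1 - S * (N - M) = S * M + 1 := by rw [mul_sub]; abel
    rw [h2, add_mul, one_mul, mul_assoc, Matrix.mul_nonsing_inv M hdet, mul_one]
  rw [h1]
  refine (norm_mul_le _ _).trans ?_
  gcongr
  refine (norm_sub_le _ _).trans (add_le_add h ((norm_mul_le _ _).trans ?_))
  gcongr

theorem eventually_norm_matProdBar_add_inv_le {γ b : ℕ → ℝ} {n₀ L : ℕ → ℕ}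
    (hγ_anti : AntitoneOn γ (Set.Ici 1)) (hγ_zero : Tendsto γ atTop (𝓝 0))
    (hn₀_top : Tendsto n₀ atTop atTop) (hb : ∀ n, 1 ≤ n → 0 < b n)
    (hnγ : Tendsto (fun n : ℕ => (n : ℝ) * γ n) atTop atTop)
    (hbγ : (fun n => b (n + 1) * γ n / (b n * γ (n + 1)) - 1) =o[atTop] γ)
    (hLn : ∀ᶠ n in atTop, L n ≤ n)
    (hLγ : ∀ T : ℝ, ∀ᶠ n in atTop, ∀ i ∈ Finset.Ioc (n₀ n) (L n), T ≤ ∑ k ∈ Finset.Ioc i n, γ k)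
    {l Λ : ℝ} (hl : 0 < l) {Mn : ℕ → Matrix (Fin d) (Fin d) ℝ} {M : Matrix (Fin d) (Fin d) ℝ}
    (hMn : ∀ᶠ n in atTop, Mn n ∈ dissipativeMatrices d l Λ) (hM : IsUnit M)
    (hlim : Tendsto Mn atTop (𝓝 M)) {ε : ℝ} (hε : 0 < ε) :
    ∀ᶠ n in atTop, ∀ i ∈ Finset.Ioc (n₀ n) (L n), ‖matProdBar γ b (Mn n) i n + M⁻¹‖ ≤ ε := by
  obtain ⟨R, hR⟩ := exists_norm_matProdBar_le hγ_anti hγ_zero hb hnγ hbγ hl (d := d) Λ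
  set c := ‖M⁻¹‖ with hc
  obtain ⟨T, hT⟩ := exists_norm_matProdBar_mul_add_one_le hγ_anti hγ_zero hb hnγ hbγ hl (d := d) Λ
    (ε := ε / 2 / (c + 1)) (by positivity)
  have hdist : Tendsto (fun n => R * ‖Mn n - M‖ * c) atTop (𝓝 0) := by
    simpa using ((tendsto_iff_norm_sub_tendsto_zero.1 hlim).const_mul R).mul_const c
  filter_upwards [hn₀_top.eventually (eventually_forall_ge_atTop.2 hR),
    hn₀_top.eventually (eventually_forall_ge_atTop.2 hT), hLn, hLγ T, hMn,
    hdist.eventually_le_const (half_pos hε)] with n h1 h2 h3 h4 h5 h6 i hi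
  have hi' := Finset.mem_Ioc.1 hi
  have hin : i ≤ n := hi'.2.trans h3
  refine (norm_add_inv_le hM (h1 i hi'.1.le n hin _ h5)
    (h2 i hi'.1.le n hin (h4 i hi) _ h5)).trans ?_
  have h7 : ε / 2 / (c + 1) * c ≤ ε / 2 := by
    have hc0 : 0 ≤ c := norm_nonneg _
    rw [div_mul_eq_mul_div, div_le_iff₀ (by positivity)]
    nlinarith
  rw [add_mul]
  linarith

theorem norm_transpose_eq (M : Matrix (Fin d) (Fin d) ℝ) : ‖M.transpose‖ = ‖M‖ := by
  rw [← Matrix.conjTranspose_eq_transpose_of_trivial, Matrix.l2_opNorm_conjTranspose]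

theorem norm_toEuclideanCLM_transpose_le (M : Matrix (Fin d) (Fin d) ℝ)
    (u : EuclideanSpace ℝ (Fin d)) :
    ‖Matrix.toEuclideanCLM (𝕜 := ℝ) M.transpose u‖ ≤ ‖M‖ * ‖u‖ := by
  rw [← norm_transpose_eq M]
  exact ContinuousLinearMap.le_opNorm _ u

/-- `M` if it is dissipative, and `-1` otherwise. -/
noncomputable def dissipativeOrNegOne (l Λ : ℝ) (M : Matrix (Fin d) (Fin d) ℝ) :
    Matrix (Fin d) (Fin d) ℝ :=
  open scoped Classical in if M ∈ dissipativeMatrices d l Λ then M else -1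

theorem dissipativeOrNegOne_mem {l Λ : ℝ} (hl : l ≤ 1) (hΛ : 1 ≤ Λ)
    (M : Matrix (Fin d) (Fin d) ℝ) : dissipativeOrNegOne l Λ M ∈ dissipativeMatrices d l Λ := by
  rw [dissipativeOrNegOne]
  split_ifs with h
  · exact h
  · exact neg_one_mem_dissipativeMatrices hl hΛ

theorem dissipativeOrNegOne_of_mem {l Λ : ℝ} {M : Matrix (Fin d) (Fin d) ℝ}
    (h : M ∈ dissipativeMatrices d l Λ) : dissipativeOrNegOne l Λ M = M := if_pos h

theorem measurable_dissipativeOrNegOne {Ω : Type*} {m : MeasurableSpace Ω} {l Λ : ℝ}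
    {S : Ω → Matrix (Fin d) (Fin d) ℝ} (hS : ∀ i j, Measurable fun ω => S ω i j) (i j : Fin d) :
    Measurable fun ω => dissipativeOrNegOne l Λ (S ω) i j := by
  classical
  have h : (fun ω => dissipativeOrNegOne l Λ (S ω) i j)
      = fun ω => if ω ∈ S ⁻¹' dissipativeMatrices d l Λ then S ω i j else
        (-1 : Matrix (Fin d) (Fin d) ℝ) i j := by
    funext ω
    rw [dissipativeOrNegOne]
    by_cases hω : S ω ∈ dissipativeMatrices d l Λ <;> simp [hω]
  rw [h]
  exact Measurable.ite (measurableSet_preimage_of_entries hS (isClosed_dissipativeMatrices l Λ))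
    (hS i j) measurable_const

end Coefficients

/-! ### Measurability and linear functionals of `σ_n⁻¹ Ξ_n`. -/

section Xi

variable {Ω : Type*} {d : ℕ} {γ b δ : ℕ → ℝ} {n₀ : ℕ → ℕ}
  {H : ℕ → Ω → Matrix (Fin d) (Fin d) ℝ} {D : ℕ → Ω → EuclideanSpace ℝ (Fin d)}

theorem measurable_toEuclideanCLM_apply [MeasurableSpace Ω] {M : Ω → Matrix (Fin d) (Fin d) ℝ}
    (hM : ∀ i j, Measurable fun ω => M ω i j) {X : Ω → EuclideanSpace ℝ (Fin d)}
    (hX : Measurable X) : Measurable fun ω => Matrix.toEuclideanCLM (𝕜 := ℝ) (M ω) (X ω) := by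
  have h : Measurable fun ω => (M ω).mulVec (WithLp.ofLp (X ω)) := by
    refine measurable_pi_iff.2 fun i => ?_
    simp only [Matrix.mulVec, dotProduct]
    refine Finset.measurable_fun_sum _ fun j _ => (hM i j).mul ?_
    have hj : Measurable fun x : EuclideanSpace ℝ (Fin d) => x j :=
      Continuous.measurable (by fun_prop)
    exact hj.comp hX
  exact (WithLp.measurable_toLp 2 (Fin d → ℝ)).comp h

theorem measurable_scaled_xiSeq [MeasurableSpace Ω]
    (hH : ∀ n, 1 ≤ n → ∀ i j, Measurable fun ω => H n ω i j)
    (hD : ∀ k, 1 ≤ k → Measurable (D k)) (n : ℕ) :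
    Measurable fun ω => (sigmaSeq b δ n₀ n)⁻¹ • xiSeq γ b n₀ H D n ω := by
  have h : Measurable fun ω => ∑ i ∈ Finset.Ioc (n₀ n) n,
      b i • Matrix.toEuclideanCLM (𝕜 := ℝ) (matProdBar γ b (H n ω) i n) (D i ω) := by
    refine Finset.measurable_fun_sum _ fun i hi => ?_
    have hi' := Finset.mem_Ioc.1 hi
    refine (measurable_toEuclideanCLM_apply (fun l l' => ?_) (hD i (by omega))).const_smul (b i)
    exact measurable_comp_of_entries (hH n (by omega))
      ((continuous_matProdBar γ b i n).matrix_elem l l')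
  exact (h.const_smul (1 / bBar b n₀ n)).const_smul (sigmaSeq b δ n₀ n)⁻¹

theorem inner_scaled_xiSeq (hb : ∀ n, 1 ≤ n → 0 < b n) {n : ℕ} (hn : n₀ n < n) (ω : Ω)
    (u : EuclideanSpace ℝ (Fin d)) :
    inner ℝ ((sigmaSeq b δ n₀ n)⁻¹ • xiSeq γ b n₀ H D n ω) u =
      ∑ i ∈ Finset.Ioc (n₀ n) n, b i / √(∑ m ∈ Finset.Ioc (n₀ n) n, (b m * δ m) ^ 2) *
        inner ℝ (Matrix.toEuclideanCLM (𝕜 := ℝ) (matProdBar γ b (H n ω) i n).transpose u)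
          (D i ω) := by
  have hbar : 0 < bBar b n₀ n := Finset.sum_pos
    (fun m hm => hb m (by have := Finset.mem_Ioc.1 hm; omega)) (Finset.nonempty_Ioc.2 hn)
  have hσ : (sigmaSeq b δ n₀ n)⁻¹ * (1 / bBar b n₀ n)
      = (√(∑ m ∈ Finset.Ioc (n₀ n) n, (b m * δ m) ^ 2))⁻¹ := by
    rw [sigmaSeq, mul_inv, one_div, inv_inv, mul_right_comm, mul_inv_cancel₀ hbar.ne', one_mul]
  rw [xiSeq, smul_smul, hσ, real_inner_smul_left, sum_inner, Finset.mul_sum]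
  refine Finset.sum_congr rfl fun i _ => ?_
  rw [real_inner_smul_left, inner_toEuclideanCLM_left, real_inner_comm]
  ring

end Xi

/-! ### The main theorem: localisation and assembly. -/

theorem mainTheorem3
    {Ω : Type*} [mΩ : MeasurableSpace Ω] (P : Measure Ω) [IsProbabilityMeasure P]
    (ℱ : Filtration ℕ mΩ) (d : ℕ)
    -- step-sizes, burn-in, weights and scaling; all sequences are indexed by `n ≥ 1`
    (γ b δ : ℕ → ℝ) (n₀ : ℕ → ℕ)
    (hγ_nonneg : ∀ n, 1 ≤ n → 0 ≤ γ n)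
    (hγ_anti : AntitoneOn γ (Set.Ici 1))
    (hγ_zero : Tendsto γ atTop (𝓝 0))
    (hn₀_mono : MonotoneOn n₀ (Set.Ici 1))
    (hn₀_le : ∀ n, 1 ≤ n → n₀ n ≤ n)
    (hn₀_lt : ∀ᶠ n in atTop, n₀ n < n)
    (hn₀_top : Tendsto n₀ atTop atTop)
    (hb : ∀ n, 1 ≤ n → 0 < b n)
    (hδ : ∀ n, 1 ≤ n → 0 < δ n)
    -- the event `A ∈ 𝓕_∞`
    (A : Set Ω) (hA : MeasurableSet[⨆ n, ℱ n] A)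
    -- technical assumptions on the parameters
    (hnγ : Tendsto (fun n : ℕ => (n : ℝ) * γ n) atTop atTop)
    (hbγ : (fun n => b (n + 1) * γ n / (b n * γ (n + 1)) - 1) =o[atTop] γ)
    (hL : ∀ L : ℕ → ℕ, (∀ n, 1 ≤ n → n₀ n ≤ L n ∧ L n ≤ n) →
      ((fun n : ℕ => (n : ℝ) - (L n : ℝ)) =o[atTop] fun n : ℕ => (n : ℝ)) →
      Tendsto (fun n => (∑ k ∈ Finset.Ioc (L n) n, (b k * δ k) ^ 2) /
        ∑ k ∈ Finset.Ioc (n₀ n) n, (b k * δ k) ^ 2) atTop (𝓝 0))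
    -- assumptions on `H_n`
    (H : ℕ → Ω → Matrix (Fin d) (Fin d) ℝ)
    (hH_meas : ∀ n, 1 ≤ n → ∀ i j, Measurable[ℱ (n₀ n)] fun ω => H n ω i j)
    (hH_symm : ∀ n, 1 ≤ n → ∀ ω, (H n ω).IsSymm)
    (Hlim : Ω → Matrix (Fin d) (Fin d) ℝ)
    (hHlim_meas : ∀ i j, Measurable fun ω => Hlim ω i j)
    (hHlim : ∀ᵐ ω ∂P, ω ∈ A → (Hlim ω).IsSymm ∧ (∀ μ ∈ spectrum ℝ (Hlim ω), μ < 0) ∧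
      Tendsto (fun n => H n ω) atTop (𝓝 (Hlim ω)))
    -- assumptions on `𝒟_k`: square integrable martingale differences
    (D : ℕ → Ω → EuclideanSpace ℝ (Fin d))
    (hD_adapted : ∀ k, 1 ≤ k → StronglyMeasurable[ℱ k] (D k))
    (hD_sq : ∀ k, 1 ≤ k → MemLp (D k) 2 P)
    (hD_mart : ∀ k, 1 ≤ k → P[D k | ℱ (k - 1)] =ᵐ[P] 0)
    (Γ : Ω → Matrix (Fin d) (Fin d) ℝ)
    (hΓ_meas : ∀ i j, Measurable fun ω => Γ ω i j)
    -- (a) convergence of the normalised conditional covariances, almost surely on `A`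
    (hD_cov : ∀ᵐ ω ∂P, ω ∈ A →
      Tendsto (fun m => condCovMatrix P (ℱ (m - 1)) (fun ω' => (δ m)⁻¹ • D m ω') ω) atTop
        (𝓝 (Γ ω)))
    -- (b) conditional Lindeberg condition, in probability on `A`
    (hD_lindeberg : ∀ ε : ℝ, 0 < ε →
      TendstoInMeasure (P.restrict A)
        (fun n ω => (sigmaSeq b δ n₀ n ^ 2)⁻¹ * ∑ m ∈ Finset.Ioc (n₀ n) n,
          b m ^ 2 / bBar b n₀ n ^ 2 *
            (P[Set.indicator {ω' | ε * bBar b n₀ n * sigmaSeq b δ n₀ n / b m < ‖D m ω'‖}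
              (fun ω' => ‖D m ω'‖ ^ 2) | ℱ (m - 1)]) ω)
        atTop (fun _ => 0)) :
    StablyConvergesOn P A (fun n ω => (sigmaSeq b δ n₀ n)⁻¹ • xiSeq γ b n₀ H D n ω)
      (gaussianImageKernel (fun ω => (Hlim ω)⁻¹) Γ (measurable_inv_matrix Hlim hHlim_meas)
        hΓ_meas) := by
  have hA' : MeasurableSet A := iSup_le (fun n => ℱ.le n) A hA
  obtain ⟨L, hL1, hL2, hL3⟩ := exists_cutoff hγ_anti hn₀_le hnγ
  have hwL := hL L hL1 hL2
  have hLev : ∀ᶠ n in atTop, n₀ n ≤ L n ∧ L n ≤ n := by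
    filter_upwards [eventually_ge_atTop 1] with n hn using hL1 n hn
  have hH0 : ∀ n, 1 ≤ n → ∀ i j, Measurable fun ω => H n ω i j := fun n hn i j =>
    (hH_meas n hn i j).mono (ℱ.le _) le_rfl
  have hD0 : ∀ k, 1 ≤ k → Measurable (D k) := fun k hk =>
    ((hD_adapted k hk).mono (ℱ.le k)).measurable
  have hYm := measurable_scaled_xiSeq (γ := γ) (b := b) (δ := δ) (n₀ := n₀) hH0 hD0
  have hpsd := posSemidef_of_tendsto_condCovMatrix hδ hD_sq hD_mart hD_cov
  refine stablyConvergesOn_of_charFun (fun n => (hYm n).aemeasurable) fun B hB u => ?_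
  set V : Ω → ℝ := fun ω => inner ℝ u (Matrix.toEuclideanCLM (𝕜 := ℝ)
    ((Hlim ω)⁻¹ * Γ ω * ((Hlim ω)⁻¹).transpose) u) with hVdef
  have hVm : Measurable V := by
    have hprod : ∀ i j, Measurable fun ω =>
        ((Hlim ω)⁻¹ * Γ ω * ((Hlim ω)⁻¹).transpose) i j := fun i j => by
      simp only [Matrix.mul_apply, Matrix.transpose_apply]
      exact Finset.measurable_fun_sum _ fun k _ => (Finset.measurable_fun_sum _ fun k' _ =>
        (measurable_inv_matrix Hlim hHlim_meas i k').mul (hΓ_meas k' k)).mul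
          (measurable_inv_matrix Hlim hHlim_meas j k)
    exact measurable_comp_of_entries hprod
      (continuous_const.inner (continuous_toEuclideanCLM_apply u))
  -- The limit of the coefficients carries a minus sign, which disappears in the quadratic form `V`.
  set g' : Ω → EuclideanSpace ℝ (Fin d) := fun ω =>
    -Matrix.toEuclideanCLM (𝕜 := ℝ) ((Hlim ω)⁻¹).transpose u with hg'
  have hVg : ∀ ω, V ω = inner ℝ (g' ω) (Matrix.toEuclideanCLM (𝕜 := ℝ) (Γ ω) (g' ω)) := fun ω => by
    rw [hVdef, hg', map_neg, inner_neg_neg, ← inner_conj_toEuclideanCLM]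
  have hV0 : ∀ᵐ ω ∂P, ω ∈ A → 0 ≤ V ω := by
    filter_upwards [hpsd] with ω h hω
    rw [hVg, Matrix.inner_toEuclideanCLM]
    exact (h hω).dotProduct_mulVec_nonneg _
  have hchar : ∀ᵐ ω ∂P, ω ∈ A → charFun (gaussianImageKernel (fun ω => (Hlim ω)⁻¹) Γ
      (measurable_inv_matrix Hlim hHlim_meas) hΓ_meas ω) u = (Real.exp (-(V ω / 2)) : ℂ) := by
    filter_upwards [hpsd] with ω h hω
    exact charFun_map_multivariateGaussian (h hω) u
  have hcharm : Measurable fun ω => charFun (gaussianImageKernel (fun ω => (Hlim ω)⁻¹) Γ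
      (measurable_inv_matrix Hlim hHlim_meas) hΓ_meas ω) u := by
    simp only [charFun_apply]
    exact (StronglyMeasurable.integral_kernel (f := fun y : EuclideanSpace ℝ (Fin d) =>
      Complex.exp ((inner ℝ y u : ℝ) * Complex.I))
      (Measurable.stronglyMeasurable (by fun_prop))).measurable
  -- On `S k` the matrices `H_n` are uniformly dissipative from time `k + 1` on and the limit
  -- variance is at most `k`. These events increase to `A ∩ B` up to a null set; starting at `k + 1`
  -- keeps `n ≥ 1`.
  set S : ℕ → Set Ω := fun k => (A ∩ B) ∩
    ((⋂ n ≥ k + 1, H n ⁻¹' dissipativeMatrices d (1 / ((k : ℝ) + 1)) (k + 1)) ∩ {ω | V ω ≤ k})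
    with hS
  have hSm : ∀ k, MeasurableSet (S k) := fun k => (hA'.inter hB).inter
    ((MeasurableSet.iInter fun n => MeasurableSet.iInter fun hn =>
      measurableSet_preimage_of_entries (hH0 n (by omega)) (isClosed_dissipativeMatrices _ _)).inter
      (measurableSet_le hVm measurable_const))
  refine tendsto_setIntegral_of_exhaustion (S := S) (fun n => ?_) (fun n ω => ?_)
    hcharm.aestronglyMeasurable (fun ω => norm_charFun_le_one u) hSm (hA'.inter hB)
    (fun k => Set.inter_subset_left) (fun k l hkl => ?_) ?_ fun k => ?_
  · have h1 : Continuous fun y : EuclideanSpace ℝ (Fin d) =>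
        Complex.exp ((inner ℝ y u : ℝ) * Complex.I) := by fun_prop
    exact (h1.measurable.comp (hYm n)).aestronglyMeasurable
  · rw [Complex.norm_exp_ofReal_mul_I]
  · have hkl' : (k : ℝ) ≤ l := by exact_mod_cast hkl
    refine Set.inter_subset_inter_right _ (Set.inter_subset_inter ?_ fun ω h => ?_)
    · intro ω h
      simp only [Set.mem_iInter] at h ⊢
      intro n hn
      exact dissipativeMatrices_mono (by gcongr) (by gcongr) (h n (by omega))
    · exact le_trans h hkl'
  · filter_upwards [hHlim] with ω h hω
    obtain ⟨h1, h2, h3⟩ := h hω.1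
    obtain ⟨k1, hk1⟩ := exists_forall_ge_mem_dissipativeMatrices h1 h2 h3
    obtain ⟨k2, hk2⟩ := exists_nat_ge (V ω)
    refine ⟨max k1 k2, hω, ?_, hk2.trans (by exact_mod_cast le_max_right _ _)⟩
    simp only [Set.mem_iInter]
    intro n hn
    have hk : (k1 : ℝ) ≤ (max k1 k2 : ℕ) := by exact_mod_cast le_max_left _ _
    exact dissipativeMatrices_mono (by gcongr) (by gcongr)
      (hk1 n (by have := le_max_left k1 k2; omega))
  · have hl : (0 : ℝ) < 1 / ((k : ℝ) + 1) := by positivity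
    have hl1 : 1 / ((k : ℝ) + 1) ≤ 1 := by
      rw [div_le_one (by positivity)]
      linarith [(Nat.cast_nonneg k : (0 : ℝ) ≤ k)]
    have hΛ1 : 1 ≤ (k : ℝ) + 1 := by linarith [(Nat.cast_nonneg k : (0 : ℝ) ≤ k)]
    -- `S k` depends on the future, so restricting to it would destroy predictability. Truncating
    -- each `H_n` by its own value keeps it `ℱ (n₀ n)`-measurable and dissipative everywhere, and
    -- changes nothing on `S k` once `n ≥ k + 1`.
    set T : ℕ → Ω → Matrix (Fin d) (Fin d) ℝ := fun n ω =>
      dissipativeOrNegOne (1 / ((k : ℝ) + 1)) (k + 1) (H n ω) with hT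
    have hTmem : ∀ n ω, T n ω ∈ dissipativeMatrices d (1 / ((k : ℝ) + 1)) (k + 1) := fun n ω =>
      dissipativeOrNegOne_mem hl1 hΛ1 _
    have hTeq : ∀ ω ∈ S k, ∀ n, k + 1 ≤ n → T n ω = H n ω := fun ω hω n hn => by
      have := hω.2.1
      simp only [Set.mem_iInter] at this
      exact dissipativeOrNegOne_of_mem (this n hn)
    have hSA : ∀ ω, ω ∈ S k → ω ∈ A := fun ω hω => hω.1.1
    set g : ℕ → ℕ → Ω → EuclideanSpace ℝ (Fin d) := fun n i ω =>
      Matrix.toEuclideanCLM (𝕜 := ℝ) (matProdBar γ b (T n ω) i n).transpose u with hg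
    obtain ⟨R, hR⟩ := exists_norm_matProdBar_le hγ_anti hγ_zero hb hnγ hbγ hl (d := d)
      ((k : ℝ) + 1)
    have hmain := tendsto_setIntegral_exp_weighted (P := P) (ℱ := ℱ) (g := g) (g' := g')
      (ρ := R * ‖u‖) (C := k) hn₀_lt hn₀_top hb hδ hLev hwL hD_adapted hD_sq hD_mart (hSm k)
      (hD_cov.mono fun ω h hω => h (hSA ω hω))
      -- The Lindeberg condition passes from `A` to the smaller event `S k`.
      (fun ε hε η hη => tendsto_of_tendsto_of_tendsto_of_le_of_le tendsto_const_nhds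
        (hD_lindeberg ε hε η hη) (fun _ => zero_le)
        fun _ => Measure.restrict_mono hSA le_rfl _)
      ?_ ?_ ?_ hVm (Nat.cast_nonneg k) ?_ (ae_of_all _ fun ω _ => hVg ω)
    · have hrhs : ∫ ω in S k, charFun (gaussianImageKernel (fun ω => (Hlim ω)⁻¹) Γ
          (measurable_inv_matrix Hlim hHlim_meas) hΓ_meas ω) u ∂P
          = ∫ ω in S k, (Real.exp (-(V ω / 2)) : ℂ) ∂P :=
        setIntegral_congr_ae (hSm k) (hchar.mono fun ω h hω => h (hSA ω hω))
      rw [hrhs]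
      refine hmain.congr' ?_
      filter_upwards [hn₀_lt, eventually_ge_atTop (k + 1)] with n h1 h2
      refine setIntegral_congr_fun (hSm k) fun ω hω => ?_
      simp only [hg, hTeq ω hω n h2]
      rw [inner_scaled_xiSeq hb h1]
    · intro n i hn
      have h1 : Continuous fun M : Matrix (Fin d) (Fin d) ℝ =>
          Matrix.toEuclideanCLM (𝕜 := ℝ) (matProdBar γ b M i n).transpose u :=
        (continuous_toEuclideanCLM_apply u).comp (continuous_matProdBar γ b i n).matrix_transpose
      exact (measurable_comp_of_entries (m := ℱ (n₀ n))
        (measurable_dissipativeOrNegOne (m := ℱ (n₀ n)) (hH_meas n hn)) h1).stronglyMeasurable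
    · filter_upwards [hn₀_top.eventually (eventually_forall_ge_atTop.2 hR)] with n h1 i hi ω
      have hi' := Finset.mem_Ioc.1 hi
      refine (norm_toEuclideanCLM_transpose_le _ u).trans ?_
      gcongr
      exact h1 i hi'.1.le n hi'.2 _ (hTmem n ω)
    · filter_upwards [hHlim] with ω h hω ε hε
      obtain ⟨-, h2, h3⟩ := h (hSA ω hω)
      have hTlim : Tendsto (fun n => T n ω) atTop (𝓝 (Hlim ω)) := h3.congr' (by
        filter_upwards [eventually_ge_atTop (k + 1)] with n hn using (hTeq ω hω n hn).symm)
      filter_upwards [eventually_norm_matProdBar_add_inv_le hγ_anti hγ_zero hn₀_top hb hnγ hbγ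
        (hLev.mono fun n h => h.2) hL3 hl (Eventually.of_forall fun n => hTmem n ω)
        (isUnit_of_spectrum_neg h2) hTlim (ε := ε / (‖u‖ + 1)) (by positivity)] with n h4 i hi
      have h5 : g n i ω - g' ω = Matrix.toEuclideanCLM (𝕜 := ℝ)
          (matProdBar γ b (T n ω) i n + (Hlim ω)⁻¹).transpose u := by
        rw [hg, hg', Matrix.transpose_add, map_add]
        simp
      rw [h5]
      refine (norm_toEuclideanCLM_transpose_le _ u).trans ?_
      calc _ ≤ ε / (‖u‖ + 1) * ‖u‖ := by gcongr; exact h4 i hi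
        _ ≤ ε := by
          rw [div_mul_eq_mul_div, div_le_iff₀ (by positivity)]
          nlinarith [norm_nonneg u]
    · filter_upwards [hV0] with ω h hω
      exact ⟨h (hSA ω hω), hω.2.2⟩
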